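/- All graphs are finite and simple. A clique (stable set) is a set of pairwise adjacent (non-adjacent) vertices; maximal means inclusion-maximal. The line graph $L(H)$ has the edges of $H$ as vertices, two distinct edges being adjacent iff they share an endpoint; a line graph is a graph isomorphic to some $L(H)$. For a graph property $\mathcal P$, a graph $G$ is $\cap$-$\mathcal P$ if both $G$ and its complement $\overline G$ have property $\mathcal P$. A graph $G=(V,E)$ is called - CIS if every maximal clique and every maximal stable set of $G$ intersect; - general partition if there are a set $U$ and non-empty sets $U_x\subseteq U$ $(x\in V)$ such that distinct $x,y$ are adjacent iff $U_x\cap U_y\ne\emptyset$, and for every maximal stable set $S$ the family $\{U_x : x\in S\}$ is a partition of $U$; - semi-weakly CIS if there is a family of strong cliques such that every edge of $G$ has both endpoints in some member of the family, where a clique is strong if it meets all maximal stable sets of $G$; - strongly equistable if for every non-empty $T\subseteq V$ that is not a maximal stable set and every real $\gamma\le 1$ there is $\varphi:V\to\mathbb R_{\ge 0}$ with $\sum_{v\in S}\varphi(v)=1$ for every maximal stable set $S$ and $\sum_{v\in T}\varphi(v)\neq\gamma$; - equistable if there is $\varphi:V\to\mathbb R_{\ge 0}$ such that for all $S\subseteq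 V$, $S$ is a maximal stable set iff $\sum_{v\in S}\varphi(v)=1$; - triangle if for every maximal stable set $S$ and every edge $uv$ with $u,v\notin S$ some $s\in S$ is adjacent to both $u$ and $v$. The bull is the graph with vertices $a,b,c,d,e$ and edges $ab,bc,cd,be,ce$. Subgraphs need not be induced. For a vertex $x$ of $H$, $N(x)$ is its set of neighbors, and $H(x)$ is the subgraph of $H$ formed by all edges of $H$ (with their endpoints) that are incident with a neighbor of $x$ but not with $x$. **Theorem.** Let $G$ be a graph with at least one vertex that is isomorphic to the line graph $L(H)$ of a graph $H$. The following conditions are equivalent: 1. $G$ is CIS; 2. $G$ is $\cap$-general partition; 3. $G$ is $\cap$-semi-weakly CIS; 4. $G$ is $\cap$-strongly equistable; 5. $G$ is $\cap$-equistable; 6. $G$ is $\cap$-triangle; 7. no subgraph of $H$ is isomorphic to a bull, and for every maximal matching $M$ of $H$ and every vertex $x$ of $H$ not covered by $M$, $N(x)$ is contained in some edge of $M$; 8. no subgraph of $H$ is isomorphic to a bull, and for every vertex $x$ of $H$, every matching in $H(x)$ with at least two edges misses some neighbor of $x$. Moreover, CIS line graphs can be recognized in polynomial time: there is an algorithm that,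 given the adjacency matrix of an arbitrary graph $G$ on $n$ vertices, decides in a number of steps polynomial in $n$ (on a unit-cost random access machine with addition and truncated subtraction) whether $G$ is a line graph that is CIS. -/

import Mathlib

namespace CISGraph

universe u v

/-! ### Graph classes -/

section Classes

variable {V : Type u}

/-- `C` is an inclusion-maximal clique of `G`. -/
def IsMaxClique (G : SimpleGraph V) (C : Set V) : Prop :=
  Maximal (fun X : Set V => G.IsClique X) C

/-- `S` is an inclusion-maximal stable (independent) set of `G`. -/
def IsMaxStable (G : SimpleGraph V) (S : Set V) : Prop :=
  Maximal (fun X : Set V => G.IsIndepSet X) S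

/-- `G` is CIS: every maximal clique meets every maximal stable set. -/
def IsCIS (G : SimpleGraph V) : Prop :=
  ∀ C S : Set V, IsMaxClique G C → IsMaxStable G S → (C ∩ S).Nonempty

/-- `G` is a general partition graph. -/
def IsGeneralPartition (G : SimpleGraph V) : Prop :=
  ∃ (U : Type u) (A : V → Set U),
    (∀ x, (A x).Nonempty) ∧
    (∀ x y, x ≠ y → (G.Adj x y ↔ (A x ∩ A y).Nonempty)) ∧
    ∀ S : Set V, IsMaxStable G S → Setoid.IsPartition {B : Set U | ∃ x ∈ S, A x = B}

/-- A strong clique: a clique that meets all maximal stable sets. -/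
def IsStrongClique (G : SimpleGraph V) (C : Set V) : Prop :=
  G.IsClique C ∧ ∀ S : Set V, IsMaxStable G S → (C ∩ S).Nonempty

/-- `G` is semi-weakly CIS: it has an edge covering family of strong cliques. -/
def IsSemiWeaklyCIS (G : SimpleGraph V) : Prop :=
  ∃ F : Set (Set V), (∀ C ∈ F, IsStrongClique G C) ∧
    ∀ x y, G.Adj x y → ∃ C ∈ F, x ∈ C ∧ y ∈ C

/-- `G` (a finite graph) is strongly equistable: for every nonempty set `T` of vertices that is not
a maximal stable set and every `γ ≤ 1`, some nonnegative weight function gives weight `1` to all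
maximal stable sets and a weight different from `γ` to `T`. -/
def IsStronglyEquistable (G : SimpleGraph V) : Prop :=
  ∀ T : Finset V, T.Nonempty → ¬ IsMaxStable G (T : Set V) → ∀ γ : ℝ, γ ≤ 1 →
    ∃ φ : V → ℝ, (∀ v, 0 ≤ φ v) ∧
      (∀ S : Finset V, IsMaxStable G (S : Set V) → ∑ v ∈ S, φ v = 1) ∧
      ∑ v ∈ T, φ v ≠ γ

/-- `G` (a finite graph) is equistable: for some nonnegative weight function, the maximal stable
sets are exactly the vertex sets of weight `1`. -/
def IsEquistable (G : SimpleGraph V) : Prop :=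
  ∃ φ : V → ℝ, (∀ v, 0 ≤ φ v) ∧
    ∀ S : Finset V, IsMaxStable G (S : Set V) ↔ ∑ v ∈ S, φ v = 1

/-- `G` is a triangle graph: for every maximal stable set `S` and every edge `uv` of `G - S`, some
vertex of `S` forms a triangle with `u` and `v`. -/
def IsTriangle (G : SimpleGraph V) : Prop :=
  ∀ S : Set V, IsMaxStable G S → ∀ u v, u ∉ S → v ∉ S → G.Adj u v →
    ∃ s ∈ S, G.Adj u s ∧ G.Adj v s

/-- `∩`-`P`: both `G` and its complement have the property `P`. -/
def Cap (P : SimpleGraph V → Prop) (G : SimpleGraph V) : Prop :=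
  P G ∧ P Gᶜ

/-- `G` is (isomorphic to) the line graph of some finite graph. -/
def IsLineGraph (G : SimpleGraph V) : Prop :=
  ∃ (W : Type u) (_ : Finite W) (H : SimpleGraph W), Nonempty (G ≃g H.lineGraph)

end Classes

/-! ### Conditions on the root graph -/

section Root

variable {W : Type v}

/-- The bull: the path `0 1 2 3` and a vertex `4` adjacent to `1` and `2`. -/
def bull : SimpleGraph (Fin 5) :=
  SimpleGraph.fromEdgeSet {s(0, 1), s(1, 2), s(2, 3), s(1, 4), s(2, 4)}

/-- `M` is an inclusion-maximal matching of `H`. -/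
def IsMaxMatching {H : SimpleGraph W} (M : H.Subgraph) : Prop :=
  Maximal (fun N : H.Subgraph => N.IsMatching) M

/-- For every maximal matching `M` and every vertex `x` not covered by `M`, the neighborhood of `x`
is contained in some edge of `M`. -/
def MaxMatchingCondition (H : SimpleGraph W) : Prop :=
  ∀ M : H.Subgraph, IsMaxMatching M → ∀ x, x ∉ M.verts →
    ∃ e ∈ M.edgeSet, ∀ y ∈ H.neighborSet x, y ∈ e

/-- The graph `H(x)`: the subgraph of `H` formed by all edges incident with a neighbor of `x` but
not with `x` (and the endpoints of these edges). -/
def localSubgraph (H : SimpleGraph W) (x : W) : H.Subgraph where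
  verts := {a | ∃ b, H.Adj a b ∧ a ≠ x ∧ b ≠ x ∧ (H.Adj x a ∨ H.Adj x b)}
  Adj a b := H.Adj a b ∧ a ≠ x ∧ b ≠ x ∧ (H.Adj x a ∨ H.Adj x b)
  adj_sub h := h.1
  edge_vert {_ b} h := ⟨b, h⟩
  symm := ⟨fun _ _ h => ⟨h.1.symm, h.2.2.1, h.2.1, h.2.2.2.symm⟩⟩

/-- For every vertex `x`, every matching of `H(x)` with at least two edges misses some neighbor
of `x`. -/
def LocalMatchingCondition (H : SimpleGraph W) : Prop :=
  ∀ x, ∀ M : H.Subgraph, M ≤ localSubgraph H x → M.IsMatching → 2 ≤ M.edgeSet.encard →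
    ∃ y ∈ H.neighborSet x, y ∉ M.verts

end Root

/-! ### Machine model: a unit-cost random access machine

Programs are built from assignments, tests and loops over registers and two-dimensional arrays that
hold natural numbers. The only arithmetic operations are addition and truncated subtraction, so that
the numbers stay of polynomial bit length within polynomially many steps: polynomial time on this
machine is polynomial time on a Turing machine. -/

/-- Expressions: constants, registers, array entries (the number of the array is fixed in the
program, its two indices are computed), sum, and truncated difference. -/
inductive Expr : Type
  | const (c : ℕ) : Expr
  | reg (r : ℕ) : Expr
  | entry (a : ℕ) (i j : Expr) : Expr
  | add (e₁ e₂ : Expr) : Expr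
  | sub (e₁ e₂ : Expr) : Expr

/-- Programs. A test succeeds when its expression has a nonzero value. -/
inductive Prog : Type
  | skip : Prog
  | setReg (r : ℕ) (e : Expr) : Prog
  | setEntry (a : ℕ) (i j e : Expr) : Prog
  | seq (p q : Prog) : Prog
  | ite (e : Expr) (p q : Prog) : Prog
  | loop (e : Expr) (p : Prog) : Prog

/-- The contents of the memory. -/
@[ext] structure Store : Type where
  reg : ℕ → ℕ
  arr : ℕ → ℕ → ℕ → ℕ

/-- The value of an expression. -/
def Expr.eval (s : Store) : Expr → ℕ
  | .const c => c
  | .reg r => s.reg r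
  | .entry a i j => s.arr a (i.eval s) (j.eval s)
  | .add e₁ e₂ => e₁.eval s + e₂.eval s
  | .sub e₁ e₂ => e₁.eval s - e₂.eval s

/-- Write `x` to register `r`. -/
def Store.setReg (s : Store) (r x : ℕ) : Store where
  reg k := if k = r then x else s.reg k
  arr := s.arr

/-- Write `x` to the entry `(i, j)` of the array `a`. -/
def Store.setEntry (s : Store) (a i j x : ℕ) : Store where
  reg := s.reg
  arr b k l := if b = a ∧ k = i ∧ l = j then x else s.arr b k l

/-- `Exec p s s' t`: the program `p`, started with memory contents `s`, halts after exactly `t` steps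
with memory contents `s'`. Each assignment, each `skip` and each evaluation of a test is one step
(the expressions of a fixed program have bounded size). -/
inductive Exec : Prog → Store → Store → ℕ → Prop
  | skip (s : Store) : Exec .skip s s 1
  | setReg (r : ℕ) (e : Expr) (s : Store) :
      Exec (.setReg r e) s (s.setReg r (e.eval s)) 1
  | setEntry (a : ℕ) (i j e : Expr) (s : Store) :
      Exec (.setEntry a i j e) s (s.setEntry a (i.eval s) (j.eval s) (e.eval s)) 1
  | seq {p q : Prog} {s s' s'' : Store} {t t' : ℕ} :
      Exec p s s' t → Exec q s' s'' t' → Exec (.seq p q) s s'' (t + t')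
  | ite_true {e : Expr} {p q : Prog} {s s' : Store} {t : ℕ} :
      e.eval s ≠ 0 → Exec p s s' t → Exec (.ite e p q) s s' (t + 1)
  | ite_false {e : Expr} {p q : Prog} {s s' : Store} {t : ℕ} :
      e.eval s = 0 → Exec q s s' t → Exec (.ite e p q) s s' (t + 1)
  | loop_done {e : Expr} {p : Prog} {s : Store} :
      e.eval s = 0 → Exec (.loop e p) s s 1
  | loop_step {e : Expr} {p : Prog} {s s' s'' : Store} {t t' : ℕ} :
      e.eval s ≠ 0 → Exec p s s' t → Exec (.loop e p) s' s'' t' →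
        Exec (.loop e p) s s'' (t + t' + 1)

/-- Execution is deterministic: the final memory contents and the number of steps are determined by
the program and the initial memory contents. -/
theorem Exec.deterministic {p : Prog} {s s₁ s₂ : Store} {t₁ t₂ : ℕ}
    (h₁ : Exec p s s₁ t₁) (h₂ : Exec p s s₂ t₂) : s₁ = s₂ ∧ t₁ = t₂ := by
  induction h₁ generalizing s₂ t₂ with
  | skip => cases h₂; exact ⟨rfl, rfl⟩
  | setReg => cases h₂; exact ⟨rfl, rfl⟩
  | setEntry => cases h₂; exact ⟨rfl, rfl⟩
  | seq _ _ ih ih' =>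
    cases h₂ with
    | seq a b =>
      obtain ⟨rfl, rfl⟩ := ih a
      obtain ⟨rfl, rfl⟩ := ih' b
      exact ⟨rfl, rfl⟩
  | ite_true h _ ih =>
    cases h₂ with
    | ite_true _ a => obtain ⟨rfl, rfl⟩ := ih a; exact ⟨rfl, rfl⟩
    | ite_false h' _ => exact absurd h' h
  | ite_false h _ ih =>
    cases h₂ with
    | ite_true h' _ => exact absurd h h'
    | ite_false _ a => obtain ⟨rfl, rfl⟩ := ih a; exact ⟨rfl, rfl⟩
  | loop_done h =>
    cases h₂ with
    | loop_done => exact ⟨rfl, rfl⟩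
    | loop_step h' _ _ => exact absurd h h'
  | loop_step h _ _ ih ih' =>
    cases h₂ with
    | loop_done h' => exact absurd h' h
    | loop_step _ a b =>
      obtain ⟨rfl, rfl⟩ := ih a
      obtain ⟨rfl, rfl⟩ := ih' b
      exact ⟨rfl, rfl⟩

open Classical in
/-- The input for a graph `G` with vertices `0, …, n - 1`: register `0` holds `n`, array `0` holds the
adjacency matrix of `G`, and everything else is `0`. -/
noncomputable def inputStore {n : ℕ} (G : SimpleGraph (Fin n)) : Store where
  reg k := if k = 0 then n else 0
  arr a i j :=
    if a = 0 ∧ ∃ (hi : i < n) (hj : j < n), G.Adj ⟨i, hi⟩ ⟨j, hj⟩ then 1 else 0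

/-- The graph class `P` can be recognized in polynomial time: a single program halts on every finite
graph `G`, after a number of steps that is at most a polynomial in the number of vertices of `G`, and
register `0` then holds `1` if and only if `G` belongs to the class. -/
def PolyTimeRecognizable (P : ∀ {n : ℕ}, SimpleGraph (Fin n) → Prop) : Prop :=
  ∃ (p : Prog) (f : Polynomial ℕ), ∀ (n : ℕ) (G : SimpleGraph (Fin n)),
    ∃ (s : Store) (t : ℕ), Exec p (inputStore G) s t ∧ t ≤ f.eval n ∧ (s.reg 0 = 1 ↔ P G)

end CISGraph

/-! Conditions 1 to 6 are linked by implications valid for all finite nonempty graphs, and the root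
graph closes the cycle. In a CIS graph every maximal clique is strong, and CIS is
self-complementary. Strong cliques containing a vertex `x` serve as the set `U_x` of a general
partition. Their indicator functions are weightings that give every maximal stable set weight 1, and
there are enough of them for strong equistability. Mixing weightings gives equistability, and an
exchange argument inside a maximal stable set gives the triangle property. For a line graph, stable
sets are matchings and cliques are stars or triangles. The triangle property of `G` controls the
vertices missed by a maximal matching, that of the complement excludes bulls
(`missCondition_of_isTriangle`, `bull_free_of_isTriangle_compl`). Conversely, a maximal clique
disjoint from a maximal stable set is a star, refuted by the local matching condition, or a
triangle, refuted by bull-freeness (`isCIS_of_bull_free`). For the algorithm, the CIS line graphs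
are described by a fixed formula `Admissible` that quantifies over vertices and compares one pair of
cardinalities; nested loops evaluate it in polynomial time (`dec_admissible`). The formula says that
each vertex lies in a component that is the line graph of a diamond or of `K_4` (`OctahedralAt`), or
in one that is the line graph of a balanced complete bipartite graph (`RookAt`), or else that the
cliques at the vertex lie in closed neighborhoods of simplicial vertices, with two local conditions.
Admissible graphs are CIS because maximal cliques of each of the three kinds meet all maximal stable
sets, and they are line graphs because each component has an explicit root graph
(`hasLocalRoot_of_covered` is the main case). In the other direction, bull-freeness makes every
triangle of the root pendant or part of a component on four vertices. A star not caught by a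
simplicial vertex is centered at an inner vertex (`IsInner`), and exchanging edges in maximal
matchings shows that its component is balanced complete bipartite (`IsInner.rookAt`). -/

namespace CISGraph

universe u v

/-! ### Maximal cliques and maximal stable sets -/

section Maximal

variable {V : Type u} {G : SimpleGraph V}

theorem exists_isMaxStable_superset [Finite V] {S : Set V} (h : G.IsIndepSet S) :
    ∃ T, S ⊆ T ∧ IsMaxStable G T :=
  Finite.exists_le_maximal (p := fun X : Set V => G.IsIndepSet X) h

theorem exists_isMaxClique_superset [Finite V] {C : Set V} (h : G.IsClique C) :
    ∃ D, C ⊆ D ∧ IsMaxClique G D :=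
  Finite.exists_le_maximal (p := fun X : Set V => G.IsClique X) h

theorem isMaxClique_compl {C : Set V} : IsMaxClique Gᶜ C ↔ IsMaxStable G C := by
  simp [IsMaxClique, IsMaxStable]

theorem isMaxStable_compl {C : Set V} : IsMaxStable Gᶜ C ↔ IsMaxClique G C := by
  simp [IsMaxClique, IsMaxStable]

theorem IsMaxStable.not_adj {S : Set V} (h : IsMaxStable G S) {x y : V} (hx : x ∈ S)
    (hy : y ∈ S) : ¬ G.Adj x y := fun hxy => h.1 hx hy hxy.ne hxy

theorem IsMaxStable.mem_of_forall_not_adj {S : Set V} (h : IsMaxStable G S) {x : V}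
    (hx : ∀ y ∈ S, ¬ G.Adj x y) : x ∈ S := by
  have h1 : G.IsIndepSet (insert x S) := by
    refine Set.Pairwise.insert h.1 fun y hy _ => ⟨hx y hy, fun h' => hx y hy h'.symm⟩
  exact h.2 h1 (Set.subset_insert x S) (Set.mem_insert x S)

theorem IsMaxStable.exists_adj {S : Set V} (h : IsMaxStable G S) {x : V} (hx : x ∉ S) :
    ∃ y ∈ S, G.Adj x y := by
  by_contra! h'
  exact hx (h.mem_of_forall_not_adj h')

theorem isMaxStable_of {S : Set V} (h : ∀ x ∈ S, ∀ y ∈ S, ¬ G.Adj x y)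
    (h' : ∀ x, x ∉ S → ∃ y ∈ S, G.Adj x y) : IsMaxStable G S := by
  refine ⟨fun x hx y hy _ => h x hx y hy, fun T hT hST x hx => ?_⟩
  by_contra hxS
  obtain ⟨y, hy, hxy⟩ := h' x hxS
  exact hT hx (hST hy) hxy.ne hxy

theorem IsMaxStable.nonempty [Nonempty V] {S : Set V} (h : IsMaxStable G S) : S.Nonempty := by
  by_contra h0
  rw [Set.not_nonempty_iff_eq_empty] at h0
  have x : V := Classical.arbitrary V
  have := h.mem_of_forall_not_adj (x := x) (by simp [h0])
  simp [h0] at this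

theorem IsMaxClique.mem_of_forall_adj {C : Set V} (h : IsMaxClique G C) {x : V}
    (hx : ∀ y ∈ C, x ≠ y → G.Adj x y) : x ∈ C := by
  have h1 : G.IsClique (insert x C) :=
    Set.Pairwise.insert h.1 fun y hy hxy => ⟨hx y hy hxy, (hx y hy hxy).symm⟩
  exact h.2 h1 (Set.subset_insert x C) (Set.mem_insert x C)

theorem IsMaxClique.nonempty [Nonempty V] {C : Set V} (h : IsMaxClique G C) : C.Nonempty := by
  by_contra h0
  rw [Set.not_nonempty_iff_eq_empty] at h0
  have x : V := Classical.arbitrary V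
  have := h.mem_of_forall_adj (x := x) (by simp [h0])
  simp [h0] at this

theorem IsCIS.compl (h : IsCIS G) : IsCIS Gᶜ := fun C S hC hS => by
  rw [Set.inter_comm]
  exact h S C (isMaxStable_compl.1 hS) (isMaxClique_compl.1 hC)

end Maximal

/-! ### Implications that hold for all finite graphs -/

section General

variable {V : Type u} {G : SimpleGraph V}

theorem IsStrongClique.eq_of_mem {C S : Set V} (hC : IsStrongClique G C) (hS : IsMaxStable G S)
    {x y : V} (hxC : x ∈ C) (hxS : x ∈ S) (hyC : y ∈ C) (hyS : y ∈ S) : x = y := by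
  by_contra h
  exact hS.1 hxS hyS h (hC.1 hxC hyC h)

theorem IsCIS.isSemiWeaklyCIS [Finite V] (h : IsCIS G) : IsSemiWeaklyCIS G := by
  refine ⟨{C | IsMaxClique G C}, fun C hC => ⟨hC.1, fun S hS => h C S hC hS⟩, fun x y hxy => ?_⟩
  obtain ⟨D, hD, hD'⟩ := exists_isMaxClique_superset (G := G) (C := {x, y}) (by
    rw [SimpleGraph.isClique_pair]; exact fun _ => hxy)
  exact ⟨D, hD', hD (by simp), hD (by simp)⟩

/-- Each point `u` of the ground set gives the clique of all `x` with `u ∈ A x`. It is strong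
because the sets belonging to a maximal stable set cover `u`. -/
theorem IsGeneralPartition.isSemiWeaklyCIS (h : IsGeneralPartition G) : IsSemiWeaklyCIS G := by
  obtain ⟨U, A, -, hA, hS⟩ := h
  refine ⟨Set.range fun u => {x | u ∈ A x}, ?_, fun x y hxy => ?_⟩
  · rintro _ ⟨u, rfl⟩
    refine ⟨fun x hx y hy hxy => (hA x y hxy).2 ⟨u, hx, hy⟩, fun S hS' => ?_⟩
    obtain ⟨_, ⟨⟨x, hx, rfl⟩, hu⟩, -⟩ := (hS S hS').2 u
    exact ⟨x, hu, hx⟩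
  · obtain ⟨u, hux, huy⟩ := (hA x y hxy.ne).1 hxy
    exact ⟨_, ⟨u, rfl⟩, hux, huy⟩

theorem IsSemiWeaklyCIS.exists_mem (h : IsSemiWeaklyCIS G) (x : V) :
    ∃ C, IsStrongClique G C ∧ x ∈ C := by
  obtain ⟨F, hF, hF'⟩ := h
  by_cases hx : ∃ y, G.Adj x y
  · obtain ⟨y, hxy⟩ := hx
    obtain ⟨C, hC, hxC, -⟩ := hF' x y hxy
    exact ⟨C, hF C hC, hxC⟩
  · push Not at hx
    exact ⟨{x}, ⟨by simp, fun S hS => ⟨x, rfl, hS.mem_of_forall_not_adj fun y _ => hx y⟩⟩, rfl⟩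

theorem IsSemiWeaklyCIS.exists_mem_of_adj (h : IsSemiWeaklyCIS G) {x y : V} (hxy : G.Adj x y) :
    ∃ C, IsStrongClique G C ∧ x ∈ C ∧ y ∈ C := by
  obtain ⟨F, hF, hF'⟩ := h
  obtain ⟨C, hC, hC'⟩ := hF' x y hxy
  exact ⟨C, hF C hC, hC'⟩

/-- The ground set consists of all strong cliques, and `x` receives those that contain it. A maximal
stable set meets each strong clique in exactly one vertex, which is the partition property. -/
theorem IsSemiWeaklyCIS.isGeneralPartition (h : IsSemiWeaklyCIS G) : IsGeneralPartition G := by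
  refine ⟨{C : Set V // IsStrongClique G C}, fun x => {C | x ∈ C.1}, fun x => ?_, fun x y hxy => ?_,
    fun S hS => ⟨?_, ?_⟩⟩
  · obtain ⟨C, hC, hx⟩ := h.exists_mem x
    exact ⟨⟨C, hC⟩, hx⟩
  · constructor
    · intro hadj
      obtain ⟨C, hC, hx, hy⟩ := h.exists_mem_of_adj hadj
      exact ⟨⟨C, hC⟩, hx, hy⟩
    · rintro ⟨C, hx, hy⟩
      exact C.2.1 hx hy hxy
  · rintro ⟨x, -, hx⟩
    obtain ⟨C, hC, hxC⟩ := h.exists_mem x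
    have : (⟨C, hC⟩ : {C : Set V // IsStrongClique G C}) ∈ (∅ : Set _) := hx ▸ hxC
    exact this
  · rintro ⟨C, hC⟩
    obtain ⟨x, hxC, hxS⟩ := hC.2 S hS
    refine ⟨_, ⟨⟨x, hxS, rfl⟩, hxC⟩, ?_⟩
    rintro _ ⟨⟨y, hyS, rfl⟩, hyC⟩
    rw [hC.eq_of_mem hS hxC hxS hyC hyS]

theorem IsStrongClique.sum_indicator {C : Set V} (hC : IsStrongClique G C) (S : Finset V)
    (hS : IsMaxStable G (S : Set V)) : ∑ v ∈ S, C.indicator (fun _ => (1 : ℝ)) v = 1 := by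
  obtain ⟨x, hxC, hxS⟩ := hC.2 S hS
  rw [Finset.sum_eq_single_of_mem x hxS]
  · simp [hxC]
  · intro y hyS hyx
    refine Set.indicator_of_notMem (fun hyC => hyx ?_) _
    exact hC.eq_of_mem hS hyC hyS hxC hxS

/-- The weightings used are indicators of strong cliques. If all of them gave `T` the weight `γ ≤
1`, then a strong clique through a vertex of `T` would force `γ = 1`. So `T` would meet every strong
clique exactly once, and this makes it a maximal stable set. -/
theorem IsSemiWeaklyCIS.isStronglyEquistable (h : IsSemiWeaklyCIS G) :
    IsStronglyEquistable G := by
  classical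
  intro T hT hTS γ hγ
  by_contra! H
  have key : ∀ C, IsStrongClique G C → ∑ v ∈ T, C.indicator (fun _ => (1 : ℝ)) v = γ :=
    fun C hC => H _ (fun v => Set.indicator_nonneg (fun _ _ => zero_le_one) v) hC.sum_indicator
  have hnn : ∀ C : Set V, ∀ v ∈ T, 0 ≤ C.indicator (fun _ => (1 : ℝ)) v :=
    fun C v _ => Set.indicator_nonneg (fun _ _ => zero_le_one) v
  have hγ1 : γ = 1 := by
    obtain ⟨x, hx⟩ := hT
    obtain ⟨C, hC, hxC⟩ := h.exists_mem x
    refine le_antisymm hγ ?_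
    rw [← key C hC]
    refine le_trans ?_ (Finset.single_le_sum (hnn C) hx)
    simp [hxC]
  subst hγ1
  refine hTS (isMaxStable_of (fun x hx y hy hxy => ?_) fun x hx => ?_)
  · obtain ⟨C, hC, hxC, hyC⟩ := h.exists_mem_of_adj hxy
    have h1 := key C hC
    have h2 : ∑ v ∈ ({x, y} : Finset V), C.indicator (fun _ => (1 : ℝ)) v ≤ 1 := by
      refine le_trans (Finset.sum_le_sum_of_subset_of_nonneg ?_ fun v hv _ => hnn C v hv) h1.le
      intro z hz
      simp only [Finset.mem_insert, Finset.mem_singleton] at hz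
      rcases hz with rfl | rfl
      · exact hx
      · exact hy
    rw [Finset.sum_pair hxy.ne] at h2
    simp only [hxC, hyC, Set.indicator_of_mem] at h2
    norm_num at h2
  · obtain ⟨C, hC, hxC⟩ := h.exists_mem x
    by_contra! hno
    have h1 := key C hC
    rw [Finset.sum_eq_zero] at h1
    · exact zero_ne_one h1
    · intro y hy
      refine Set.indicator_of_notMem (fun hyC => ?_) _
      exact hno y hy (hC.1 hxC hyC fun e => hx (e ▸ hy))

/-- Admissible weightings form a convex set. Finitely many sets `T` have to be kept away from weight
1, and a generic convex combination does this for all of them at once. -/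
theorem IsStronglyEquistable.isEquistable [Finite V] [Nonempty V] (h : IsStronglyEquistable G) :
    IsEquistable G := by
  classical
  have : Fintype V := Fintype.ofFinite V
  let P : (V → ℝ) → Prop := fun φ => (∀ v, 0 ≤ φ v) ∧
      ∀ S : Finset V, IsMaxStable G (S : Set V) → ∑ v ∈ S, φ v = 1
  have main : ∀ 𝒯 : Finset (Finset V), 𝒯.Nonempty →
      (∀ T ∈ 𝒯, T.Nonempty ∧ ¬ IsMaxStable G (T : Set V)) →
      ∃ φ, P φ ∧ ∀ T ∈ 𝒯, ∑ v ∈ T, φ v ≠ 1 := by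
    intro 𝒯 h0
    induction h0 using Finset.Nonempty.cons_induction with
    | singleton T =>
      intro hT
      obtain ⟨φ, h1, h2, h3⟩ := h T (hT T (by simp)).1 (hT T (by simp)).2 1 le_rfl
      exact ⟨φ, ⟨h1, h2⟩, by simpa using h3⟩
    | cons T 𝒯 hT𝒯 _ ih =>
      intro hT
      obtain ⟨φ, hφ, hφ'⟩ := ih fun T' hT' => hT T' (by simp [hT'])
      obtain ⟨ψ, h1, h2, h3⟩ := h T (hT T (by simp)).1 (hT T (by simp)).2 1 le_rfl
      have hlin : ∀ (ε : ℝ) (X : Finset V), ∑ v ∈ X, ((1 - ε) * φ v + ε * ψ v) =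
          (1 - ε) * ∑ v ∈ X, φ v + ε * ∑ v ∈ X, ψ v := by
        intro ε X
        rw [Finset.sum_add_distrib, Finset.mul_sum, Finset.mul_sum]
      -- The weight of `T'` is affine in `ε` and differs from 1 at `ε = 0` or at `ε = 1`, hence it
      -- equals 1 for at most one `ε`.
      have hfin : ∀ T' ∈ Finset.cons T 𝒯 hT𝒯,
          {ε : ℝ | ∑ v ∈ T', ((1 - ε) * φ v + ε * ψ v) = 1}.Finite := by
        intro T' hT'
        have hor : ∑ v ∈ T', φ v ≠ 1 ∨ ∑ v ∈ T', ψ v ≠ 1 := by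
          rcases Finset.mem_cons.1 hT' with rfl | hT'
          · exact Or.inr h3
          · exact Or.inl (hφ' T' hT')
        refine Set.Subsingleton.finite fun a ha b hb => ?_
        simp only [Set.mem_ofPred_eq, hlin] at ha hb
        by_contra hab
        have e : ∑ v ∈ T', φ v = ∑ v ∈ T', ψ v := by
          have : (a - b) * (∑ v ∈ T', ψ v - ∑ v ∈ T', φ v) = 0 := by linarith
          rcases mul_eq_zero.1 this with h' | h'
          · exact absurd (sub_eq_zero.1 h') hab
          · linarith
        rw [e] at ha hor
        have : ∑ v ∈ T', ψ v = 1 := by linarith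
        simp [this] at hor
      have hfin' : (⋃ T' ∈ Finset.cons T 𝒯 hT𝒯,
          {ε : ℝ | ∑ v ∈ T', ((1 - ε) * φ v + ε * ψ v) = 1}).Finite :=
        Set.Finite.biUnion (Finset.finite_toSet _) hfin
      obtain ⟨ε, hε, hε'⟩ := (Set.Ioo_infinite (zero_lt_one (α := ℝ))).exists_notMem_finite hfin'
      refine ⟨fun v => (1 - ε) * φ v + ε * ψ v, ⟨fun v => ?_, fun S hS => ?_⟩, fun T' hT' hc => ?_⟩
      · have := hε.1.le
        have := sub_nonneg.2 hε.2.le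
        have := hφ.1 v
        have := h1 v
        positivity
      · rw [hlin, hφ.2 S hS, h2 S hS]; ring
      · exact hε' (Set.mem_biUnion hT' hc)
  let 𝒯 : Finset (Finset V) := Finset.univ.filter fun T => T.Nonempty ∧ ¬ IsMaxStable G (T : Set V)
  by_cases h0 : 𝒯.Nonempty
  · obtain ⟨φ, hφ, hφ'⟩ := main 𝒯 h0 fun T hT => by simpa [𝒯] using hT
    refine ⟨φ, hφ.1, fun S => ⟨hφ.2 S, fun hS => ?_⟩⟩
    by_contra hS'
    refine hφ' S ?_ hS
    simp only [𝒯, Finset.mem_filter, Finset.mem_univ, true_and]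
    refine ⟨?_, hS'⟩
    by_contra he
    rw [Finset.not_nonempty_iff_eq_empty] at he
    simp [he] at hS
  -- With nothing to avoid, every nonempty set is maximal stable. This leaves a single vertex, for
  -- which the constant weight 1 works.
  · have hall : ∀ T : Finset V, T.Nonempty → IsMaxStable G (T : Set V) := by
      intro T hT
      by_contra hT'
      exact h0 ⟨T, by simp [𝒯, hT, hT']⟩
    have huniv := hall Finset.univ Finset.univ_nonempty
    have hsub : ∀ x y : V, x = y := by
      intro x y
      have hx := hall {x} (by simp)
      have : y ∈ ((({x} : Finset V)) : Set V) :=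
        hx.mem_of_forall_not_adj fun z _ => huniv.not_adj (by simp) (by simp)
      exact (Finset.mem_singleton.1 (Finset.mem_coe.1 this)).symm
    obtain ⟨x⟩ := ‹Nonempty V›
    refine ⟨fun _ => 1, fun _ => zero_le_one, fun S => ?_⟩
    rcases S.eq_empty_or_nonempty with rfl | hS
    · have hne : ¬ IsMaxStable G ((∅ : Finset V) : Set V) := fun h' => by
        have : Nonempty V := ⟨x⟩
        simpa using h'.nonempty
      simpa using hne
    · have : S = {x} := Finset.eq_singleton_iff_nonempty_unique_mem.2 ⟨hS, fun y _ => hsub y x⟩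
      subst this
      simpa using hall {x} (by simp)

/-- If `u` and `v` have no common neighbor in `S`, their neighborhoods in `S` are disjoint. Each can
be exchanged for a set of the same weight containing `u`, respectively `v`. The double exchange has
weight 1, so it is stable, yet it contains the edge `uv`. -/
theorem IsEquistable.isTriangle [Finite V] (h : IsEquistable G) : IsTriangle G := by
  classical
  have : Fintype V := Fintype.ofFinite V
  obtain ⟨φ, -, hφ⟩ := h
  intro S hS u v hu hv huv
  by_contra! hno
  let w : Set V → ℝ := fun X => ∑ x ∈ X.toFinset, φ x
  have hw : ∀ X, IsMaxStable G X ↔ w X = 1 := fun X => by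
    have := hφ X.toFinset
    rwa [Set.coe_toFinset] at this
  have hwu : ∀ X Y : Set V, Disjoint X Y → w (X ∪ Y) = w X + w Y := fun X Y hXY => by
    simp only [w]
    rw [Set.toFinset_union, Finset.sum_union]
    exact Set.disjoint_toFinset.2 hXY
  -- `X` is the new part of a maximal stable set containing `p` and all non-neighbors of `p` in `S`.
  -- Comparing the two weights 1 shows that `X` weighs as much as the neighborhood of `p` in `S`.
  have ext : ∀ p, p ∉ S → ∃ X : Set V, p ∈ X ∧ Disjoint X S ∧
      (∀ x ∈ X, ∀ s ∈ S, G.Adj x s → G.Adj p s) ∧ w X = w {s ∈ S | G.Adj p s} := by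
    intro p hp
    obtain ⟨T, hT, hT'⟩ := exists_isMaxStable_superset (G := G)
      (S := insert p {s ∈ S | ¬ G.Adj p s}) (by
        refine Set.Pairwise.insert (hS.1.mono (Set.sep_subset _ _)) fun y hy _ =>
          ⟨hy.2, fun h' => hy.2 h'.symm⟩)
    have hpT : p ∈ T := hT (by simp)
    have hST : ∀ s ∈ S, ¬ G.Adj p s → s ∈ T := fun s hs hps => hT (by simp [hs, hps])
    refine ⟨T \ S, ⟨hpT, hp⟩, Set.disjoint_sdiff_left, fun x hx s hs hxs => ?_, ?_⟩
    · by_contra hps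
      exact hT'.not_adj hx.1 (hST s hs hps) hxs
    · have h1 := (hw T).1 hT'
      have h2 := (hw S).1 hS
      have e1 : T = (T \ S) ∪ {s ∈ S | ¬ G.Adj p s} := by
        ext x
        constructor
        · intro hx
          by_cases hxS : x ∈ S
          · exact Or.inr ⟨hxS, hT'.not_adj hpT hx⟩
          · exact Or.inl ⟨hx, hxS⟩
        · rintro (hx | hx)
          · exact hx.1
          · exact hST x hx.1 hx.2
      have e2 : S = {s ∈ S | G.Adj p s} ∪ {s ∈ S | ¬ G.Adj p s} := by
        ext x; by_cases hx : G.Adj p x <;> simp [hx]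
      rw [e1, hwu] at h1
      · rw [e2, hwu] at h2
        · linarith
        · exact Set.disjoint_left.2 fun x hx hx' => hx'.2 hx.2
      · exact Set.disjoint_left.2 fun x hx hx' => hx.2 hx'.1
  obtain ⟨X, huX, hXS, hXu, hwX⟩ := ext u hu
  obtain ⟨Y, hvY, hYS, hYv, hwY⟩ := ext v hv
  -- A common element lies outside `S`, so it has a neighbor in `S`, and that vertex would be
  -- adjacent to both `u` and `v`.
  have hXY : Disjoint X Y := by
    refine Set.disjoint_left.2 fun x hxX hxY => ?_
    obtain ⟨s, hs, hxs⟩ := hS.exists_adj (Set.disjoint_left.1 hXS hxX)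
    exact hno s hs (hXu x hxX s hs hxs) (hYv x hxY s hs hxs)
  let R : Set V := {s ∈ S | ¬ G.Adj u s ∧ ¬ G.Adj v s}
  have hR : R ⊆ S := Set.sep_subset _ _
  have e : S = ({s ∈ S | G.Adj u s} ∪ {s ∈ S | G.Adj v s}) ∪ R := by
    ext x; by_cases hx : G.Adj u x <;> by_cases hx' : G.Adj v x <;> simp [hx, hx', R]
  have h2 := (hw S).1 hS
  rw [e, hwu, hwu] at h2
  · have h3 : w ((X ∪ Y) ∪ R) = 1 := by
      rw [hwu, hwu _ _ hXY]
      · linarith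
      · exact (hXS.mono_right hR).union_left (hYS.mono_right hR)
    exact ((hw _).2 h3).not_adj (Or.inl (Or.inl huX)) (Or.inl (Or.inr hvY)) huv
  · exact Set.disjoint_left.2 fun x hx hx' => hno x hx.1 hx.2 hx'.2
  · refine Set.disjoint_left.2 fun x hx hx' => ?_
    rcases hx with hx | hx
    · exact hx'.2.1 hx.2
    · exact hx'.2.2 hx.2

end General

end CISGraph

namespace CISGraph

universe u v

/-! ### Root graphs -/

section RootMap

variable {V : Type u} {W : Type v}

/-- `f` represents `G` as the line graph of `H`: it is a bijection from the vertices of `G` to the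
edges of `H`, and distinct vertices are adjacent iff the corresponding edges share an endpoint. -/
structure IsRoot (G : SimpleGraph V) (H : SimpleGraph W) (f : V → Sym2 W) : Prop where
  inj : Function.Injective f
  mem_edgeSet : ∀ e, e ∈ H.edgeSet ↔ ∃ v, f v = e
  adj : ∀ u v, G.Adj u v ↔ u ≠ v ∧ ∃ x, x ∈ f u ∧ x ∈ f v

theorem isRoot_of_iso {G : SimpleGraph V} {H : SimpleGraph W} (e : G ≃g H.lineGraph) :
    IsRoot G H (fun v => (e v : Sym2 W)) where
  inj := fun _ _ h => e.injective (Subtype.ext h)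
  mem_edgeSet := fun a =>
    ⟨fun ha => ⟨e.symm ⟨a, ha⟩, by simp⟩, by rintro ⟨v, rfl⟩; exact (e v).2⟩
  adj := fun u v => by
    rw [← e.map_adj_iff, SimpleGraph.lineGraph_adj_iff_exists, e.injective.ne_iff]

variable {G : SimpleGraph V} {H : SimpleGraph W} {f : V → Sym2 W}

namespace IsRoot

theorem adj_of_mem (R : IsRoot G H f) {u v : V} {x : W} (h : u ≠ v) (hu : x ∈ f u)
    (hv : x ∈ f v) : G.Adj u v := (R.adj u v).2 ⟨h, x, hu, hv⟩

theorem exists_eq (R : IsRoot G H f) {a b : W} (h : H.Adj a b) : ∃ v, f v = s(a, b) :=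
  (R.mem_edgeSet _).1 h

theorem hadj (R : IsRoot G H f) {a b : W} {v : V} (h : f v = s(a, b)) : H.Adj a b :=
  (R.mem_edgeSet s(a, b)).2 ⟨v, h⟩

theorem exists_eq_of_mem (R : IsRoot G H f) {a : W} {v : V} (h : a ∈ f v) :
    ∃ b, f v = s(a, b) ∧ H.Adj a b := by
  obtain ⟨b, hb⟩ := Sym2.mem_iff_exists.1 h
  exact ⟨b, hb, R.hadj hb⟩

theorem exists_eq_mk (R : IsRoot G H f) (v : V) : ∃ a b, f v = s(a, b) ∧ H.Adj a b := by
  induction h : f v using Sym2.ind with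
  | _ a b => exact ⟨a, b, rfl, R.hadj h⟩

theorem eq_of_mem (R : IsRoot G H f) {S : Set V} (hS : G.IsIndepSet S) {u v : V} {x : W}
    (hu : u ∈ S) (hv : v ∈ S) (hxu : x ∈ f u) (hxv : x ∈ f v) : u = v := by
  by_contra h
  exact hS hu hv h (R.adj_of_mem h hxu hxv)

end IsRoot

/-- The subgraph of `H` formed by the edges that correspond to the members of `S`. -/
def IsRoot.toSubgraph (R : IsRoot G H f) (S : Set V) : H.Subgraph where
  verts := {a | ∃ v ∈ S, a ∈ f v}
  Adj a b := ∃ v ∈ S, f v = s(a, b)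
  adj_sub := by rintro a b ⟨v, -, h⟩; exact R.hadj h
  edge_vert := by rintro a b ⟨v, hv, h⟩; exact ⟨v, hv, by simp [h]⟩
  symm := ⟨by rintro a b ⟨v, hv, h⟩; exact ⟨v, hv, by rw [h, Sym2.eq_swap]⟩⟩

/-- The set of vertices of `G` that correspond to the edges of a subgraph of `H`. -/
def edgeVertices (f : V → Sym2 W) (M : H.Subgraph) : Set V := {v | f v ∈ M.edgeSet}

namespace IsRoot

theorem isMatching_toSubgraph (R : IsRoot G H f) {S : Set V} (hS : G.IsIndepSet S) :
    (R.toSubgraph S).IsMatching := by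
  rintro a ⟨v, hv, hav⟩
  obtain ⟨b, hb, -⟩ := R.exists_eq_of_mem hav
  refine ⟨b, ⟨v, hv, hb⟩, ?_⟩
  rintro c ⟨w, hw, hc⟩
  have := R.eq_of_mem hS hv hw hav (by simp [hc])
  subst this
  rw [hb] at hc
  exact (Sym2.congr_right.1 hc).symm

theorem isIndepSet_edgeVertices (R : IsRoot G H f) {M : H.Subgraph} (hM : M.IsMatching) :
    G.IsIndepSet (edgeVertices f M) := by
  intro u hu v hv huv hadj
  obtain ⟨-, x, hxu, hxv⟩ := (R.adj u v).1 hadj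
  obtain ⟨a, ha, -⟩ := R.exists_eq_of_mem hxu
  obtain ⟨b, hb, -⟩ := R.exists_eq_of_mem hxv
  have h1 : M.Adj x a := by rw [← SimpleGraph.Subgraph.mem_edgeSet, ← ha]; exact hu
  have h2 : M.Adj x b := by rw [← SimpleGraph.Subgraph.mem_edgeSet, ← hb]; exact hv
  have : a = b := (hM (M.edge_vert h1)).unique h1 h2
  exact huv (R.inj (by rw [ha, hb, this]))

theorem edgeVertices_toSubgraph (R : IsRoot G H f) (S : Set V) :
    edgeVertices f (R.toSubgraph S) = S := by
  ext v
  obtain ⟨a, b, h, -⟩ := R.exists_eq_mk v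
  simp only [edgeVertices, Set.mem_ofPred_eq, h, SimpleGraph.Subgraph.mem_edgeSet]
  constructor
  · rintro ⟨w, hw, hw'⟩
    rwa [R.inj (h.trans hw'.symm)]
  · exact fun hv => ⟨v, hv, h⟩

/-- A matching has no isolated vertices, so it is determined by its edges. With
`edgeVertices_toSubgraph` this lets maximality pass between matchings of `H` and stable sets of `G`.
-/
theorem le_toSubgraph (R : IsRoot G H f) {M : H.Subgraph} (hM : M.IsMatching) :
    M ≤ R.toSubgraph (edgeVertices f M) := by
  have key : ∀ {a b}, M.Adj a b → ∃ v ∈ edgeVertices f M, f v = s(a, b) := by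
    intro a b hab
    obtain ⟨v, hv⟩ := R.exists_eq (M.adj_sub hab)
    exact ⟨v, by simpa [edgeVertices, hv] using hab, hv⟩
  refine ⟨fun a ha => ?_, fun a b hab => key hab⟩
  obtain ⟨b, hb, -⟩ := hM ha
  obtain ⟨v, hv, hv'⟩ := key hb
  exact ⟨v, hv, by simp [hv']⟩

theorem toSubgraph_mono (R : IsRoot G H f) {S T : Set V} (h : S ⊆ T) :
    R.toSubgraph S ≤ R.toSubgraph T :=
  ⟨fun _ ⟨v, hv, hv'⟩ => ⟨v, h hv, hv'⟩, fun _ _ ⟨v, hv, hv'⟩ => ⟨v, h hv, hv'⟩⟩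

theorem edgeVertices_mono {M N : H.Subgraph} (h : M ≤ N) : edgeVertices f M ⊆ edgeVertices f N :=
  fun _ hv => SimpleGraph.Subgraph.edgeSet_mono h hv

theorem isMaxMatching_toSubgraph (R : IsRoot G H f) {S : Set V} (hS : IsMaxStable G S) :
    IsMaxMatching (R.toSubgraph S) := by
  refine ⟨R.isMatching_toSubgraph hS.1, fun N hN hSN => ?_⟩
  have h1 := edgeVertices_mono (f := f) hSN
  rw [R.edgeVertices_toSubgraph] at h1
  exact (R.le_toSubgraph hN).trans (R.toSubgraph_mono (hS.2 (R.isIndepSet_edgeVertices hN) h1))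

theorem isMaxStable_edgeVertices (R : IsRoot G H f) {M : H.Subgraph} (hM : IsMaxMatching M) :
    IsMaxStable G (edgeVertices f M) := by
  refine ⟨R.isIndepSet_edgeVertices hM.1, fun T hT hMT => ?_⟩
  have h1 := hM.2 (R.isMatching_toSubgraph hT) ((R.le_toSubgraph hM.1).trans (R.toSubgraph_mono hMT))
  have := edgeVertices_mono (f := f) h1
  rwa [R.edgeVertices_toSubgraph] at this

end IsRoot

/-- The condition on maximal matchings of the root graph, in terms of maximal stable sets. -/
def MissCondition (G : SimpleGraph V) (H : SimpleGraph W) (f : V → Sym2 W) : Prop :=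
  ∀ S, IsMaxStable G S → ∀ x, (∀ v ∈ S, x ∉ f v) → ∃ v ∈ S, ∀ y, H.Adj x y → y ∈ f v

theorem IsRoot.maxMatchingCondition_iff (R : IsRoot G H f) :
    MaxMatchingCondition H ↔ MissCondition G H f := by
  constructor
  · intro h S hS x hx
    obtain ⟨e, he, hxe⟩ := h _ (R.isMaxMatching_toSubgraph hS) x (by rintro ⟨v, hv, hv'⟩; exact hx v hv hv')
    obtain ⟨v, rfl⟩ := (R.mem_edgeSet e).1 (SimpleGraph.Subgraph.edgeSet_subset _ he)
    refine ⟨v, ?_, hxe⟩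
    rw [← R.edgeVertices_toSubgraph S]
    exact he
  · intro h M hM x hx
    obtain ⟨v, hv, hxv⟩ := h _ (R.isMaxStable_edgeVertices hM) x fun v hv hxv =>
      hx (SimpleGraph.Subgraph.mem_verts_of_mem_edge hv hxv)
    exact ⟨f v, hv, hxv⟩

theorem bull_free_iff : bull.Free H ↔ ∀ a' a b b' c : W, H.Adj a b → H.Adj b c → H.Adj a c →
    H.Adj a a' → H.Adj b b' → a' ≠ b → a' ≠ c → b' ≠ a → b' ≠ c → a' ≠ b' → False := by
  constructor
  · intro h a' a b b' c hab hbc hac haa hbb h1 h2 h3 h4 h5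
    refine h ⟨⟨⟨![a', a, b, b', c], ?_⟩, ?_⟩⟩
    · intro i j hij
      fin_cases i <;> fin_cases j <;>
        simp_all [bull, SimpleGraph.adj_comm]
    · intro i j hij
      have e1 := hab.ne
      have e2 := hbc.ne
      have e3 := hac.ne
      have e4 := haa.ne
      have e5 := hbb.ne
      fin_cases i <;> fin_cases j <;> simp_all
  · rintro h ⟨φ⟩
    have adj : ∀ i j, bull.Adj i j → H.Adj (φ i) (φ j) := fun i j hij => φ.toHom.map_adj hij
    have ne : ∀ i j : Fin 5, i ≠ j → φ i ≠ φ j := fun i j hij => φ.injective.ne hij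
    refine h (φ 0) (φ 1) (φ 2) (φ 3) (φ 4) (adj _ _ ?_) (adj _ _ ?_) (adj _ _ ?_) (adj _ _ ?_)
      (adj _ _ ?_) (ne _ _ ?_) (ne _ _ ?_) (ne _ _ ?_) (ne _ _ ?_) (ne _ _ ?_) <;> simp [bull]

/-! ### Matching conditions, bulls and the CIS property. -/

namespace IsRoot

/-- Two edges `xy` and `xy'` are adjacent vertices of `G` outside `S`, so some edge of the matching
`S` meets both. It avoids `x`, hence it contains `y` and `y'`. As only one edge of `S` contains `y`,
the same edge serves for all `y'`. -/
theorem missCondition_of_isTriangle [Nonempty V] (R : IsRoot G H f) (h : IsTriangle G) :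
    MissCondition G H f := by
  intro S hS x hx
  by_cases hN : ∃ y, H.Adj x y
  · obtain ⟨y, hxy⟩ := hN
    obtain ⟨v, hv⟩ := R.exists_eq hxy
    have hvS : v ∉ S := fun h' => hx v h' (by simp [hv])
    obtain ⟨w, hw, hvw⟩ := hS.exists_adj hvS
    have key : ∀ (w v : V) (y : W), w ∈ S → f v = s(x, y) → G.Adj v w → y ∈ f w := by
      intro w v y hw hv hvw
      obtain ⟨-, z, hz, hz'⟩ := (R.adj v w).1 hvw
      rw [hv, Sym2.mem_iff] at hz
      rcases hz with rfl | rfl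
      · exact absurd hz' (hx w hw)
      · exact hz'
    refine ⟨w, hw, fun y' hy' => ?_⟩
    obtain ⟨v', hv'⟩ := R.exists_eq hy'
    have hvS' : v' ∉ S := fun h' => hx v' h' (by simp [hv'])
    by_cases hvv : v = v'
    · subst hvv
      exact key w v y' hw hv' hvw
    · obtain ⟨s, hs, h1, h2⟩ := h S hS v v' hvS hvS'
        (R.adj_of_mem (x := x) hvv (by simp [hv]) (by simp [hv']))
      have := R.eq_of_mem hS.1 hw hs (key w v y hw hv hvw) (key s v y hs hv h1)
      subst this
      exact key w v' y' hs hv' h2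
  · push Not at hN
    obtain ⟨v, hv⟩ := hS.nonempty
    exact ⟨v, hv, fun y hy => absurd hy (hN y)⟩

theorem eq_of_two_mem (_ : IsRoot G H f) {v : V} {a b : W} (hab : a ≠ b) (ha : a ∈ f v)
    (hb : b ∈ f v) : f v = s(a, b) := (Sym2.mem_and_mem_iff hab).1 ⟨ha, hb⟩

/-- The triangle `abc` of a bull is a maximal clique of `G`, that is, a maximal stable set of the
complement. The horns `aa'` and `bb'` are disjoint, hence adjacent in the complement, but every edge
of the triangle contains `a` or `b` and so touches a horn. -/
theorem bull_free_of_isTriangle_compl (R : IsRoot G H f) (h : IsTriangle Gᶜ) : bull.Free H := by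
  rw [bull_free_iff]
  intro a' a b b' c hab hbc hac haa hbb h1 h2 h3 h4 h5
  obtain ⟨p, hp⟩ := R.exists_eq hab
  obtain ⟨q, hq⟩ := R.exists_eq hbc
  obtain ⟨r, hr⟩ := R.exists_eq hac
  obtain ⟨u, hu⟩ := R.exists_eq haa
  obtain ⟨v, hv⟩ := R.exists_eq hbb
  have e1 := hab.ne
  have e2 := hbc.ne
  have e3 := hac.ne
  have e4 := haa.ne
  have e5 := hbb.ne
  have hS : IsMaxStable Gᶜ {p, q, r} := by
    refine isMaxStable_of ?_ ?_
    · have hpq : G.Adj p q := R.adj_of_mem (x := b)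
        (by rintro rfl; rw [hp] at hq; simp [e1, e2, e3] at hq) (by simp [hp]) (by simp [hq])
      have hqr : G.Adj q r := R.adj_of_mem (x := c)
        (by rintro rfl; rw [hq] at hr; simp [e2, e1.symm] at hr) (by simp [hq]) (by simp [hr])
      have hpr : G.Adj p r := R.adj_of_mem (x := a)
        (by rintro rfl; rw [hp] at hr; simp [e2, e3] at hr) (by simp [hp]) (by simp [hr])
      rintro x (rfl | rfl | rfl) y (rfl | rfl | rfl) <;>
        simp [hpq, hqr, hpr, hpq.symm, hqr.symm, hpr.symm]
    · intro x hx
      by_contra! hno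
      simp only [Set.mem_insert_iff, Set.mem_singleton_iff, not_or] at hx
      simp only [Set.mem_insert_iff, Set.mem_singleton_iff, forall_eq_or_imp, forall_eq,
        SimpleGraph.compl_adj, not_and, not_not] at hno
      obtain ⟨n1, n2, n3⟩ := hno
      obtain ⟨-, y1, y1x, y1p⟩ := (R.adj _ _).1 (n1 hx.1)
      obtain ⟨-, y2, y2x, y2q⟩ := (R.adj _ _).1 (n2 hx.2.1)
      obtain ⟨-, y3, y3x, y3r⟩ := (R.adj _ _).1 (n3 hx.2.2)
      rw [hp, Sym2.mem_iff] at y1p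
      rw [hq, Sym2.mem_iff] at y2q
      rw [hr, Sym2.mem_iff] at y3r
      have no1 : ¬ (a ∈ f x ∧ b ∈ f x) := fun hh =>
        hx.1 (R.inj ((R.eq_of_two_mem e1 hh.1 hh.2).trans hp.symm))
      have no2 : ¬ (b ∈ f x ∧ c ∈ f x) := fun hh =>
        hx.2.1 (R.inj ((R.eq_of_two_mem e2 hh.1 hh.2).trans hq.symm))
      have no3 : ¬ (a ∈ f x ∧ c ∈ f x) := fun hh =>
        hx.2.2 (R.inj ((R.eq_of_two_mem e3 hh.1 hh.2).trans hr.symm))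
      have m2 : b ∈ f x ∨ c ∈ f x := by
        rcases y2q with rfl | rfl
        · exact Or.inl y2x
        · exact Or.inr y2x
      have m3 : a ∈ f x ∨ c ∈ f x := by
        rcases y3r with rfl | rfl
        · exact Or.inl y3x
        · exact Or.inr y3x
      rcases y1p with rfl | rfl
      · exact m2.elim (fun h' => no1 ⟨y1x, h'⟩) fun h' => no3 ⟨y1x, h'⟩
      · exact m3.elim (fun h' => no1 ⟨h', y1x⟩) fun h' => no2 ⟨y1x, h'⟩
  have hnot : ∀ (x : V) (y z : W), f x = s(y, z) → y ≠ z → z ≠ a → z ≠ b → z ≠ c →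
      x ∉ ({p, q, r} : Set V) := by
    rintro x y z hx hyz hza hzb hzc (rfl | rfl | rfl)
    · rw [hp] at hx
      have : z ∈ s(a, b) := hx ▸ Sym2.mem_mk_right y z
      simp_all
    · rw [hq] at hx
      have : z ∈ s(b, c) := hx ▸ Sym2.mem_mk_right y z
      simp_all
    · rw [hr] at hx
      have : z ∈ s(a, c) := hx ▸ Sym2.mem_mk_right y z
      simp_all
  have huv : Gᶜ.Adj u v := by
    rw [SimpleGraph.compl_adj, R.adj, hu, hv]
    refine ⟨?_, ?_⟩
    · rintro rfl
      rw [hu] at hv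
      have : a ∈ s(b, b') := hv ▸ Sym2.mem_mk_left a a'
      rw [Sym2.mem_iff] at this
      rcases this with h' | h'
      · exact e1 h'
      · exact h3 h'.symm
    · rintro ⟨-, x, hx, hx'⟩
      rw [Sym2.mem_iff] at hx hx'
      rcases hx with rfl | rfl <;> rcases hx' with rfl | rfl <;> simp_all
  obtain ⟨s, hs, hus, hvs⟩ := h _ hS u v (hnot u a a' hu e4 e4.symm h1 h2)
    (hnot v b b' hv e5 h3 e5.symm h4) huv
  have share : ∀ (x y : V) (z : W), z ∈ f x → z ∈ f y → ¬ Gᶜ.Adj x y := by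
    intro x y z hx hy hxy
    rw [SimpleGraph.compl_adj] at hxy
    exact hxy.2 (R.adj_of_mem hxy.1 hx hy)
  rcases hs with rfl | rfl | rfl
  · exact share u _ a (by simp [hu]) (by simp [hp]) hus
  · exact share v _ b (by simp [hv]) (by simp [hq]) hvs
  · exact share u _ a (by simp [hu]) (by simp [hr]) hus

/-- If `M` covers all neighbors of `x`, then no maximal matching extending `M` can cover `x`. All
neighbors of `x` then lie in one edge of the extension. Each edge of `M` contains a neighbor of `x`,
so `M` has only that edge. -/
theorem localMatchingCondition_of_missCondition [Finite V] (R : IsRoot G H f)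
    (h : MissCondition G H f) : LocalMatchingCondition H := by
  intro x M hM hMm hcard
  by_contra! hno
  obtain ⟨T, hST, hT⟩ := exists_isMaxStable_superset (R.isIndepSet_edgeVertices hMm)
  have hxT : ∀ v ∈ T, x ∉ f v := by
    intro v hv hxv
    obtain ⟨y, hy, hxy⟩ := R.exists_eq_of_mem hxv
    obtain ⟨w, hyw, -⟩ := hMm (hno y hxy)
    obtain ⟨v', hv'⟩ := R.exists_eq (M.adj_sub hyw)
    have hv'M : v' ∈ edgeVertices f M := by simpa [edgeVertices, hv'] using hyw
    have := R.eq_of_mem hT.1 hv (hST hv'M) (x := y) (by simp [hy]) (by simp [hv'])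
    subst this
    have hw := hM.2 hyw
    rw [hv', Sym2.mem_iff] at hxv
    rcases hxv with rfl | rfl
    · exact hw.2.1 rfl
    · exact hw.2.2.1 rfl
  obtain ⟨v, hvT, hv⟩ := h T hT x hxT
  have key : ∀ e ∈ M.edgeSet, e = f v := by
    intro e he
    obtain ⟨w, rfl⟩ := (R.mem_edgeSet e).1 (SimpleGraph.Subgraph.edgeSet_subset _ he)
    obtain ⟨a, b, hab, -⟩ := R.exists_eq_mk w
    have hwT : w ∈ T := hST he
    have hMab : M.Adj a b := by rwa [hab] at he
    rcases (hM.2 hMab).2.2.2 with hxa | hxb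
    · rw [R.eq_of_mem hT.1 hwT hvT (x := a) (by simp [hab]) (hv a hxa)]
    · rw [R.eq_of_mem hT.1 hwT hvT (x := b) (by simp [hab]) (hv b hxb)]
  have h2 : (1 : ℕ∞) < M.edgeSet.encard := lt_of_lt_of_le (by norm_num) hcard
  obtain ⟨e, e', he, he', hne⟩ := Set.one_lt_encard_iff.1 h2
  exact hne ((key e he).trans (key e' he').symm)

/-- Pairwise intersecting edges form a star or a triangle: if neither end of `p` is common to all,
an edge avoiding `a` and one avoiding `b` must meet in a third vertex. -/
theorem clique_cases (R : IsRoot G H f) {C : Set V} (hC : G.IsClique C) (h0 : C.Nonempty) :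
    (∃ x, ∀ v ∈ C, x ∈ f v) ∨ ∃ a b c, a ≠ b ∧ b ≠ c ∧ a ≠ c ∧
      (∃ p ∈ C, f p = s(a, b)) ∧ (∃ q ∈ C, f q = s(b, c)) ∧ ∃ r ∈ C, f r = s(a, c) := by
  obtain ⟨p, hp⟩ := h0
  obtain ⟨a, b, hab, hadj⟩ := R.exists_eq_mk p
  by_cases ha : ∀ v ∈ C, a ∈ f v
  · exact Or.inl ⟨a, ha⟩
  by_cases hb : ∀ v ∈ C, b ∈ f v
  · exact Or.inl ⟨b, hb⟩
  push Not at ha hb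
  obtain ⟨q, hq, haq⟩ := ha
  obtain ⟨r, hr, hbr⟩ := hb
  have share : ∀ {u v}, u ∈ C → v ∈ C → ∃ x, x ∈ f u ∧ x ∈ f v := by
    intro u v hu hv
    by_cases huv : u = v
    · subst huv
      obtain ⟨a, b, h, -⟩ := R.exists_eq_mk u
      exact ⟨a, by simp [h], by simp [h]⟩
    · exact ((R.adj u v).1 (hC hu hv huv)).2
  have hbq : b ∈ f q := by
    obtain ⟨x, hx, hx'⟩ := share hp hq
    rw [hab, Sym2.mem_iff] at hx
    rcases hx with rfl | rfl
    · exact absurd hx' haq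
    · exact hx'
  have har : a ∈ f r := by
    obtain ⟨x, hx, hx'⟩ := share hp hr
    rw [hab, Sym2.mem_iff] at hx
    rcases hx with rfl | rfl
    · exact hx'
    · exact absurd hx' hbr
  obtain ⟨c, hc, hbc⟩ := R.exists_eq_of_mem hbq
  have hac : a ≠ c := by rintro rfl; exact haq (by simp [hc])
  refine Or.inr ⟨a, b, c, hadj.ne, hbc.ne, hac, ⟨p, hp, hab⟩, ⟨q, hq, hc⟩, r, hr, ?_⟩
  obtain ⟨x, hx, hx'⟩ := share hq hr
  rw [hc, Sym2.mem_iff] at hx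
  rcases hx with rfl | rfl
  · exact absurd hx' hbr
  · exact R.eq_of_two_mem hac har hx'

/-- The disjoint clique `C` is a star or a triangle. For a star at `x`, the set `S` covers all
neighbors of `x` but not `x`. For a triangle, `S` covers two of its vertices by edges leaving the
triangle, and these are the horns of a bull. -/
theorem isCIS_of_bull_free [Nonempty V] (R : IsRoot G H f) (hb : bull.Free H)
    (h : LocalMatchingCondition H) : IsCIS G := by
  intro C S hC hS
  by_contra hCS
  have hdis : ∀ v ∈ C, v ∉ S := fun v hv hv' => hCS ⟨v, hv, hv'⟩
  rcases R.clique_cases hC.1 hC.nonempty with ⟨x, hx⟩ | ⟨a, b, c, hab, hbc, hac, ⟨p, hp, hp'⟩,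
    ⟨q, hq, hq'⟩, r, hr, hr'⟩
  · have hxC : ∀ v, x ∈ f v → v ∈ C := fun v hv =>
      hC.mem_of_forall_adj fun y hy hvy => R.adj_of_mem hvy hv (hx y hy)
    have hxS : ∀ v ∈ S, x ∉ f v := fun v hv hxv => hdis v (hxC v hxv) hv
    have hcov : ∀ y, H.Adj x y → ∃ w ∈ S, y ∈ f w := by
      intro y hxy
      obtain ⟨v, hv⟩ := R.exists_eq hxy
      obtain ⟨w, hw, hvw⟩ := hS.exists_adj (hdis v (hxC v (by simp [hv])))
      obtain ⟨-, z, hz, hz'⟩ := (R.adj v w).1 hvw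
      rw [hv, Sym2.mem_iff] at hz
      rcases hz with rfl | rfl
      · exact absurd hz' (hxS w hw)
      · exact ⟨w, hw, hz'⟩
    -- `T` is a matching in `H(x)` that covers every neighbor of `x`, so it has at most one edge.
    -- That edge meets all members of `C`, hence belongs to `C` by maximality.
    let T : Set V := {v ∈ S | ∃ y ∈ f v, H.Adj x y}
    have hT : G.IsIndepSet T := hS.1.mono (Set.sep_subset _ _)
    have hle : R.toSubgraph T ≤ localSubgraph H x := by
      have key : ∀ a b, (R.toSubgraph T).Adj a b → (localSubgraph H x).Adj a b := by
        rintro a b ⟨v, ⟨hvS, y, hyv, hxy⟩, hv⟩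
        refine ⟨R.hadj hv, ?_, ?_, ?_⟩
        · rintro rfl; exact hxS v hvS (by simp [hv])
        · rintro rfl; exact hxS v hvS (by simp [hv])
        · rw [hv, Sym2.mem_iff] at hyv
          rcases hyv with rfl | rfl
          · exact Or.inl hxy
          · exact Or.inr hxy
      refine ⟨?_, fun a b => key a b⟩
      rintro a ⟨v, hv, hav⟩
      obtain ⟨b, hb, -⟩ := R.exists_eq_of_mem hav
      exact (localSubgraph H x).edge_vert (key a b ⟨v, hv, hb⟩)
    have hsub : ∀ v ∈ T, ∀ w ∈ T, v = w := by
      by_contra! hne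
      obtain ⟨v, hv, w, hw, hvw⟩ := hne
      have hmem : ∀ v ∈ T, f v ∈ (R.toSubgraph T).edgeSet := by
        intro v hv
        obtain ⟨a, b, hab, -⟩ := R.exists_eq_mk v
        rw [hab]
        exact ⟨v, hv, hab⟩
      have h2 : 2 ≤ (R.toSubgraph T).edgeSet.encard := by
        have : (1 : ℕ∞) < (R.toSubgraph T).edgeSet.encard :=
          Set.one_lt_encard_iff.2 ⟨f v, f w, hmem v hv, hmem w hw, R.inj.ne hvw⟩
        exact Order.add_one_le_of_lt this
      obtain ⟨y, hy, hy'⟩ := h x _ hle (R.isMatching_toSubgraph hT) h2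
      obtain ⟨w, hw, hyw⟩ := hcov y hy
      exact hy' ⟨w, ⟨hw, y, hyw, hy⟩, hyw⟩
    obtain ⟨v, hv⟩ := hC.nonempty
    obtain ⟨y, hy, hxy⟩ := R.exists_eq_of_mem (hx v hv)
    obtain ⟨w, hw, hyw⟩ := hcov y hxy
    refine hdis w (hC.mem_of_forall_adj fun v' hv' hne => ?_) hw
    obtain ⟨y', hy', hxy'⟩ := R.exists_eq_of_mem (hx v' hv')
    obtain ⟨w', hw', hyw'⟩ := hcov y' hxy'
    have := hsub w ⟨hw, y, hyw, hxy⟩ w' ⟨hw', y', hyw', hxy'⟩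
    subst this
    exact R.adj_of_mem hne hyw' (by simp [hy'])
  · rw [bull_free_iff] at hb
    have bullAt : ∀ (a b c : W), a ≠ b → b ≠ c → a ≠ c → (∃ p ∈ C, f p = s(a, b)) →
        (∃ q ∈ C, f q = s(b, c)) → (∃ r ∈ C, f r = s(a, c)) → (∃ v ∈ S, a ∈ f v) →
        (∃ v ∈ S, b ∈ f v) → False := by
      rintro a b c hab hbc hac ⟨p, hp, hp'⟩ ⟨q, hq, hq'⟩ ⟨r, hr, hr'⟩ ⟨v, hv, hav⟩ ⟨w, hw, hbw⟩
      obtain ⟨a', ha', haa⟩ := R.exists_eq_of_mem hav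
      obtain ⟨b', hb', hbb⟩ := R.exists_eq_of_mem hbw
      have n1 : a' ≠ b := by
        rintro rfl; exact hdis p hp (by rwa [R.inj (hp'.trans ha'.symm)])
      have n2 : a' ≠ c := by
        rintro rfl; exact hdis r hr (by rwa [R.inj (hr'.trans ha'.symm)])
      have n3 : b' ≠ a := by
        rintro rfl
        exact hdis p hp (by rwa [R.inj (hp'.trans (Sym2.eq_swap.trans hb'.symm))])
      have n4 : b' ≠ c := by
        rintro rfl; exact hdis q hq (by rwa [R.inj (hq'.trans hb'.symm)])
      refine hb a' a b b' c (R.hadj hp') (R.hadj hq') (R.hadj hr') haa hbb n1 n2 n3 n4 ?_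
      rintro rfl
      have := R.eq_of_mem hS.1 hv hw (x := a') (by simp [ha']) (by simp [hb'])
      subst this
      rw [ha'] at hb'
      simp [hab, n1] at hb'
    have hit : ∀ p ∈ C, ∀ a b, f p = s(a, b) → (∃ v ∈ S, a ∈ f v) ∨ ∃ v ∈ S, b ∈ f v := by
      intro p hp a b hab
      obtain ⟨w, hw, hpw⟩ := hS.exists_adj (hdis p hp)
      obtain ⟨-, z, hz, hz'⟩ := (R.adj p w).1 hpw
      rw [hab, Sym2.mem_iff] at hz
      rcases hz with rfl | rfl
      · exact Or.inl ⟨w, hw, hz'⟩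
      · exact Or.inr ⟨w, hw, hz'⟩
    have sw : ∀ {a b : W}, (∃ p ∈ C, f p = s(a, b)) → ∃ p ∈ C, f p = s(b, a) :=
      fun ⟨p, hp, h⟩ => ⟨p, hp, h.trans Sym2.eq_swap⟩
    have P : ∃ p ∈ C, f p = s(a, b) := ⟨p, hp, hp'⟩
    have Q : ∃ p ∈ C, f p = s(b, c) := ⟨q, hq, hq'⟩
    have R' : ∃ p ∈ C, f p = s(a, c) := ⟨r, hr, hr'⟩
    rcases hit p hp a b hp' with ha | hb
    · rcases hit q hq b c hq' with hb | hc
      · exact bullAt a b c hab hbc hac P Q R' ha hb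
      · exact bullAt a c b hac hbc.symm hab R' (sw Q) P ha hc
    · rcases hit r hr a c hr' with ha | hc
      · exact bullAt a b c hab hbc hac P Q R' ha hb
      · exact bullAt b c a hbc hac.symm hab.symm Q (sw R') (sw P) hb hc

end IsRoot

end RootMap

/-- The equivalence of the conditions for line graphs. -/
theorem tfae_of_iso {V : Type u} {W : Type v} [Finite V] [Nonempty V]
    (G : SimpleGraph V) (H : SimpleGraph W) (e : Nonempty (G ≃g H.lineGraph)) :
    List.TFAE [IsCIS G, Cap IsGeneralPartition G, Cap IsSemiWeaklyCIS G,
      Cap IsStronglyEquistable G, Cap IsEquistable G, Cap IsTriangle G,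
      bull.Free H ∧ MaxMatchingCondition H, bull.Free H ∧ LocalMatchingCondition H] := by
  obtain ⟨e⟩ := e
  have R := isRoot_of_iso e
  tfae_have 1 → 2 := fun h =>
    ⟨h.isSemiWeaklyCIS.isGeneralPartition, h.compl.isSemiWeaklyCIS.isGeneralPartition⟩
  tfae_have 2 → 3 := fun h => ⟨h.1.isSemiWeaklyCIS, h.2.isSemiWeaklyCIS⟩
  tfae_have 3 → 4 := fun h => ⟨h.1.isStronglyEquistable, h.2.isStronglyEquistable⟩
  tfae_have 4 → 5 := fun h => ⟨h.1.isEquistable, h.2.isEquistable⟩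
  tfae_have 5 → 6 := fun h => ⟨h.1.isTriangle, h.2.isTriangle⟩
  tfae_have 6 → 7 := fun h => ⟨R.bull_free_of_isTriangle_compl h.2,
    R.maxMatchingCondition_iff.2 (R.missCondition_of_isTriangle h.1)⟩
  tfae_have 7 → 8 := fun h =>
    ⟨h.1, R.localMatchingCondition_of_missCondition (R.maxMatchingCondition_iff.1 h.2)⟩
  tfae_have 8 → 1 := fun h => R.isCIS_of_bull_free h.1 h.2
  tfae_finish

end CISGraph

namespace CISGraph

/-! ### Polynomial-time evaluation of counting formulas -/

section Machine

/-- A context: values of type `α n` are kept in registers below `bound`. -/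
structure Ctx (α : ℕ → Type) where
  bound : ℕ
  rel : ∀ {n : ℕ}, α n → Store → Prop
  pos : 0 < bound
  congr : ∀ {n : ℕ} (a : α n) (s s' : Store), (∀ r < bound, s'.reg r = s.reg r) → rel a s → rel a s'

variable {α : ℕ → Type}

/-- The store `s` holds the graph `G` and the values `a` of the context. -/
structure Ctx.Holds (Γ : Ctx α) {n : ℕ} (G : SimpleGraph (Fin n)) (a : α n) (s : Store) : Prop where
  size : s.reg 0 = n
  arr : s.arr = (inputStore G).arr
  rel : Γ.rel a s

/-- The number `F n G a` can be computed in polynomial time into any register that is not used by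
the context. -/
def Num (Γ : Ctx α) (F : ∀ n : ℕ, SimpleGraph (Fin n) → α n → ℕ) : Prop :=
  ∀ b, Γ.bound ≤ b → ∃ (p : Prog) (f : Polynomial ℕ), ∀ (n : ℕ) (G : SimpleGraph (Fin n)) (a : α n)
    (s : Store), Γ.Holds G a s → ∃ (s' : Store) (t : ℕ), Exec p s s' t ∧ t ≤ f.eval n ∧
      s'.arr = s.arr ∧ (∀ r < b, s'.reg r = s.reg r) ∧ s'.reg b = F n G a

theorem Ctx.Holds.of_eq {Γ : Ctx α} {n : ℕ} {G : SimpleGraph (Fin n)} {a : α n} {s s' : Store}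
    (h : Γ.Holds G a s) (harr : s'.arr = s.arr) (hreg : ∀ r < Γ.bound, s'.reg r = s.reg r) :
    Γ.Holds G a s' :=
  ⟨(hreg 0 Γ.pos).trans h.size, harr.trans h.arr, Γ.congr a s s' hreg h.rel⟩

/-- The context extended by one vertex, kept in register `b + 1`. -/
def Ctx.ext (Γ : Ctx α) (b : ℕ) (hb : Γ.bound ≤ b) : Ctx (fun n => α n × Fin n) where
  bound := b + 2
  rel p s := Γ.rel p.1 s ∧ s.reg (b + 1) = p.2
  pos := by omega
  congr a s s' h h' :=
    ⟨Γ.congr a.1 s s' (fun r hr => h r (by omega)) h'.1, (h (b + 1) (by omega)).trans h'.2⟩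

/-- The empty context. -/
def Ctx.nil : Ctx (fun _ => Unit) where
  bound := 1
  rel _ _ := True
  pos := one_pos
  congr _ _ _ _ _ := trivial

/-- The vertex `t` is a variable of the context. -/
def Var (Γ : Ctx α) (t : ∀ n : ℕ, α n → Fin n) : Prop :=
  ∃ r, ∀ (n : ℕ) (a : α n) (s : Store), Γ.rel a s → s.reg r = t n a

theorem Var.fst {Γ : Ctx α} {t : ∀ n : ℕ, α n → Fin n} {b : ℕ} {hb : Γ.bound ≤ b}
    (h : Var Γ t) : Var (Γ.ext b hb) (fun n p => t n p.1) := by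
  obtain ⟨r, hr⟩ := h
  exact ⟨r, fun n a s hs => hr n a.1 s hs.1⟩

theorem Var.snd {Γ : Ctx α} {b : ℕ} {hb : Γ.bound ≤ b} :
    Var (Γ.ext b hb) (fun _ p => p.2) :=
  ⟨b + 1, fun _ _ _ hs => hs.2⟩

@[simp] theorem Store.setReg_reg (s : Store) (r x k : ℕ) :
    (s.setReg r x).reg k = if k = r then x else s.reg k := rfl

@[simp] theorem Store.setReg_arr (s : Store) (r x : ℕ) : (s.setReg r x).arr = s.arr := rfl

theorem Num.ofExpr {Γ : Ctx α} {F : ∀ n : ℕ, SimpleGraph (Fin n) → α n → ℕ} (e : Expr)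
    (h : ∀ (n : ℕ) (G : SimpleGraph (Fin n)) (a : α n) (s : Store), Γ.Holds G a s →
      e.eval s = F n G a) : Num Γ F := by
  intro b hb
  refine ⟨.setReg b e, 1, fun n G a s hs => ⟨_, _, Exec.setReg b e s, by simp, rfl, ?_, ?_⟩⟩
  · intro r hr
    simp [hr.ne]
  · simp [h n G a s hs]

/-- The second operand is computed into register `b + 1`, which protects the first one in register
`b`. -/
theorem Num.binop {Γ : Ctx α} {F F' : ∀ n : ℕ, SimpleGraph (Fin n) → α n → ℕ}
    (hF : Num Γ F) (hF' : Num Γ F') (g : ℕ → ℕ → ℕ) (op : Expr → Expr → Expr)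
    (hop : ∀ s e e', (op e e').eval s = g (e.eval s) (e'.eval s)) :
    Num Γ (fun n G a => g (F n G a) (F' n G a)) := by
  intro b hb
  obtain ⟨p, f, hp⟩ := hF b hb
  obtain ⟨p', f', hp'⟩ := hF' (b + 1) (by omega)
  refine ⟨.seq p (.seq p' (.setReg b (op (.reg b) (.reg (b + 1))))), f + (f' + 1),
    fun n G a s hs => ?_⟩
  obtain ⟨s₁, t₁, h1, ht1, harr1, hreg1, hval1⟩ := hp n G a s hs
  obtain ⟨s₂, t₂, h2, ht2, harr2, hreg2, hval2⟩ := hp' n G a s₁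
    (hs.of_eq harr1 fun r hr => hreg1 r (by omega))
  refine ⟨_, _, Exec.seq h1 (Exec.seq h2 (Exec.setReg _ _ _)), ?_, ?_, ?_, ?_⟩
  · simp only [Polynomial.eval_add, Polynomial.eval_one]
    omega
  · rw [Store.setReg_arr, harr2, harr1]
  · intro r hr
    rw [Store.setReg_reg, if_neg hr.ne, hreg2 r (by omega), hreg1 r hr]
  · rw [Store.setReg_reg, if_pos rfl, hop]
    simp only [Expr.eval]
    rw [hreg2 b (by omega), hval1, hval2]

/-- Register `b` accumulates the sum, `b + 1` is the loop counter and holds the bound vertex, and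
the summand is computed into `b + 2`. -/
theorem Num.sum {Γ : Ctx α} {F : ∀ n : ℕ, SimpleGraph (Fin n) → α n → Fin n → ℕ}
    (hF : ∀ b (hb : Γ.bound ≤ b), Num (Γ.ext b hb) (fun n G p => F n G p.1 p.2)) :
    Num Γ (fun n G a => ∑ x, F n G a x) := by
  intro b hb
  obtain ⟨p, f, hp⟩ := hF b hb (b + 2) le_rfl
  let body : Prog := .seq p (.seq (.setReg b (.add (.reg b) (.reg (b + 2))))
    (.setReg (b + 1) (.add (.reg (b + 1)) (.const 1))))
  let guard : Expr := .sub (.reg 0) (.reg (b + 1))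
  refine ⟨.seq (.setReg b (.const 0)) (.seq (.setReg (b + 1) (.const 0)) (.loop guard body)),
    -- Each round costs the summand, two assignments and a test. The last 3 counts the two
    -- initializations and the final failing test.
    Polynomial.X * (f + 3) + 3, fun n G a s hs => ?_⟩
  let g : ℕ → ℕ := fun j => if h : j < n then F n G a ⟨j, h⟩ else 0
  have hg : ∑ x, F n G a x = ∑ j ∈ Finset.range n, g j := by
    rw [Finset.sum_range]
    exact Finset.sum_congr rfl fun x _ => by simp [g]
  have hpos := Γ.pos
  have main : ∀ m i, i + m = n → ∀ s₁ : Store, Γ.Holds G a s₁ → s₁.reg (b + 1) = i →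
      s₁.reg b = ∑ j ∈ Finset.range i, g j →
      ∃ (s' : Store) (t : ℕ), Exec (.loop guard body) s₁ s' t ∧ t ≤ m * (f.eval n + 3) + 1 ∧
        s'.arr = s₁.arr ∧ (∀ r < b, s'.reg r = s₁.reg r) ∧
        s'.reg b = ∑ j ∈ Finset.range n, g j := by
    intro m
    induction m with
    | zero =>
      intro i hi s₁ h1 hi1 hacc
      refine ⟨s₁, 1, Exec.loop_done ?_, by omega, rfl, fun _ _ => rfl, ?_⟩
      · simp only [guard, Expr.eval, h1.size, hi1]
        omega
      · rw [hacc, show i = n by omega]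
    | succ m ih =>
      intro i hi s₁ h1 hi1 hacc
      have hin : i < n := by omega
      obtain ⟨s₂, t₂, h2, ht2, harr2, hreg2, hval2⟩ := hp n G (a, ⟨i, hin⟩) s₁
        ⟨h1.size, h1.arr, h1.rel, hi1⟩
      let s₃ := s₂.setReg b (s₂.reg b + s₂.reg (b + 2))
      let s₄ := s₃.setReg (b + 1) (s₃.reg (b + 1) + 1)
      have hreg : ∀ r < b, s₄.reg r = s₁.reg r := by
        intro r hr
        simp only [s₄, s₃, Store.setReg_reg]
        rw [if_neg (by omega), if_neg (by omega), hreg2 r (by omega)]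
      have harr : s₄.arr = s₁.arr := by
        simp only [s₄, s₃, Store.setReg_arr, harr2]
      have hex : Exec body s₁ s₄ (t₂ + (1 + 1)) :=
        Exec.seq h2 (Exec.seq (Exec.setReg _ _ _) (Exec.setReg _ _ _))
      obtain ⟨s', t, h', ht, harr', hreg', hval'⟩ := ih (i + 1) (by omega) s₄
        (h1.of_eq harr fun r hr => hreg r (by omega))
        (by simp [s₄, s₃, hreg2 (b + 1) (by omega), hi1])
        (by
          simp only [s₄, s₃, Store.setReg_reg]
          rw [if_neg (by omega), if_pos trivial, hreg2 b (by omega), hacc, hval2,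
            Finset.sum_range_succ]
          simp [g, hin])
      refine ⟨s', _, Exec.loop_step ?_ hex h', ?_, harr'.trans harr,
        fun r hr => (hreg' r hr).trans (hreg r hr), hval'⟩
      · simp only [guard, Expr.eval, h1.size, hi1]
        omega
      · rw [add_mul]
        omega
  let s₁ := (s.setReg b 0).setReg (b + 1) 0
  have hreg1 : ∀ r < b, s₁.reg r = s.reg r := by
    intro r hr
    simp only [s₁, Store.setReg_reg]
    rw [if_neg (by omega), if_neg (by omega)]
  obtain ⟨s', t, h', ht, harr', hreg', hval'⟩ := main n 0 (by omega) s₁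
    (hs.of_eq rfl fun r hr => hreg1 r (by omega)) (by simp [s₁]) (by simp [s₁])
  refine ⟨s', _, Exec.seq (Exec.setReg _ _ _) (Exec.seq (Exec.setReg _ _ _) h'), ?_, harr',
    fun r hr => (hreg' r hr).trans (hreg1 r hr), hval'.trans hg.symm⟩
  simp only [Polynomial.eval_add, Polynomial.eval_mul, Polynomial.eval_X, Polynomial.eval_ofNat]
  omega

theorem Num.congr {Γ : Ctx α} {F F' : ∀ n : ℕ, SimpleGraph (Fin n) → α n → ℕ} (hF : Num Γ F)
    (h : ∀ n G a, F n G a = F' n G a) : Num Γ F' := by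
  rwa [show F' = F from by ext n G a; exact (h n G a).symm]

theorem Num.const {Γ : Ctx α} (c : ℕ) : Num Γ (fun _ _ _ => c) :=
  Num.ofExpr (.const c) fun _ _ _ _ _ => rfl

theorem Num.add {Γ : Ctx α} {F F' : ∀ n : ℕ, SimpleGraph (Fin n) → α n → ℕ}
    (hF : Num Γ F) (hF' : Num Γ F') : Num Γ (fun n G a => F n G a + F' n G a) :=
  hF.binop hF' (· + ·) .add fun _ _ _ => rfl

theorem Num.sub {Γ : Ctx α} {F F' : ∀ n : ℕ, SimpleGraph (Fin n) → α n → ℕ}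
    (hF : Num Γ F) (hF' : Num Γ F') : Num Γ (fun n G a => F n G a - F' n G a) :=
  hF.binop hF' (· - ·) .sub fun _ _ _ => rfl

open Classical in
/-- The truth value of a proposition. -/
noncomputable def truth (p : Prop) : ℕ := if p then 1 else 0

@[simp] theorem truth_eq_zero {p : Prop} : truth p = 0 ↔ ¬ p := by simp [truth]

@[simp] theorem truth_eq_one {p : Prop} : truth p = 1 ↔ p := by simp [truth]

/-- The property `P` can be decided in polynomial time in the context `Γ`. -/
def Dec (Γ : Ctx α) (P : ∀ n : ℕ, SimpleGraph (Fin n) → α n → Prop) : Prop :=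
  Num Γ (fun n G a => truth (P n G a))

/-- Truncated subtraction turns any nonzero value into 1 by `1 - (1 - F)`. -/
theorem Num.dec {Γ : Ctx α} {F : ∀ n : ℕ, SimpleGraph (Fin n) → α n → ℕ}
    {P : ∀ n : ℕ, SimpleGraph (Fin n) → α n → Prop} (hF : Num Γ F)
    (h : ∀ n G a, F n G a ≠ 0 ↔ P n G a) : Dec Γ P := by
  refine ((Num.const 1).sub ((Num.const 1).sub hF)).congr fun n G a => ?_
  have := h n G a
  by_cases hP : P n G a
  · rw [truth_eq_one.2 hP]
    have := this.2 hP
    omega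
  · rw [truth_eq_zero.2 hP]
    have : F n G a = 0 := by
      by_contra h0
      exact hP (this.1 h0)
    omega

namespace Dec

variable {Γ : Ctx α} {P Q : ∀ n : ℕ, SimpleGraph (Fin n) → α n → Prop}

theorem congr (h : Dec Γ P) (hPQ : ∀ n G a, P n G a ↔ Q n G a) : Dec Γ Q :=
  Num.congr h fun n G a => by rw [hPQ]

theorem adj {t t' : ∀ n : ℕ, α n → Fin n} (h : Var Γ t) (h' : Var Γ t') :
    Dec Γ (fun n G a => G.Adj (t n a) (t' n a)) := by
  obtain ⟨r, hr⟩ := h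
  obtain ⟨r', hr'⟩ := h'
  refine Num.ofExpr (.entry 0 (.reg r) (.reg r')) fun n G a s hs => ?_
  simp only [Expr.eval, hr n a s hs.rel, hr' n a s hs.rel, hs.arr, inputStore]
  rw [truth]
  congr 1
  simp

theorem eq {t t' : ∀ n : ℕ, α n → Fin n} (h : Var Γ t) (h' : Var Γ t') :
    Dec Γ (fun n _ a => t n a = t' n a) := by
  obtain ⟨r, hr⟩ := h
  obtain ⟨r', hr'⟩ := h'
  refine Num.dec (F := fun n G a => 1 - (((t n a : ℕ) - t' n a) + (t' n a - t n a)))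
    (Num.ofExpr (.sub (.const 1) (.add (.sub (.reg r) (.reg r')) (.sub (.reg r') (.reg r))))
      fun n G a s hs => ?_) fun n G a => ?_
  · simp only [Expr.eval, hr n a s hs.rel, hr' n a s hs.rel]
  · simp only [Fin.ext_iff]
    omega

theorem not (h : Dec Γ P) : Dec Γ (fun n G a => ¬ P n G a) := by
  refine Num.dec ((Num.const 1).sub h) fun n G a => ?_
  by_cases hP : P n G a <;> simp [truth, hP]

theorem and (h : Dec Γ P) (h' : Dec Γ Q) : Dec Γ (fun n G a => P n G a ∧ Q n G a) := by
  refine Num.dec ((Num.add h h').sub (Num.const 1)) fun n G a => ?_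
  by_cases hP : P n G a <;> by_cases hQ : Q n G a <;> simp [truth, hP, hQ]

theorem or (h : Dec Γ P) (h' : Dec Γ Q) : Dec Γ (fun n G a => P n G a ∨ Q n G a) :=
  (h.not.and h'.not).not.congr fun _ _ _ => by tauto

theorem imp (h : Dec Γ P) (h' : Dec Γ Q) : Dec Γ (fun n G a => P n G a → Q n G a) :=
  (h.and h'.not).not.congr fun _ _ _ => by tauto

theorem iff (h : Dec Γ P) (h' : Dec Γ Q) : Dec Γ (fun n G a => P n G a ↔ Q n G a) :=
  ((h.imp h').and (h'.imp h)).congr fun _ _ _ => by tauto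

/-- A quantifier over vertices is a nonzero test on a sum of truth values, so it costs one loop. -/
theorem ex {P : ∀ n : ℕ, SimpleGraph (Fin n) → α n → Fin n → Prop}
    (h : ∀ b (hb : Γ.bound ≤ b), Dec (Γ.ext b hb) (fun n G p => P n G p.1 p.2)) :
    Dec Γ (fun n G a => ∃ x, P n G a x) := by
  refine Num.dec (Num.sum (F := fun n G a x => truth (P n G a x)) h) fun n G a => ?_
  simp [Finset.sum_eq_zero_iff]

theorem all {P : ∀ n : ℕ, SimpleGraph (Fin n) → α n → Fin n → Prop}
    (h : ∀ b (hb : Γ.bound ≤ b), Dec (Γ.ext b hb) (fun n G p => P n G p.1 p.2)) :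
    Dec Γ (fun n G a => ∀ x, P n G a x) :=
  (Dec.ex (P := fun n G a x => ¬ P n G a x) fun b hb => (h b hb).not).not.congr
    fun _ _ _ => by simp

theorem ncard_eq {P Q : ∀ n : ℕ, SimpleGraph (Fin n) → α n → Fin n → Prop}
    (h : ∀ b (hb : Γ.bound ≤ b), Dec (Γ.ext b hb) (fun n G p => P n G p.1 p.2))
    (h' : ∀ b (hb : Γ.bound ≤ b), Dec (Γ.ext b hb) (fun n G p => Q n G p.1 p.2)) :
    Dec Γ (fun n G a => {x | P n G a x}.ncard = {x | Q n G a x}.ncard) := by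
  classical
  have hsum : ∀ (n : ℕ) (R : Fin n → Prop), ∑ x, truth (R x) = {x | R x}.ncard := by
    intro n R
    rw [Set.ncard_eq_toFinset_card', Set.toFinset_ofPred, Finset.card_filter]
    exact Finset.sum_congr rfl fun x _ => by simp [truth]
  have hP := Num.sum (F := fun n G a x => truth (P n G a x)) h
  have hQ := Num.sum (F := fun n G a x => truth (Q n G a x)) h'
  refine Num.dec ((Num.const 1).sub ((hP.sub hQ).add (hQ.sub hP))) fun n G a => ?_
  simp only [hsum]
  omega

end Dec

theorem polyTimeRecognizable_of_dec {P : ∀ {n : ℕ}, SimpleGraph (Fin n) → Prop}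
    (h : Dec Ctx.nil (fun _ G _ => P G)) : PolyTimeRecognizable P := by
  obtain ⟨p, f, hp⟩ := h 1 le_rfl
  -- Register 0 must keep `n` during the computation, so the answer is produced in register 1 and
  -- copied in one extra step.
  refine ⟨.seq p (.setReg 0 (.reg 1)), f + 1, fun n G => ?_⟩
  obtain ⟨s, t, h1, ht, -, -, hval⟩ := hp n G () (inputStore G) ⟨by simp [inputStore], rfl, trivial⟩
  refine ⟨_, _, Exec.seq h1 (Exec.setReg _ _ _), ?_, ?_⟩
  · simpa using ht
  · simp [Expr.eval, hval]

end Machine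

end CISGraph

namespace CISGraph

universe u

/-! ### Local structure of CIS line graphs -/

section Types

variable {V : Type u}

/-- Equal or adjacent. -/
def Near (G : SimpleGraph V) (x y : V) : Prop := x = y ∨ G.Adj x y

/-- The closed neighborhood of `s` is a clique. -/
def Simplicial (G : SimpleGraph V) (s : V) : Prop :=
  ∀ x y, Near G s x → Near G s y → Near G x y

/-- All cliques of at most three vertices that contain `v` lie in closed neighborhoods of
simplicial vertices. -/
def Covered (G : SimpleGraph V) (v : V) : Prop :=
  ∀ x y, Near G v x → Near G v y → Near G x y →
    ∃ s, Simplicial G s ∧ Near G s v ∧ Near G s x ∧ Near G s y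

/-- Among three simplicial neighbors of `v`, two are equal or adjacent. -/
def ClawFreeAt (G : SimpleGraph V) (v : V) : Prop :=
  ∀ r s t, Simplicial G r → Simplicial G s → Simplicial G t → Near G r v → Near G s v →
    Near G t v → Near G r s ∨ Near G r t ∨ Near G s t

/-- If two distinct simplicial cliques share `v` and another vertex `w`, then one of them is a
triangle. -/
def LinearAt (G : SimpleGraph V) (v : V) : Prop :=
  ∀ w s t, v ≠ w → Simplicial G s → Simplicial G t → ¬ Near G s t → G.Adj s v → G.Adj s w →
    G.Adj t v → G.Adj t w →
    (∀ z, G.Adj s z → z = v ∨ z = w) ∨ ∀ z, G.Adj t z → z = v ∨ z = w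

/-- `v` lies in a component whose vertices are covered by three pairs of non-adjacent (possibly
equal) vertices, with all edges between distinct pairs. -/
def OctahedralAt (G : SimpleGraph V) (v : V) : Prop :=
  ∃ p p' q q' r r', (v = p ∨ v = p' ∨ v = q ∨ v = q' ∨ v = r ∨ v = r') ∧
    (¬ G.Adj p p' ∧ ¬ G.Adj q q' ∧ ¬ G.Adj r r') ∧
    (G.Adj p q ∧ G.Adj p q' ∧ G.Adj p' q ∧ G.Adj p' q') ∧
    (G.Adj p r ∧ G.Adj p r' ∧ G.Adj p' r ∧ G.Adj p' r') ∧
    (G.Adj q r ∧ G.Adj q r' ∧ G.Adj q' r ∧ G.Adj q' r') ∧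
    ∀ x y, x = p ∨ x = p' ∨ x = q ∨ x = q' ∨ x = r ∨ x = r' → G.Adj x y →
      y = p ∨ y = p' ∨ y = q ∨ y = q' ∨ y = r ∨ y = r'

/-- `x` is near both `v` and `c`. -/
def OnLine (G : SimpleGraph V) (v c x : V) : Prop := Near G v x ∧ Near G c x

/-- In the line graph of a complete bipartite graph, `k` is the point where the line through `x`
that is not parallel to the line through `v` and `c` meets the latter. -/
def ProjectsTo (G : SimpleGraph V) (v c x k : V) : Prop :=
  OnLine G v c k ∧ (x = k ∨ (G.Adj x k ∧ ¬ OnLine G v c x))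

/-- `x` has coordinates `k` and `r`. -/
def Cell (G : SimpleGraph V) (v c d x k r : V) : Prop :=
  ProjectsTo G v c x k ∧ ProjectsTo G v d x r

/-- `v` lies in a component that is the line graph of a balanced complete bipartite graph. -/
def RookAt (G : SimpleGraph V) (v : V) : Prop :=
  ∃ c d, (∃ k r, Cell G v c d v k r) ∧
    (∀ x k r, Cell G v c d x k r → ∀ x' k' r', Cell G v c d x' k' r' →
      ((x = x' ↔ k = k' ∧ r = r') ∧ (Near G x x' ↔ k = k' ∨ r = r'))) ∧
    (∀ x k r, Cell G v c d x k r → ∀ y, G.Adj x y → ∃ k' r', Cell G v c d y k' r') ∧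
    (∀ k r, OnLine G v c k → OnLine G v d r → ∃ x, Cell G v c d x k r) ∧
    {k | OnLine G v c k}.ncard = {r | OnLine G v d r}.ncard

/-- The local description of CIS line graphs. -/
def Admissible (G : SimpleGraph V) : Prop :=
  (∃ v : V, v = v) ∧ ∀ v, OctahedralAt G v ∨ RookAt G v ∨ Covered G v ∧ ClawFreeAt G v ∧ LinearAt G v

end Types

/-! ### Evaluating the local description. -/

section Decidable

theorem dec_admissible : Dec Ctx.nil (fun _ G _ => Admissible G) := by
  unfold Admissible OctahedralAt RookAt Cell ProjectsTo OnLine Covered ClawFreeAt LinearAt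
    Simplicial Near Ne
  -- The number of `fst` is the de Bruijn index of a variable. Nine vertices are in scope at the
  -- deepest point, inside `RookAt`.
  repeat' first
    | exact Var.snd
    | exact Var.snd.fst
    | exact Var.snd.fst.fst
    | exact Var.snd.fst.fst.fst
    | exact Var.snd.fst.fst.fst.fst
    | exact Var.snd.fst.fst.fst.fst.fst
    | exact Var.snd.fst.fst.fst.fst.fst.fst
    | exact Var.snd.fst.fst.fst.fst.fst.fst.fst
    | exact Var.snd.fst.fst.fst.fst.fst.fst.fst.fst
    | apply Dec.and
    | apply Dec.or
    | apply Dec.adj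
    | apply Dec.eq
    | apply Dec.not
    | (apply Dec.ncard_eq <;> intro _ _)
    | apply Dec.iff
    | (apply Dec.all; intro _ _)
    | (apply Dec.ex; intro _ _)
    | apply Dec.imp

end Decidable
end CISGraph

namespace CISGraph

/-! ### Admissible graphs are CIS line graphs -/

section Near

universe u

variable {V : Type u} {G : SimpleGraph V}

theorem Near.refl (x : V) : Near G x x := Or.inl rfl

theorem Near.symm {x y : V} (h : Near G x y) : Near G y x := h.imp Eq.symm fun h => h.symm

theorem Near.adj {x y : V} (h : Near G x y) (hne : x ≠ y) : G.Adj x y := h.resolve_left hne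

theorem Simplicial.near_iff {s t x : V} (hs : Simplicial G s) (ht : Simplicial G t)
    (hst : Near G s t) : Near G s x ↔ Near G t x :=
  ⟨fun h => hs t x hst h, fun h => ht s x hst.symm h⟩

theorem near_of_isClique {C : Set V} (hC : G.IsClique C) {x y : V} (hx : x ∈ C) (hy : y ∈ C) :
    Near G x y := by
  by_cases h : x = y
  · exact Or.inl h
  · exact Or.inr (hC hx hy h)

theorem IsMaxClique.mem_of_forall_near {C : Set V} (hC : IsMaxClique G C) {x : V}
    (hx : ∀ y ∈ C, Near G x y) : x ∈ C := hC.mem_of_forall_adj fun y hy hne => (hx y hy).adj hne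

theorem IsMaxClique.inter_nonempty_of_simplicial {C S : Set V} (hC : IsMaxClique G C)
    (hS : IsMaxStable G S) {s : V} (hs : Simplicial G s) (hCs : ∀ x ∈ C, Near G s x) :
    (C ∩ S).Nonempty := by
  have hmem : ∀ x, Near G s x → x ∈ C := fun x hx =>
    hC.mem_of_forall_near fun y hy => hs x y hx (hCs y hy)
  by_cases hsS : s ∈ S
  · exact ⟨s, hmem s (.refl s), hsS⟩
  · obtain ⟨y, hy, hsy⟩ := hS.exists_adj hsS
    exact ⟨y, hmem y (Or.inr hsy), hy⟩

/-- If `C` lies in the closed neighborhood of a simplicial vertex, it equals that neighborhood, and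
`S` meets it by maximality. Otherwise `x` separates `r` from `s` and `t`, and `y` separates `s` from
`t`. This gives three pairwise distant simplicial vertices near `v`, against `ClawFreeAt`. Hence
covering cliques of size three suffices. -/
theorem Covered.inter_nonempty {v : V} (hv : Covered G v) (hv' : ClawFreeAt G v) {C S : Set V}
    (hC : IsMaxClique G C) (hS : IsMaxStable G S) (hvC : v ∈ C) : (C ∩ S).Nonempty := by
  by_contra hno
  have hex : ∀ s, Simplicial G s → ∃ x ∈ C, ¬ Near G s x := by
    intro s hs
    by_contra! h
    exact hno (hC.inter_nonempty_of_simplicial hS hs h)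
  have near : ∀ {x y}, x ∈ C → y ∈ C → Near G x y := near_of_isClique hC.1
  obtain ⟨r, hr, hrv, -, -⟩ := hv v v (.refl v) (.refl v) (.refl v)
  obtain ⟨x, hx, hrx⟩ := hex r hr
  obtain ⟨s, hs, hsv, hsx, -⟩ := hv x x (near hvC hx) (near hvC hx) (.refl x)
  obtain ⟨y, hy, hsy⟩ := hex s hs
  obtain ⟨t, ht, htv, htx, hty⟩ := hv x y (near hvC hx) (near hvC hy) (near hx hy)
  rcases hv' r s t hr hs ht hrv hsv htv with h | h | h
  · exact hrx ((hr.near_iff hs h).2 hsx)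
  · exact hrx ((hr.near_iff ht h).2 htx)
  · exact hsy ((hs.near_iff ht h).2 hty)

/-- `ρ` and `γ` are coordinates with values in `K` and `R` that represent the union `D` of some
components of `G` as the line graph of a balanced complete bipartite graph. -/
structure RookCoords (G : SimpleGraph V) (D K R : Set V) (ρ γ : V → V) : Prop where
  closed : ∀ x ∈ D, ∀ y, G.Adj x y → y ∈ D
  row_mem : ∀ x ∈ D, ρ x ∈ K
  col_mem : ∀ x ∈ D, γ x ∈ R
  inj : ∀ x ∈ D, ∀ y ∈ D, ρ x = ρ y → γ x = γ y → x = y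
  near : ∀ x ∈ D, ∀ y ∈ D, (Near G x y ↔ ρ x = ρ y ∨ γ x = γ y)
  surj : ∀ k ∈ K, ∀ r ∈ R, ∃ x ∈ D, ρ x = k ∧ γ x = r
  card : K.ncard = R.ncard

theorem RookAt.exists_coords {v : V} (h : RookAt G v) :
    ∃ (D K R : Set V) (ρ γ : V → V), v ∈ D ∧ RookCoords G D K R ρ γ := by
  obtain ⟨c, d, hv, hX, hcl, hsurj, hcard⟩ := h
  let D : Set V := {x | ∃ k r, Cell G v c d x k r}
  have hD : ∀ x, ∃ k r, x ∈ D → Cell G v c d x k r := by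
    intro x
    by_cases hx : x ∈ D
    · obtain ⟨k, r, hkr⟩ := hx
      exact ⟨k, r, fun _ => hkr⟩
    · exact ⟨x, x, fun h => absurd h hx⟩
  choose ρ γ hργ using hD
  refine ⟨D, {k | OnLine G v c k}, {r | OnLine G v d r}, ρ, γ, hv, ?_, ?_, ?_, ?_, ?_, ?_, hcard⟩
  · intro x hx y hxy
    exact hcl x _ _ (hργ x hx) y hxy
  · exact fun x hx => (hργ x hx).1.1
  · exact fun x hx => (hργ x hx).2.1
  · exact fun x hx y hy h1 h2 => (hX x _ _ (hργ x hx) y _ _ (hργ y hy)).1.2 ⟨h1, h2⟩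
  · exact fun x hx y hy => (hX x _ _ (hργ x hx) y _ _ (hργ y hy)).2
  · intro k hk r hr
    obtain ⟨x, hx⟩ := hsurj k r hk hr
    have hxD : x ∈ D := ⟨k, r, hx⟩
    obtain ⟨h1, h2⟩ := (hX x _ _ (hργ x hxD) x _ _ hx).1.1 rfl
    exact ⟨x, hxD, h1, h2⟩

theorem RookCoords.swap {D K R : Set V} {ρ γ : V → V} (h : RookCoords G D K R ρ γ) :
    RookCoords G D R K γ ρ where
  closed := h.closed
  row_mem := h.col_mem
  col_mem := h.row_mem
  inj x hx y hy h1 h2 := h.inj x hx y hy h2 h1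
  near x hx y hy := (h.near x hx y hy).trans or_comm
  surj k hk r hr := by
    obtain ⟨x, hx, h1, h2⟩ := h.surj r hr k hk
    exact ⟨x, hx, h2, h1⟩
  card := h.card.symm

/-- If row `k` is missed, every cell of that row has a neighbor in `S` in its own column, so `S` has
at least `R.ncard` elements in `D`. They occupy distinct rows other than `k`, which are too few as
`K` and `R` have equal size. -/
theorem RookCoords.exists_mem_row [Finite V] {D K R : Set V} {ρ γ : V → V}
    (h : RookCoords G D K R ρ γ) {S : Set V} (hS : IsMaxStable G S) {k : V} (hk : k ∈ K) :
    ∃ s ∈ S, s ∈ D ∧ ρ s = k := by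
  by_contra! hno
  have hinj : ∀ s ∈ S ∩ D, ∀ t ∈ S ∩ D, ρ s = ρ t ∨ γ s = γ t → s = t := by
    intro s hs t ht hst
    by_contra hne
    exact hS.not_adj hs.1 ht.1 (((h.near s hs.2 t ht.2).2 hst).adj hne)
  have h1 : R ⊆ γ '' (S ∩ D) := by
    intro r hr
    obtain ⟨x, hxD, hxk, hxr⟩ := h.surj k hk r hr
    have hxS : x ∉ S := fun hxS => hno x hxS hxD hxk
    obtain ⟨s, hs, hxs⟩ := hS.exists_adj hxS
    have hsD := h.closed x hxD s hxs
    refine ⟨s, ⟨hs, hsD⟩, ?_⟩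
    rcases (h.near x hxD s hsD).1 (Or.inr hxs) with h' | h'
    · exact absurd (h'.symm.trans hxk) (hno s hs hsD)
    · exact h'.symm.trans hxr
  have h2 : ρ '' (S ∩ D) ⊆ K \ {k} := by
    rintro _ ⟨s, hs, rfl⟩
    exact ⟨h.row_mem s hs.2, hno s hs.1 hs.2⟩
  have e1 : R.ncard ≤ (S ∩ D).ncard :=
    (Set.ncard_le_ncard h1).trans (Set.ncard_image_le (Set.toFinite _))
  have e2 : (S ∩ D).ncard ≤ (K \ {k}).ncard := by
    rw [← Set.InjOn.ncard_image (f := ρ) fun s hs t ht hst => hinj s hs t ht (Or.inl hst)]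
    exact Set.ncard_le_ncard h2
  have e3 := Set.ncard_sdiff_singleton_lt_of_mem hk (Set.toFinite K)
  have := h.card
  omega

/-- A clique lies in one row or one column: a cell off the row of `v` and a cell off its column,
both near `v`, share no coordinate. Rows and columns are then handled alike by `swap`. -/
theorem RookCoords.inter_nonempty [Finite V] {D K R : Set V} {ρ γ : V → V}
    (h : RookCoords G D K R ρ γ) {C S : Set V} (hC : IsMaxClique G C) (hS : IsMaxStable G S)
    {v : V} (hvC : v ∈ C) (hvD : v ∈ D) : (C ∩ S).Nonempty := by
  have hCD : ∀ x ∈ C, x ∈ D := fun x hx => by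
    by_cases hvx : v = x
    · exact hvx ▸ hvD
    · exact h.closed v hvD x (hC.1 hvC hx hvx)
  have aux : ∀ {K R : Set V} {ρ γ : V → V}, RookCoords G D K R ρ γ → (∀ x ∈ C, ρ x = ρ v) →
      (C ∩ S).Nonempty := by
    intro K R ρ γ h hρ
    obtain ⟨s, hs, hsD, hsk⟩ := h.exists_mem_row hS (h.row_mem v hvD)
    exact ⟨s, hC.mem_of_forall_near fun y hy =>
      (h.near s hsD y (hCD y hy)).2 (Or.inl (hsk.trans (hρ y hy).symm)), hs⟩
  by_cases h1 : ∀ x ∈ C, ρ x = ρ v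
  · exact aux h h1
  by_cases h2 : ∀ x ∈ C, γ x = γ v
  · exact aux h.swap h2
  push Not at h1 h2
  obtain ⟨x, hx, hxv⟩ := h1
  obtain ⟨y, hy, hyv⟩ := h2
  have nx := (h.near x (hCD x hx) v hvD).1 (near_of_isClique hC.1 hx hvC)
  have ny := (h.near y (hCD y hy) v hvD).1 (near_of_isClique hC.1 hy hvC)
  have nxy := (h.near x (hCD x hx) y (hCD y hy)).1 (near_of_isClique hC.1 hx hy)
  have gx := nx.resolve_left hxv
  have gy := ny.resolve_right hyv
  rcases nxy with h' | h'
  · exact absurd (h'.trans gy) hxv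
  · exact absurd (h'.symm.trans gx) hyv

/-- A maximal clique contains a vertex of each of the three pairs, while a maximal stable set that
meets a pair contains all of it. The argument also covers pairs whose two members coincide. -/
theorem OctahedralAt.inter_nonempty {v : V} (h : OctahedralAt G v) {C S : Set V}
    (hC : IsMaxClique G C) (hS : IsMaxStable G S) (hvC : v ∈ C) : (C ∩ S).Nonempty := by
  obtain ⟨p, p', q, q', r, r', hv, ⟨np, nq, nr⟩, ⟨a1, a2, a3, a4⟩, ⟨b1, b2, b3, b4⟩,
    ⟨c1, c2, c3, c4⟩, hcl⟩ := h
  have hCD : ∀ x ∈ C, x = p ∨ x = p' ∨ x = q ∨ x = q' ∨ x = r ∨ x = r' := fun x hx => by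
    by_cases hvx : v = x
    · exact hvx ▸ hv
    · exact hcl v x hv (hC.1 hvC hx hvx)
  obtain ⟨s, hs, hsD⟩ : ∃ s ∈ S, s = p ∨ s = p' ∨ s = q ∨ s = q' ∨ s = r ∨ s = r' := by
    by_cases hvS : v ∈ S
    · exact ⟨v, hvS, hv⟩
    · obtain ⟨s, hs, hvs⟩ := hS.exists_adj hvS
      exact ⟨s, hs, hcl v s hv hvs⟩
  have aux : ∀ x x', ¬ G.Adj x x' →
      (∀ y, (y = p ∨ y = p' ∨ y = q ∨ y = q' ∨ y = r ∨ y = r') → y ≠ x → y ≠ x' →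
        G.Adj x y ∧ G.Adj x' y) → (∀ y, G.Adj x' y →
      (y = p ∨ y = p' ∨ y = q ∨ y = q' ∨ y = r ∨ y = r')) → x ∈ S → (C ∩ S).Nonempty := by
    intro x x' hxx hD hx' hxS
    by_cases hxC : x' ∈ C
    · refine ⟨x', hxC, hS.mem_of_forall_not_adj fun y hy hxy => ?_⟩
      have hyx : y ≠ x := fun e => hxx (e ▸ hxy.symm)
      exact hS.not_adj hxS hy (hD y (hx' y hxy) hyx hxy.ne').1
    · exact ⟨x, hC.mem_of_forall_adj fun y hy hxy =>
        (hD y (hCD y hy) hxy.symm fun e => hxC (e ▸ hy)).1, hxS⟩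
  have np' := fun h => np (SimpleGraph.Adj.symm h)
  have nq' := fun h => nq (SimpleGraph.Adj.symm h)
  have nr' := fun h => nr (SimpleGraph.Adj.symm h)
  have hp : ∀ y, (y = p ∨ y = p' ∨ y = q ∨ y = q' ∨ y = r ∨ y = r') → y ≠ p → y ≠ p' →
      G.Adj p y ∧ G.Adj p' y := by
    rintro y (h | h | rfl | rfl | rfl | rfl) h1 h2
    exacts [absurd h h1, absurd h h2, ⟨a1, a3⟩, ⟨a2, a4⟩, ⟨b1, b3⟩, ⟨b2, b4⟩]
  have hq : ∀ y, (y = p ∨ y = p' ∨ y = q ∨ y = q' ∨ y = r ∨ y = r') → y ≠ q → y ≠ q' →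
      G.Adj q y ∧ G.Adj q' y := by
    rintro y (rfl | rfl | h | h | rfl | rfl) h1 h2
    exacts [⟨a1.symm, a2.symm⟩, ⟨a3.symm, a4.symm⟩, absurd h h1, absurd h h2, ⟨c1, c3⟩, ⟨c2, c4⟩]
  have hr : ∀ y, (y = p ∨ y = p' ∨ y = q ∨ y = q' ∨ y = r ∨ y = r') → y ≠ r → y ≠ r' →
      G.Adj r y ∧ G.Adj r' y := by
    rintro y (rfl | rfl | rfl | rfl | h | h) h1 h2
    exacts [⟨b1.symm, b2.symm⟩, ⟨b3.symm, b4.symm⟩, ⟨c1.symm, c2.symm⟩, ⟨c3.symm, c4.symm⟩,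
      absurd h h1, absurd h h2]
  rcases hsD with rfl | rfl | rfl | rfl | rfl | rfl
  · exact aux s p' np hp (fun y => hcl p' y (by simp)) hs
  · exact aux s p np' (fun y hy h1 h2 => (hp y hy h2 h1).symm) (fun y => hcl p y (by simp)) hs
  · exact aux s q' nq hq (fun y => hcl q' y (by simp)) hs
  · exact aux s q nq' (fun y hy h1 h2 => (hq y hy h2 h1).symm) (fun y => hcl q y (by simp)) hs
  · exact aux s r' nr hr (fun y => hcl r' y (by simp)) hs
  · exact aux s r nr' (fun y hy h1 h2 => (hr y hy h2 h1).symm) (fun y => hcl r y (by simp)) hs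

theorem Admissible.isCIS [Finite V] (h : Admissible G) : IsCIS G := by
  obtain ⟨⟨v₀, -⟩, h⟩ := h
  have : Nonempty V := ⟨v₀⟩
  intro C S hC hS
  obtain ⟨v, hv⟩ := hC.nonempty
  rcases h v with h | h | ⟨h1, h2, -⟩
  · exact h.inter_nonempty hC hS hv
  · obtain ⟨D, K, R, ρ, γ, hvD, hX⟩ := h.exists_coords
    exact hX.inter_nonempty hC hS hv hvD
  · exact h1.inter_nonempty h2 hC hS hv

end Near

/-! ### Root graphs of admissible graphs. -/

section LocalRoot

variable {V : Type} {G : SimpleGraph V}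

/-- `G` restricted to `D` is represented as a line graph. -/
def HasLocalRoot (G : SimpleGraph V) (D : Set V) : Prop :=
  ∃ (W : Type) (_ : Finite W) (f : V → Sym2 W), (∀ x ∈ D, ¬ (f x).IsDiag) ∧
    (∀ x ∈ D, ∀ y ∈ D, f x = f y → x = y) ∧
    ∀ x ∈ D, ∀ y ∈ D, x ≠ y → (G.Adj x y ↔ ∃ z, z ∈ f x ∧ z ∈ f y)

theorem isLineGraph_of_hasLocalRoot_univ (h : HasLocalRoot G Set.univ) : IsLineGraph G := by
  obtain ⟨W, hW, f, h1, h2, h3⟩ := h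
  let H : SimpleGraph W := SimpleGraph.fromEdgeSet (Set.range f)
  have hH : ∀ e, e ∈ H.edgeSet ↔ ∃ v, f v = e := by
    intro e
    simp only [H, SimpleGraph.edgeSet_fromEdgeSet, Set.mem_sdiff, Set.mem_range]
    refine ⟨fun h => h.1, fun h => ⟨h, ?_⟩⟩
    obtain ⟨v, rfl⟩ := h
    exact h1 v trivial
  refine ⟨W, hW, H, ⟨⟨Equiv.ofBijective (fun v => ⟨f v, (hH _).2 ⟨v, rfl⟩⟩) ⟨?_, ?_⟩, ?_⟩⟩⟩
  · intro x y hxy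
    exact h2 x trivial y trivial (Subtype.ext_iff.1 hxy)
  · rintro ⟨e, he⟩
    obtain ⟨v, rfl⟩ := (hH e).1 he
    exact ⟨v, rfl⟩
  · intro x y
    rw [SimpleGraph.lineGraph_adj_iff_exists]
    constructor
    · rintro ⟨hne, h⟩
      exact (h3 x trivial y trivial fun e => hne (e ▸ rfl)).2 h
    · intro h
      exact ⟨fun e => h.ne (h2 x trivial y trivial (Subtype.ext_iff.1 e)), (h3 x trivial y trivial h.ne).1 h⟩

theorem mem_of_reachable {D : Set V} (hD : ∀ x ∈ D, ∀ y, G.Adj x y → y ∈ D) {x y : V}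
    (h : G.Reachable x y) (hx : x ∈ D) : y ∈ D := by
  obtain ⟨p⟩ := h
  induction p with
  | nil => exact hx
  | cons hadj _ ih => exact ih (hD _ hx _ hadj)

/-- One local root is chosen per connected component, and the disjoint union of these roots
represents the whole graph. -/
theorem isLineGraph_of_forall_hasLocalRoot [Finite V]
    (h : ∀ v, ∃ D : Set V, v ∈ D ∧ (∀ x ∈ D, ∀ y, G.Adj x y → y ∈ D) ∧ HasLocalRoot G D) :
    IsLineGraph G := by
  choose D hvD hcl W hW f h1 h2 h3 using h
  have hrep : ∀ c : G.ConnectedComponent, ∃ v, G.connectedComponentMk v = c := fun c =>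
    c.exists_rep
  choose rep hrep using hrep
  let κ := G.connectedComponentMk
  have hmem : ∀ x, x ∈ D (rep (κ x)) := fun x =>
    mem_of_reachable (hcl _) (SimpleGraph.ConnectedComponent.exact (hrep (κ x))) (hvD _)
  have : Finite G.ConnectedComponent := Quot.finite _
  let F : ∀ x, Sym2 (Σ c : G.ConnectedComponent, W (rep c)) := fun x =>
    (f (rep (κ x)) x).map (Sigma.mk (κ x))
  have hF : ∀ x z, z ∈ F x ↔ ∃ w ∈ f (rep (κ x)) x, ⟨κ x, w⟩ = z := fun x z => Sym2.mem_map
  have hκ : ∀ x y z, z ∈ F x → z ∈ F y → κ x = κ y := by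
    intro x y z hx hy
    obtain ⟨w, -, rfl⟩ := (hF x z).1 hx
    obtain ⟨w', -, hw'⟩ := (hF y _).1 hy
    exact (congrArg Sigma.fst hw').symm
  have hsame : ∀ c x, κ x = c → F x = (f (rep c) x).map (Sigma.mk c) := by
    rintro c x rfl; rfl
  have hsmem : ∀ c x, κ x = c → x ∈ D (rep c) := by
    rintro c x rfl; exact hmem x
  have hinj : ∀ c : G.ConnectedComponent, Function.Injective
      (Sigma.mk (β := fun c : G.ConnectedComponent => W (rep c)) c) :=
    fun c a b hab => eq_of_heq (Sigma.mk.inj hab).2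
  refine isLineGraph_of_hasLocalRoot_univ ⟨_, inferInstance, F, ?_, ?_, ?_⟩
  · intro x _ hx
    rw [Sym2.isDiag_map (hinj _)] at hx
    exact h1 _ x (hmem x) hx
  · intro x _ y _ hxy
    have hk : κ x = κ y := by
      obtain ⟨a, ha⟩ : ∃ a, a ∈ F x := by
        induction F x using Sym2.ind with
        | _ a b => exact ⟨a, by simp⟩
      exact hκ x y a ha (hxy ▸ ha)
    rw [hsame _ x hk, hsame _ y rfl] at hxy
    exact h2 _ x (hsmem _ x hk) y (hmem y) (Sym2.map.injective (hinj _) hxy)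
  · intro x _ y _ hne
    constructor
    · intro hxy
      have hk : κ x = κ y := SimpleGraph.ConnectedComponent.sound hxy.reachable
      obtain ⟨z, hz, hz'⟩ := (h3 _ x (hsmem _ x hk) y (hmem y) hne).1 hxy
      refine ⟨⟨κ y, z⟩, ?_, ?_⟩
      · rw [hsame _ x hk]
        exact Sym2.mem_map.2 ⟨z, hz, rfl⟩
      · exact Sym2.mem_map.2 ⟨z, hz', rfl⟩
    · rintro ⟨z, hz, hz'⟩
      have hk := hκ x y z hz hz'
      rw [hsame _ x hk] at hz
      obtain ⟨a, ha, rfl⟩ := Sym2.mem_map.1 hz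
      obtain ⟨b, hb, hab⟩ := Sym2.mem_map.1 hz'
      have := hinj _ hab
      subst this
      exact (h3 _ x (hsmem _ x hk) y (hmem y) hne).2 ⟨b, ha, hb⟩

theorem RookCoords.hasLocalRoot [Finite V] {D K R : Set V} {ρ γ : V → V}
    (h : RookCoords G D K R ρ γ) : HasLocalRoot G D := by
  refine ⟨V ⊕ V, inferInstance, fun x => s(Sum.inl (ρ x), Sum.inr (γ x)), by simp, ?_, ?_⟩
  · intro x hx y hy hxy
    simp only [Sym2.eq_iff, Sum.inl.injEq, Sum.inr.injEq, reduceCtorEq, and_self, or_false] at hxy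
    exact h.inj x hx y hy hxy.1 hxy.2
  · intro x hx y hy hne
    have := h.near x hx y hy
    simp only [Near, hne, false_or] at this
    rw [this]
    constructor
    · rintro (h' | h')
      · exact ⟨Sum.inl (ρ x), by simp, by simp [h']⟩
      · exact ⟨Sum.inr (γ x), by simp, by simp [h']⟩
    · rintro ⟨z, hz, hz'⟩
      simp only [Sym2.mem_iff] at hz hz'
      rcases hz with rfl | rfl
      · left; simpa using hz'
      · right; simpa using hz'

theorem OctahedralAt.exists_hasLocalRoot {v : V} (h : OctahedralAt G v) :
    ∃ D : Set V, v ∈ D ∧ (∀ x ∈ D, ∀ y, G.Adj x y → y ∈ D) ∧ HasLocalRoot G D := by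
  obtain ⟨p, p', q, q', r, r', hv, ⟨np, nq, nr⟩, ⟨a1, a2, a3, a4⟩, ⟨b1, b2, b3, b4⟩,
    ⟨c1, c2, c3, c4⟩, hcl⟩ := h
  let pat : Fin 6 → V := ![p, p', q, q', r, r']
  -- The pairs are sent to the three perfect matchings of `K_4`. If the two members of a pair
  -- coincide, `idx` picks one label, and the root is `K_4` with edges removed.
  let lab : Fin 6 → Sym2 (Fin 4) := ![s(0, 1), s(2, 3), s(0, 2), s(1, 3), s(0, 3), s(1, 2)]
  have hD : ∀ x, (x = p ∨ x = p' ∨ x = q ∨ x = q' ∨ x = r ∨ x = r') ↔ ∃ i, pat i = x := by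
    intro x
    simp [Fin.exists_fin_succ, pat, eq_comm]
  have hadj : ∀ i j, pat i ≠ pat j →
      (G.Adj (pat i) (pat j) ↔ ∃ z, z ∈ lab i ∧ z ∈ lab j) := by
    intro i j hij
    have key : ∀ (P Q : Prop), P → Q → (P ↔ Q) := fun _ _ hP hQ => ⟨fun _ => hQ, fun _ => hP⟩
    have key' : ∀ (P Q : Prop), ¬ P → ¬ Q → (P ↔ Q) := fun _ _ hP hQ =>
      ⟨fun h => absurd h hP, fun h => absurd h hQ⟩
    fin_cases i <;> fin_cases j <;>
    first
    | exact absurd rfl hij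
    | exact key _ _ ‹_› (by decide)
    | exact key _ _ (SimpleGraph.Adj.symm ‹_›) (by decide)
    | exact key' _ _ ‹_› (by decide)
    | exact key' _ _ (fun h => absurd h.symm ‹_›) (by decide)
  have hlab : Function.Injective lab := by decide
  have hidx : ∀ x, ∃ i, (∃ i, pat i = x) → pat i = x := by
    intro x
    by_cases hx : ∃ i, pat i = x
    · obtain ⟨i, hi⟩ := hx
      exact ⟨i, fun _ => hi⟩
    · exact ⟨0, fun h => absurd h hx⟩
  choose idx hidx using hidx
  refine ⟨{x | ∃ i, pat i = x}, (hD v).1 hv, ?_, Fin 4, inferInstance, fun x => lab (idx x), ?_, ?_, ?_⟩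
  · intro x hx y hxy
    exact (hD y).1 (hcl x y ((hD x).2 hx) hxy)
  · intro x _
    have : ∀ i, ¬ (lab i).IsDiag := by decide
    exact this _
  · intro x hx y hy hxy
    rw [← hidx x hx, ← hidx y hy, hlab hxy]
  · intro x hx y hy hne
    have := hadj (idx x) (idx y)
    rw [hidx x hx, hidx y hy] at this
    exact this hne

/-- This is Krausz's criterion: the cliques are the vertices of the root, and `x` is the edge
joining the cliques that contain it. The vertices `Sum.inr (x, i)` are private to `x` and supply the
ends it lacks when it lies in fewer than two cliques. -/
theorem hasLocalRoot_of_cliques [Finite V] {D : Set V} (𝒬 : Set (Set V))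
    (h1 : ∀ Q ∈ 𝒬, ∀ x ∈ Q, ∀ y ∈ Q, Near G x y)
    (h2 : ∀ x ∈ D, ∀ y ∈ D, G.Adj x y → ∃ Q ∈ 𝒬, x ∈ Q ∧ y ∈ Q)
    (h3 : ∀ Q ∈ 𝒬, ∀ Q' ∈ 𝒬, ∀ x ∈ D, ∀ y ∈ D, x ≠ y → x ∈ Q → y ∈ Q → x ∈ Q' → y ∈ Q' → Q = Q')
    (h4 : ∀ x ∈ D, ∀ Q₁ ∈ 𝒬, ∀ Q₂ ∈ 𝒬, ∀ Q₃ ∈ 𝒬, x ∈ Q₁ → x ∈ Q₂ → x ∈ Q₃ →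
      Q₁ = Q₂ ∨ Q₁ = Q₃ ∨ Q₂ = Q₃) : HasLocalRoot G D := by
  have hex : ∀ x, ∃ e : Sym2 (Set V ⊕ V × Bool), x ∈ D → ¬ e.IsDiag ∧
      (∀ Q, Sum.inl Q ∈ e ↔ Q ∈ 𝒬 ∧ x ∈ Q) ∧ ∀ y i, Sum.inr (y, i) ∈ e → y = x := by
    intro x
    by_cases hx : x ∈ D
    · by_cases hQ : ∃ Q, Q ∈ 𝒬 ∧ x ∈ Q
      · obtain ⟨Q, hQ, hxQ⟩ := hQ
        by_cases hQ' : ∃ Q', Q' ∈ 𝒬 ∧ x ∈ Q' ∧ Q ≠ Q'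
        · obtain ⟨Q', hQ', hxQ', hne⟩ := hQ'
          refine ⟨s(Sum.inl Q, Sum.inl Q'), fun _ => ⟨by simpa using hne, fun P => ?_, by simp⟩⟩
          simp only [Sym2.mem_iff, Sum.inl.injEq]
          constructor
          · rintro (rfl | rfl)
            · exact ⟨hQ, hxQ⟩
            · exact ⟨hQ', hxQ'⟩
          · rintro ⟨hP, hxP⟩
            rcases h4 x hx Q hQ Q' hQ' P hP hxQ hxQ' hxP with h | h | h
            · exact absurd h hne
            · exact Or.inl h.symm
            · exact Or.inr h.symm
        · push Not at hQ'
          refine ⟨s(Sum.inl Q, Sum.inr (x, true)), fun _ => ⟨by simp, fun P => ?_, by simp⟩⟩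
          simp only [Sym2.mem_iff, Sum.inl.injEq, reduceCtorEq, or_false]
          constructor
          · rintro rfl
            exact ⟨hQ, hxQ⟩
          · rintro ⟨hP, hxP⟩
            exact (hQ' P hP hxP).symm
      · refine ⟨s(Sum.inr (x, true), Sum.inr (x, false)), fun _ => ⟨by simp, fun P => ?_, ?_⟩⟩
        · simp only [Sym2.mem_iff, reduceCtorEq, or_self, false_iff]
          exact fun h => hQ ⟨P, h⟩
        · intro y i hy
          simp only [Sym2.mem_iff, Sum.inr.injEq, Prod.mk.injEq] at hy
          rcases hy with h | h
          · exact h.1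
          · exact h.1
    · exact ⟨s(Sum.inr (x, true), Sum.inr (x, true)), fun h => absurd h hx⟩
  choose f hf using hex
  refine ⟨_, inferInstance, f, fun x hx => (hf x hx).1, ?_, ?_⟩
  · intro x hx y hy hxy
    by_contra hne
    obtain ⟨n1, m1, p1⟩ := hf x hx
    obtain ⟨-, m2, p2⟩ := hf y hy
    rw [← hxy] at m2 p2
    have hinl : ∀ z ∈ f x, ∃ Q, z = Sum.inl Q := by
      rintro (Q | ⟨w, i⟩) hz
      · exact ⟨Q, rfl⟩
      · exact absurd ((p1 w i hz).symm.trans (p2 w i hz)) hne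
    revert n1 m1 m2 hinl
    induction f x using Sym2.ind with
    | _ a b =>
      intro n1 m1 m2 hinl
      obtain ⟨Q, rfl⟩ := hinl a (by simp)
      obtain ⟨Q', rfl⟩ := hinl b (by simp)
      have e1 := (m1 Q).1 (by simp)
      have e2 := (m1 Q').1 (by simp)
      have e3 := (m2 Q).1 (by simp)
      have e4 := (m2 Q').1 (by simp)
      refine n1 ?_
      rw [h3 Q e1.1 Q' e2.1 x hx y hy hne e1.2 e3.2 e2.2 e4.2]
      simp
  · intro x hx y hy hne
    obtain ⟨-, m1, p1⟩ := hf x hx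
    obtain ⟨-, m2, p2⟩ := hf y hy
    constructor
    · intro hxy
      obtain ⟨Q, hQ, hxQ, hyQ⟩ := h2 x hx y hy hxy
      exact ⟨Sum.inl Q, (m1 Q).2 ⟨hQ, hxQ⟩, (m2 Q).2 ⟨hQ, hyQ⟩⟩
    · rintro ⟨Q | ⟨w, i⟩, hz, hz'⟩
      · obtain ⟨hQ, hxQ⟩ := (m1 Q).1 hz
        exact (h1 Q hQ x hxQ y ((m2 Q).1 hz').2).adj hne
      · exact absurd ((p1 w i hz).symm.trans (p2 w i hz')) hne

/-- A simplicial vertex with exactly two neighbors, which have another common simplicial neighbor. -/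
def IsBase (G : SimpleGraph V) (g : V) : Prop :=
  Simplicial G g ∧ ∃ u w t, u ≠ w ∧ G.Adj g u ∧ G.Adj g w ∧ (∀ z, G.Adj g z → z = u ∨ z = w) ∧
    Simplicial G t ∧ ¬ Near G t g ∧ G.Adj t u ∧ G.Adj t w

/-- Any other simplicial vertex near `g` would be `u` or `w`, and its closed neighborhood would
contain the distant vertices `t` and `g`. -/
theorem IsBase.eq_of_near {g s : V} (hg : IsBase G g) (hs : Simplicial G s) (h : Near G s g) :
    s = g := by
  by_contra hne
  obtain ⟨-, u, w, t, -, -, -, hN, ht, htg, htu, htw⟩ := hg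
  have hts : Near G s t := by
    rcases hN s (h.adj hne).symm with rfl | rfl
    · exact Or.inr htu.symm
    · exact Or.inr htw.symm
  exact htg (hs t g hts h)

/-- Closed neighborhoods of simplicial vertices cover all edges, and by `ClawFreeAt` each vertex
lies in at most two of them. Two of them can share two vertices, but `LinearAt` then makes one a
triangle with a base vertex `g`. Replacing that triangle by the two edges at `g` restores Krausz's
conditions; in the root, `g` becomes the base of a pendant triangle. -/
theorem hasLocalRoot_of_covered [Finite V] {D : Set V} (hcl : ∀ x ∈ D, ∀ y, G.Adj x y → y ∈ D)
    (hcov : ∀ x ∈ D, Covered G x) (hclaw : ∀ x ∈ D, ClawFreeAt G x)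
    (hlin : ∀ x ∈ D, LinearAt G x) (hoct : ∀ x ∈ D, ¬ OctahedralAt G x) : HasLocalRoot G D := by
  have hclN : ∀ x ∈ D, ∀ y, Near G y x → y ∈ D := by
    rintro x hx y (rfl | hxy)
    · exact hx
    · exact hcl x hx y hxy.symm
  let 𝒬 : Set (Set V) := {Q | (∃ s, Simplicial G s ∧ ¬ IsBase G s ∧ Q = {x | Near G s x}) ∨
    ∃ g u, IsBase G g ∧ G.Adj g u ∧ Q = {g, u}}
  -- Splitting the triangle at `g` leaves the edge `uw` uncovered, and the clique of `t` takes it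
  -- over. This requires that `t` is not itself a base.
  have hbase : ∀ x ∈ D, ∀ g, IsBase G g → G.Adj g x → ∀ y, y ≠ x → G.Adj g y →
      ∃ t, Simplicial G t ∧ ¬ IsBase G t ∧ Near G t x ∧ Near G t y := by
    rintro x hx g ⟨hg, u, w, t, huw, hgu, hgw, hN, ht, htg, htu, htw⟩ hgx y hyx hgy
    have hgD : g ∈ D := hcl x hx g hgx.symm
    refine ⟨t, ht, ?_, ?_, ?_⟩
    -- If `t` were a base too, `ClawFreeAt` at `u` and `w` would confine the component to `g`, `t`,
    -- `u`, `w`. That is an octahedral component with two degenerate pairs.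
    · rintro ⟨-, u', w', -, -, -, -, hN', -⟩
      have hNt : ∀ z, G.Adj t z → z = u ∨ z = w := by
        intro z hz
        have e1 := hN' z hz
        have e2 := hN' u htu
        have e3 := hN' w htw
        rcases e1 with rfl | rfl <;> rcases e2 with rfl | rfl <;> rcases e3 with rfl | rfl <;> tauto
      have hcl' : ∀ a, a = u ∨ a = w → ∀ z, G.Adj a z → z = g ∨ z = t ∨ z = u ∨ z = w := by
        intro a ha z haz
        have haD : a ∈ D := hcl g hgD a (by rcases ha with rfl | rfl <;> assumption)
        have hga : Near G g a := Or.inr (by rcases ha with rfl | rfl <;> assumption)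
        have hta : Near G t a := Or.inr (by rcases ha with rfl | rfl <;> assumption)
        obtain ⟨s, hs, hsa, hsz, -⟩ := hcov a haD z z (Or.inr haz) (Or.inr haz) (.refl z)
        rcases hclaw a haD g t s hg ht hs hga hta hsa with h | h | h
        · exact absurd h.symm htg
        · rcases (hg.near_iff hs h).2 hsz with rfl | h'
          · exact Or.inl rfl
          · exact Or.inr (Or.inr (hN z h'))
        · rcases (ht.near_iff hs h).2 hsz with rfl | h'
          · exact Or.inr (Or.inl rfl)
          · exact Or.inr (Or.inr (hNt z h'))
      have huw' : G.Adj u w := (hg u w (Or.inr hgu) (Or.inr hgw)).adj huw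
      refine hoct g hgD ⟨u, u, w, w, g, t, by simp, ⟨G.irrefl, G.irrefl, fun h => htg (Or.inr h.symm)⟩,
        ⟨huw', huw', huw', huw'⟩, ⟨hgu.symm, htu.symm, hgu.symm, htu.symm⟩,
        ⟨hgw.symm, htw.symm, hgw.symm, htw.symm⟩, ?_⟩
      intro a b ha hab
      have hb : b = g ∨ b = t ∨ b = u ∨ b = w := by
        rcases ha with h | h | h | h | h | h
        · exact hcl' a (Or.inl h) b hab
        · exact hcl' a (Or.inl h) b hab
        · exact hcl' a (Or.inr h) b hab
        · exact hcl' a (Or.inr h) b hab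
        · exact Or.inr (Or.inr (hN b (h ▸ hab)))
        · exact Or.inr (Or.inr (hNt b (h ▸ hab)))
      tauto
    · rcases hN x hgx with rfl | rfl
      · exact Or.inr htu
      · exact Or.inr htw
    · rcases hN y hgy with rfl | rfl
      · exact Or.inr htu
      · exact Or.inr htw
  refine hasLocalRoot_of_cliques 𝒬 ?_ ?_ ?_ ?_
  · rintro _ (⟨s, hs, -, rfl⟩ | ⟨g, u, -, hgu, rfl⟩) x hx y hy
    · exact hs x y hx hy
    · rcases hx with rfl | rfl <;> rcases hy with rfl | rfl
      · exact .refl _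
      · exact Or.inr hgu
      · exact Or.inr hgu.symm
      · exact .refl _
  · intro x hx y hy hxy
    obtain ⟨s, hs, hsx, hsy, -⟩ := hcov x hx y y (Or.inr hxy) (Or.inr hxy) (.refl y)
    by_cases hsb : IsBase G s
    · by_cases e1 : s = x
      · subst e1
        exact ⟨{s, y}, Or.inr ⟨s, y, hsb, hxy, rfl⟩, by simp, by simp⟩
      by_cases e2 : s = y
      · subst e2
        exact ⟨{s, x}, Or.inr ⟨s, x, hsb, hxy.symm, rfl⟩, by simp, by simp⟩
      obtain ⟨t, ht, htb, htx, hty⟩ := hbase x hx s hsb (hsx.adj e1) y hxy.ne' (hsy.adj e2)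
      exact ⟨_, Or.inl ⟨t, ht, htb, rfl⟩, htx, hty⟩
    · exact ⟨_, Or.inl ⟨s, hs, hsb, rfl⟩, hsx, hsy⟩
  · have mixed : ∀ s g u x y, Simplicial G s → ¬ IsBase G s → IsBase G g → x ≠ y →
        x ∈ ({g, u} : Set V) → y ∈ ({g, u} : Set V) → Near G s x → Near G s y → False := by
      rintro s g u x y hs hsb hg hne (rfl | rfl) (rfl | rfl) h1 h2
      · exact hne rfl
      · exact hsb (hg.eq_of_near hs h1 ▸ hg)
      · exact hsb (hg.eq_of_near hs h2 ▸ hg)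
      · exact hne rfl
    rintro _ (⟨s, hs, hsb, rfl⟩ | ⟨g, u, hg, hgu, rfl⟩) _
      (⟨s', hs', hsb', rfl⟩ | ⟨g', u', hg', hgu', rfl⟩) x hx y hy hne h1 h2 h3 h4
    · by_cases hss : Near G s s'
      · ext z
        exact hs.near_iff hs' hss
      · exfalso
        have ne1 : ∀ z, Near G s z → Near G s' z → s ≠ z ∧ s' ≠ z := fun z h h' =>
          ⟨fun e => hss (e ▸ h'.symm), fun e => hss (e ▸ h)⟩
        have ax := ne1 x h1 h3
        have ay := ne1 y h2 h4
        rcases hlin x hx y s s' hne hs hs' hss (h1.adj ax.1) (h2.adj ay.1) (h3.adj ax.2)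
          (h4.adj ay.2) with h | h
        · exact hsb ⟨hs, x, y, s', hne, h1.adj ax.1, h2.adj ay.1, h, hs', fun h' => hss h'.symm,
            h3.adj ax.2, h4.adj ay.2⟩
        · exact hsb' ⟨hs', x, y, s, hne, h3.adj ax.2, h4.adj ay.2, h, hs, hss, h1.adj ax.1,
            h2.adj ay.1⟩
    · exact (mixed s g' u' x y hs hsb hg' hne h3 h4 h1 h2).elim
    · exact (mixed s' g u x y hs' hsb' hg hne h1 h2 h3 h4).elim
    · have pair : ∀ a b : V, x ∈ ({a, b} : Set V) → y ∈ ({a, b} : Set V) →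
          ({a, b} : Set V) = {x, y} := by
        rintro a b (rfl | rfl) (rfl | rfl)
        · exact absurd rfl hne
        · rfl
        · exact Set.pair_comm _ _
        · exact absurd rfl hne
      rw [pair g u h1 h2, pair g' u' h3 h4]
  · intro x hx
    by_cases hxb : IsBase G x
    · have key : ∀ Q ∈ 𝒬, x ∈ Q → ∃ u, G.Adj x u ∧ Q = {x, u} := by
        rintro _ (⟨s, hs, hsb, rfl⟩ | ⟨g, u, hg, hgu, rfl⟩) hxQ
        · exact absurd (hxb.eq_of_near hs hxQ ▸ hxb) hsb
        · rcases hxQ with rfl | rfl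
          · exact ⟨u, hgu, rfl⟩
          · exact absurd (hxb.eq_of_near hg.1 (Or.inr hgu)) hgu.ne
      intro Q₁ hQ₁ Q₂ hQ₂ Q₃ hQ₃ m₁ m₂ m₃
      obtain ⟨u₁, hu₁, rfl⟩ := key Q₁ hQ₁ m₁
      obtain ⟨u₂, hu₂, rfl⟩ := key Q₂ hQ₂ m₂
      obtain ⟨u₃, hu₃, rfl⟩ := key Q₃ hQ₃ m₃
      obtain ⟨-, u, w, -, -, -, -, hN, -⟩ := hxb
      rcases hN u₁ hu₁ with rfl | rfl <;> rcases hN u₂ hu₂ with rfl | rfl <;>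
        rcases hN u₃ hu₃ with rfl | rfl <;> simp
    · let P : V → Set V := fun s => {z | (IsBase G s ∧ (z = s ∨ z = x)) ∨ (¬ IsBase G s ∧ Near G s z)}
      have key : ∀ Q ∈ 𝒬, x ∈ Q → ∃ s, Simplicial G s ∧ Near G s x ∧ Q = P s := by
        rintro _ (⟨s, hs, hsb, rfl⟩ | ⟨g, u, hg, hgu, rfl⟩) hxQ
        · exact ⟨s, hs, hxQ, by ext z; simp [P, hsb]⟩
        · rcases hxQ with rfl | rfl
          · exact absurd hg hxb
          · exact ⟨g, hg.1, Or.inr hgu, by ext z; simp [P, hg]⟩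
      have hP : ∀ s t, Simplicial G s → Simplicial G t → Near G s t → P s = P t := by
        intro s t hs ht hst
        by_cases hsb : IsBase G s
        · rw [hsb.eq_of_near ht hst.symm]
        by_cases htb : IsBase G t
        · rw [htb.eq_of_near hs hst]
        ext z
        simp [P, hsb, htb, hs.near_iff ht hst]
      intro Q₁ hQ₁ Q₂ hQ₂ Q₃ hQ₃ m₁ m₂ m₃
      obtain ⟨s₁, h₁, n₁, rfl⟩ := key Q₁ hQ₁ m₁
      obtain ⟨s₂, h₂, n₂, rfl⟩ := key Q₂ hQ₂ m₂
      obtain ⟨s₃, h₃, n₃, rfl⟩ := key Q₃ hQ₃ m₃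
      rcases hclaw x hx s₁ s₂ s₃ h₁ h₂ h₃ n₁ n₂ n₃ with h | h | h
      · exact Or.inl (hP _ _ h₁ h₂ h)
      · exact Or.inr (Or.inl (hP _ _ h₁ h₃ h))
      · exact Or.inr (Or.inr (hP _ _ h₂ h₃ h))

theorem Admissible.isLineGraph [Finite V] (h : Admissible G) : IsLineGraph G := by
  refine isLineGraph_of_forall_hasLocalRoot fun v => ?_
  have hR : ∀ w, RookAt G w →
      ∃ D : Set V, w ∈ D ∧ (∀ x ∈ D, ∀ y, G.Adj x y → y ∈ D) ∧ HasLocalRoot G D := by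
    intro w hw
    obtain ⟨D, K, R, ρ, γ, hvD, hX⟩ := hw.exists_coords
    exact ⟨D, hvD, hX.closed, hX.hasLocalRoot⟩
  by_cases hw : ∃ w, G.Reachable w v ∧ (OctahedralAt G w ∨ RookAt G w)
  · obtain ⟨w, hwv, hw⟩ := hw
    obtain ⟨D, hwD, hcl, hD⟩ := hw.elim (fun h => h.exists_hasLocalRoot) (hR w)
    exact ⟨D, mem_of_reachable hcl hwv hwD, hcl, hD⟩
  · push Not at hw
    have hgood : ∀ x, G.Reachable x v → Covered G x ∧ ClawFreeAt G x ∧ LinearAt G x :=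
      fun x hx => ((h.2 x).resolve_left (hw x hx).1).resolve_left (hw x hx).2
    have hcl : ∀ x ∈ {x | G.Reachable x v}, ∀ y, G.Adj x y → y ∈ {x | G.Reachable x v} :=
      fun x hx y hxy => hxy.symm.reachable.trans hx
    exact ⟨{x | G.Reachable x v}, SimpleGraph.Reachable.refl v, hcl,
      hasLocalRoot_of_covered hcl (fun x hx => (hgood x hx).1) (fun x hx => (hgood x hx).2.1)
        (fun x hx => (hgood x hx).2.2) fun x hx => (hw x hx).1⟩

end LocalRoot

end CISGraph

namespace CISGraph

universe u v

/-! ### CIS line graphs are admissible -/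

section Structure

variable {V : Type u} {W : Type v} {G : SimpleGraph V} {H : SimpleGraph W} {f : V → Sym2 W}

/-- The graph `H` contains no bull. -/
def NoBull (H : SimpleGraph W) : Prop :=
  ∀ a' a b b' c : W, H.Adj a b → H.Adj b c → H.Adj a c → H.Adj a a' → H.Adj b b' →
    a' ≠ b → a' ≠ c → b' ≠ a → b' ≠ c → a' ≠ b' → False

/-- A triangle whose vertices `b` and `c` have degree two. -/
structure IsPendantTriangle (H : SimpleGraph W) (x b c : W) : Prop where
  xb : H.Adj x b
  xc : H.Adj x c
  bc : H.Adj b c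
  left : ∀ z, H.Adj b z → z = x ∨ z = c
  right : ∀ z, H.Adj c z → z = x ∨ z = b

/-- A component on four vertices that contains a diamond. -/
structure IsDiamondComponent (H : SimpleGraph W) (a b c d : W) : Prop where
  ab : H.Adj a b
  bc : H.Adj b c
  ac : H.Adj a c
  ad : H.Adj a d
  bd : H.Adj b d
  ne : c ≠ d
  closed : ∀ y, (y = a ∨ y = b ∨ y = c ∨ y = d) → ∀ z, H.Adj y z → z = a ∨ z = b ∨ z = c ∨ z = d

/-- The outer neighbors of `a` and `b` must coincide, since otherwise they are the horns of a bull.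
Any edge leaving the resulting diamond would again be a horn. -/
theorem NoBull.isDiamondComponent (h : NoBull H) {a b c a' b' : W} (hab : H.Adj a b)
    (hbc : H.Adj b c) (hac : H.Adj a c) (ha : H.Adj a a') (hb : H.Adj b b') (h1 : a' ≠ b)
    (h2 : a' ≠ c) (h3 : b' ≠ a) (h4 : b' ≠ c) : IsDiamondComponent H a b c a' := by
  have e : a' = b' := by
    by_contra hne
    exact h a' a b b' c hab hbc hac ha hb h1 h2 h3 h4 hne
  subst e
  refine ⟨hab, hbc, hac, ha, hb, h2.symm, ?_⟩
  intro y hy z hyz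
  by_contra! hz
  obtain ⟨za, zb, zc, zd⟩ := hz
  rcases hy with rfl | rfl | rfl | rfl
  · exact h z y b a' c hab hbc hac hyz hb zb zc h3 h2 zd
  · exact h z y a a' c hab.symm hac hbc hyz ha za zc h1 h2 zd
  · exact h z y a a' b hac.symm hab hbc.symm hyz ha za zb h2 h1 zd
  · exact h c a y z b ha hb.symm hab hac hyz h2.symm hbc.ne' za zb zc.symm

theorem NoBull.triangle_cases (h : NoBull H) {a b c : W} (hab : H.Adj a b) (hbc : H.Adj b c)
    (hac : H.Adj a c) : IsPendantTriangle H a b c ∨ IsPendantTriangle H b a c ∨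
      IsPendantTriangle H c a b ∨ (∃ d, IsDiamondComponent H a b c d) ∨
      (∃ d, IsDiamondComponent H b c a d) ∨ ∃ d, IsDiamondComponent H a c b d := by
  by_cases ha : ∃ z, H.Adj a z ∧ z ≠ b ∧ z ≠ c
  · obtain ⟨a', ha, h1, h2⟩ := ha
    by_cases hb : ∃ z, H.Adj b z ∧ z ≠ a ∧ z ≠ c
    · obtain ⟨b', hb, h3, h4⟩ := hb
      exact Or.inr (Or.inr (Or.inr (Or.inl ⟨_, h.isDiamondComponent hab hbc hac ha hb h1 h2 h3 h4⟩)))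
    by_cases hc : ∃ z, H.Adj c z ∧ z ≠ a ∧ z ≠ b
    · obtain ⟨c', hc, h3, h4⟩ := hc
      exact Or.inr (Or.inr (Or.inr (Or.inr (Or.inr
        ⟨_, h.isDiamondComponent hac hbc.symm hab ha hc h2 h1 h3 h4⟩))))
    exact Or.inl ⟨hab, hac, hbc, fun z hz => by by_contra! hh; exact hb ⟨z, hz, hh⟩,
      fun z hz => by by_contra! hh; exact hc ⟨z, hz, hh⟩⟩
  have ha' : ∀ z, H.Adj a z → z = b ∨ z = c := fun z hz => by by_contra! hh; exact ha ⟨z, hz, hh⟩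
  by_cases hb : ∃ z, H.Adj b z ∧ z ≠ a ∧ z ≠ c
  · obtain ⟨b', hb, h3, h4⟩ := hb
    by_cases hc : ∃ z, H.Adj c z ∧ z ≠ a ∧ z ≠ b
    · obtain ⟨c', hc, h5, h6⟩ := hc
      exact Or.inr (Or.inr (Or.inr (Or.inr (Or.inl
        ⟨_, h.isDiamondComponent hbc hac.symm hab.symm hb hc h4 h3 h6 h5⟩))))
    exact Or.inr (Or.inl ⟨hab.symm, hbc, hac, ha',
      fun z hz => by by_contra! hh; exact hc ⟨z, hz, hh.symm⟩⟩)
  exact Or.inr (Or.inr (Or.inl ⟨hac.symm, hbc.symm, hab, fun z hz => (ha' z hz).symm,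
    fun z hz => by by_contra! hh; exact hb ⟨z, hz, hh.symm⟩⟩))

/-! ### Reading the local conditions off the root graph. -/

namespace IsRoot

theorem near_iff (R : IsRoot G H f) {u v : V} : Near G u v ↔ ∃ x, x ∈ f u ∧ x ∈ f v := by
  constructor
  · rintro (rfl | h)
    · obtain ⟨a, b, h, -⟩ := R.exists_eq_mk u
      exact ⟨a, by simp [h], by simp [h]⟩
    · exact ((R.adj u v).1 h).2
  · rintro ⟨x, hu, hv⟩
    by_cases h : u = v
    · exact Or.inl h
    · exact Or.inr (R.adj_of_mem h hu hv)

theorem near_of_mem (R : IsRoot G H f) {u v : V} {x : W} (hu : x ∈ f u) (hv : x ∈ f v) :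
    Near G u v := R.near_iff.2 ⟨x, hu, hv⟩

/-- Each of the three edges meets `v` in one of its two ends, so two of them meet it in the same
end. -/
theorem clawFreeAt (R : IsRoot G H f) (v : V) : ClawFreeAt G v := by
  intro r s t _ _ _ hr hs ht
  obtain ⟨a, b, hab, -⟩ := R.exists_eq_mk v
  obtain ⟨x, hx, hxv⟩ := R.near_iff.1 hr
  obtain ⟨y, hy, hyv⟩ := R.near_iff.1 hs
  obtain ⟨z, hz, hzv⟩ := R.near_iff.1 ht
  rw [hab, Sym2.mem_iff] at hxv hyv hzv
  have : x = y ∨ x = z ∨ y = z := by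
    rcases hxv with rfl | rfl <;> rcases hyv with rfl | rfl <;> rcases hzv with rfl | rfl <;> simp
  rcases this with rfl | rfl | rfl
  · exact Or.inl (R.near_of_mem hx hy)
  · exact Or.inr (Or.inl (R.near_of_mem hx hz))
  · exact Or.inr (Or.inr (R.near_of_mem hy hz))

/-- The edges `s` and `t` are disjoint and `v`, `w` both join them. Since `v` and `w` meet, they
form a triangle with `s` or `t`, and simpliciality of that edge excludes any further edge touching
it. -/
theorem linearAt (R : IsRoot G H f) (v : V) : LinearAt G v := by
  intro w s t hvw hs ht hst hsv hsw htv htw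
  have aux : ∀ (t v w : V) (x y y' : W), Simplicial G t → G.Adj t v → G.Adj t w →
      f v = s(x, y) → f w = s(x, y') → y ∈ f t → y' ∈ f t → y ≠ y' → ∀ z, G.Adj t z → z = v ∨ z = w := by
    intro t v w x y y' ht htv htw hv hw hy hy' hyy z hz
    have hft := R.eq_of_two_mem hyy hy hy'
    have hzt : ¬ (y ∈ f z ∧ y' ∈ f z) := fun h' =>
      hz.ne (R.inj (hft.trans (R.eq_of_two_mem hyy h'.1 h'.2).symm))
    obtain ⟨a, hat, haz⟩ := ((R.adj t z).1 hz).2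
    obtain ⟨b, hbz, hbv⟩ := R.near_iff.1 (ht z v (Or.inr hz) (Or.inr htv))
    obtain ⟨c, hcz, hcw⟩ := R.near_iff.1 (ht z w (Or.inr hz) (Or.inr htw))
    rw [hft, Sym2.mem_iff] at hat
    rw [hv, Sym2.mem_iff] at hbv
    rw [hw, Sym2.mem_iff] at hcw
    rcases hat with rfl | rfl
    · rcases hcw with rfl | rfl
      · exact Or.inl (R.inj ((R.eq_of_two_mem (R.hadj hv).ne hcz haz).trans hv.symm))
      · exact absurd ⟨haz, hcz⟩ hzt
    · rcases hbv with rfl | rfl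
      · exact Or.inr (R.inj ((R.eq_of_two_mem (R.hadj hw).ne hbz haz).trans hw.symm))
      · exact absurd ⟨hbz, haz⟩ hzt
  have split : ∀ v, G.Adj s v → G.Adj t v → ∃ x y, x ∈ f s ∧ y ∈ f t ∧ f v = s(x, y) := by
    intro v hsv htv
    obtain ⟨-, x, hxs, hxv⟩ := (R.adj s v).1 hsv
    obtain ⟨-, y, hyt, hyv⟩ := (R.adj t v).1 htv
    exact ⟨x, y, hxs, hyt, R.eq_of_two_mem (fun e => hst (R.near_of_mem hxs (e ▸ hyt))) hxv hyv⟩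
  obtain ⟨x, y, hx, hy, hv⟩ := split v hsv htv
  obtain ⟨x', y', hx', hy', hw⟩ := split w hsw htw
  have hne : ¬ (x = x' ∧ y = y') := fun h' => hvw (R.inj (by rw [hv, hw, h'.1, h'.2]))
  obtain ⟨z, hzv, hzw⟩ := R.near_iff.1 (hs v w (Or.inr hsv) (Or.inr hsw))
  rw [hv, Sym2.mem_iff] at hzv
  rw [hw, Sym2.mem_iff] at hzw
  rcases hzv with rfl | rfl <;> rcases hzw with rfl | rfl
  · exact Or.inr (aux t v w z y y' ht htv htw hv hw hy hy' fun e => hne ⟨rfl, e⟩)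
  · exact absurd (R.near_of_mem hx hy') hst
  · exact absurd (R.near_of_mem hx' hy) hst
  · exact Or.inl (aux s v w z x x' hs hsv hsw (hv.trans Sym2.eq_swap) (hw.trans Sym2.eq_swap) hx hx'
      fun e => hne ⟨e, rfl⟩)

theorem simplicial_of_leaf (R : IsRoot G H f) {x l : W} {s : V} (hs : f s = s(x, l))
    (hl : ∀ z, H.Adj l z → z = x) : Simplicial G s := by
  have key : ∀ y, Near G s y → x ∈ f y := by
    intro y hy
    obtain ⟨z, hz, hzy⟩ := R.near_iff.1 hy
    rw [hs, Sym2.mem_iff] at hz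
    rcases hz with rfl | rfl
    · exact hzy
    · obtain ⟨w, hw, hzw⟩ := R.exists_eq_of_mem hzy
      rw [hw, hl w hzw]
      simp
  exact fun y z hy hz => R.near_of_mem (key y hy) (key z hz)

theorem simplicial_of_isPendantTriangle (R : IsRoot G H f) {x b c : W}
    (h : IsPendantTriangle H x b c) {s : V} (hs : f s = s(b, c)) : Simplicial G s := by
  have key : ∀ y, Near G s y → (b ∈ f y ∧ c ∈ f y) ∨ (b ∈ f y ∧ x ∈ f y) ∨ (c ∈ f y ∧ x ∈ f y) := by
    intro y hy
    obtain ⟨z, hz, hzy⟩ := R.near_iff.1 hy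
    obtain ⟨w, hw, hzw⟩ := R.exists_eq_of_mem hzy
    rw [hs, Sym2.mem_iff] at hz
    rcases hz with rfl | rfl
    · rcases h.left w hzw with rfl | rfl <;> simp [hw]
    · rcases h.right w hzw with rfl | rfl <;> simp [hw]
  intro y z hy hz
  rcases key y hy with h1 | h1 | h1 <;> rcases key z hz with h2 | h2 | h2 <;>
  first
  | exact R.near_of_mem h1.1 h2.1
  | exact R.near_of_mem h1.1 h2.2
  | exact R.near_of_mem h1.2 h2.1
  | exact R.near_of_mem h1.2 h2.2

theorem octahedralAt (R : IsRoot G H f) {a b c d : W} (h : IsDiamondComponent H a b c d) {v : V}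
    {x : W} (hx : x = a ∨ x = b ∨ x = c ∨ x = d) (hxv : x ∈ f v) : OctahedralAt G v := by
  obtain ⟨p, hp⟩ := R.exists_eq h.ab
  obtain ⟨q, hq⟩ := R.exists_eq h.ac
  obtain ⟨q', hq'⟩ := R.exists_eq h.bd
  obtain ⟨r, hr⟩ := R.exists_eq h.ad
  obtain ⟨r', hr'⟩ := R.exists_eq h.bc
  have n1 := h.ab.ne
  have n2 := h.ac.ne
  have n3 := h.ad.ne
  have n4 := h.bc.ne
  have n5 := h.bd.ne
  have n6 := h.ne
  -- If `cd` is not an edge, the partner of `p` is missing and the pair degenerates to `p' = p`.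
  obtain ⟨p', hp1, hp2⟩ : ∃ p', (f p' = s(a, b) ∨ f p' = s(c, d)) ∧ (H.Adj c d → f p' = s(c, d)) := by
    by_cases hcd : H.Adj c d
    · obtain ⟨p', hp'⟩ := R.exists_eq hcd
      exact ⟨p', Or.inr hp', fun _ => hp'⟩
    · exact ⟨p, Or.inl hp, fun h' => absurd h' hcd⟩
  have hall : ∀ y, (y = a ∨ y = b ∨ y = c ∨ y = d) → ∀ z, y ∈ f z →
      z = p ∨ z = p' ∨ z = q ∨ z = q' ∨ z = r ∨ z = r' := by
    intro y hy z hyz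
    obtain ⟨w, hw, hadj⟩ := R.exists_eq_of_mem hyz
    have hw' := h.closed y hy w hadj
    have e : ∀ {u : V} {a b : W}, f u = s(a, b) → f z = s(a, b) ∨ f z = s(b, a) → z = u :=
      fun hu hz => R.inj (hz.elim (fun h => h.trans hu.symm)
        fun h => (h.trans Sym2.eq_swap).trans hu.symm)
    rcases hy with rfl | rfl | rfl | rfl <;> rcases hw' with rfl | rfl | rfl | rfl
    · exact absurd rfl hadj.ne
    · exact Or.inl (e hp (Or.inl hw))
    · exact Or.inr (Or.inr (Or.inl (e hq (Or.inl hw))))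
    · exact Or.inr (Or.inr (Or.inr (Or.inr (Or.inl (e hr (Or.inl hw))))))
    · exact Or.inl (e hp (Or.inr hw))
    · exact absurd rfl hadj.ne
    · exact Or.inr (Or.inr (Or.inr (Or.inr (Or.inr (e hr' (Or.inl hw))))))
    · exact Or.inr (Or.inr (Or.inr (Or.inl (e hq' (Or.inl hw)))))
    · exact Or.inr (Or.inr (Or.inl (e hq (Or.inr hw))))
    · exact Or.inr (Or.inr (Or.inr (Or.inr (Or.inr (e hr' (Or.inr hw))))))
    · exact absurd rfl hadj.ne
    · exact Or.inr (Or.inl (e (hp2 hadj) (Or.inl hw)))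
    · exact Or.inr (Or.inr (Or.inr (Or.inr (Or.inl (e hr (Or.inr hw))))))
    · exact Or.inr (Or.inr (Or.inr (Or.inl (e hq' (Or.inr hw)))))
    · exact Or.inr (Or.inl (e (hp2 hadj.symm) (Or.inr hw)))
    · exact absurd rfl hadj.ne
  have hadj : ∀ {u w : V} {y y₁ y₂ : W}, f u = s(y, y₁) → f w = s(y, y₂) → y₁ ≠ y₂ → G.Adj u w := by
    intro u w y y₁ y₂ hu hw hne
    refine R.adj_of_mem (x := y) ?_ (by simp [hu]) (by simp [hw])
    rintro rfl
    exact hne (Sym2.congr_right.1 (hu.symm.trans hw))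
  have hnadj : ∀ {u w : V} {y₁ y₂ y₃ y₄ : W}, f u = s(y₁, y₂) → f w = s(y₃, y₄) → y₁ ≠ y₃ → y₁ ≠ y₄ →
      y₂ ≠ y₃ → y₂ ≠ y₄ → ¬ G.Adj u w := by
    intro u w y₁ y₂ y₃ y₄ hu hw h1 h2 h3 h4 huw
    obtain ⟨-, x, hx, hx'⟩ := (R.adj u w).1 huw
    rw [hu, Sym2.mem_iff] at hx
    rw [hw, Sym2.mem_iff] at hx'
    rcases hx with rfl | rfl <;> rcases hx' with rfl | rfl
    exacts [h1 rfl, h2 rfl, h3 rfl, h4 rfl]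
  have sw : ∀ {u : V} {a b : W}, f u = s(a, b) → f u = s(b, a) := fun h => h.trans Sym2.eq_swap
  have p1 : ¬ G.Adj p p' := by
    rcases hp1 with h' | h'
    · rw [R.inj (h'.trans hp.symm)]
      exact G.irrefl
    · exact hnadj hp h' n2 n3 n4 n5
  have p2 : G.Adj p' q ∧ G.Adj p' q' ∧ G.Adj p' r ∧ G.Adj p' r' := by
    rcases hp1 with h' | h'
    · exact ⟨hadj h' hq n4, hadj (sw h') hq' n3, hadj h' hr n5, hadj (sw h') hr' n2⟩
    · exact ⟨hadj h' (sw hq) n3.symm, hadj (sw h') (sw hq') n4.symm, hadj (sw h') (sw hr) n2.symm,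
        hadj h' (sw hr') n5.symm⟩
  refine ⟨p, p', q, q', r, r', hall x hx v hxv, ⟨p1, hnadj hq hq' n1 n3 n4.symm n6,
    hnadj hr hr' n1 n2 n5.symm n6.symm⟩,
    ⟨hadj hp hq n4, hadj (sw hp) hq' n3, p2.1, p2.2.1⟩,
    ⟨hadj hp hr n5, hadj (sw hp) hr' n2, p2.2.2.1, p2.2.2.2⟩,
    ⟨hadj hq hr n6, hadj (sw hq) (sw hr') n1, hadj (sw hq') (sw hr) n1.symm, hadj hq' hr' n6.symm⟩, ?_⟩
  intro y z hy hyz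
  obtain ⟨-, w, hwy, hwz⟩ := (R.adj y z).1 hyz
  refine hall w ?_ z hwz
  have m : ∀ {u : V} {y₁ y₂ : W}, f u = s(y₁, y₂) → w ∈ f u → w = y₁ ∨ w = y₂ :=
    fun hu hw => Sym2.mem_iff.1 (hu ▸ hw)
  rcases hy with rfl | rfl | rfl | rfl | rfl | rfl
  · exact (m hp hwy).imp_right Or.inl
  · exact hp1.elim (fun h' => (m h' hwy).imp_right Or.inl) fun h' => Or.inr (Or.inr (m h' hwy))
  · exact (m hq hwy).imp_right fun h => Or.inr (Or.inl h)
  · exact Or.inr ((m hq' hwy).imp_right Or.inr)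
  · exact (m hr hwy).imp_right fun h => Or.inr (Or.inr h)
  · exact Or.inr ((m hr' hwy).imp_right Or.inl)

end IsRoot

/-- `x` has no neighbor of degree one. -/
def NoLeafAt (H : SimpleGraph W) (x : W) : Prop := ∀ y, H.Adj x y → ∃ z, z ≠ x ∧ H.Adj y z

/-- In a maximal matching through `xb`, that edge can be exchanged for `bc` without losing
maximality. The new matching misses `x`, so all neighbors of `x` lie in `bc`, which leaves no room
for `y`. -/
theorem MissCondition.not_isPendantTriangle [Finite V] (R : IsRoot G H f)
    (hM : MissCondition G H f) {x b c y : W} (h : IsPendantTriangle H x b c) (hl : NoLeafAt H x)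
    (hy : H.Adj x y) (hyb : y ≠ b) (hyc : y ≠ c) : False := by
  obtain ⟨p, hp⟩ := R.exists_eq h.xb
  obtain ⟨q, hq⟩ := R.exists_eq h.bc
  obtain ⟨S, hpS, hS⟩ := exists_isMaxStable_superset (G := G) (S := {p}) (by simp)
  have hpS : p ∈ S := hpS rfl
  have hSp : ∀ s ∈ S, s ≠ p → x ∉ f s ∧ b ∉ f s ∧ c ∉ f s := by
    intro s hs hsp
    have hx : x ∉ f s := fun h' => hsp (R.eq_of_mem hS.1 hs hpS h' (by simp [hp]))
    have hb : b ∉ f s := fun h' => hsp (R.eq_of_mem hS.1 hs hpS h' (by simp [hp]))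
    refine ⟨hx, hb, fun hc => ?_⟩
    obtain ⟨w, hw, hcw⟩ := R.exists_eq_of_mem hc
    rcases h.right w hcw with rfl | rfl
    · exact hx (by simp [hw])
    · exact hb (by simp [hw])
  have hnq : ∀ z, b ∈ f z ∨ c ∈ f z → Near G z q := by
    rintro z (h' | h')
    · exact R.near_of_mem h' (by simp [hq])
    · exact R.near_of_mem h' (by simp [hq])
  let T : Set V := insert q (S \ {p})
  have hT : IsMaxStable G T := by
    refine isMaxStable_of ?_ ?_
    · have hqs : ∀ s ∈ S \ {p}, ¬ G.Adj q s := by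
        intro s hs hqs
        obtain ⟨-, w, hwq, hws⟩ := (R.adj q s).1 hqs
        obtain ⟨-, h1, h2⟩ := hSp s hs.1 hs.2
        rw [hq, Sym2.mem_iff] at hwq
        rcases hwq with rfl | rfl
        · exact h1 hws
        · exact h2 hws
      rintro s (rfl | hs) t (rfl | ht)
      · exact G.irrefl
      · exact hqs t ht
      · exact fun h' => hqs s hs h'.symm
      · exact hS.not_adj hs.1 ht.1
    · intro z hz
      have hzq : z ≠ q := fun e => hz (Or.inl e)
      have hq' : b ∈ f z ∨ c ∈ f z → ∃ y ∈ T, G.Adj z y := fun h' =>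
        ⟨q, Or.inl rfl, (hnq z h').adj hzq⟩
      have hT' : ∀ s ∈ S, s ≠ p → G.Adj z s → ∃ y ∈ T, G.Adj z y := fun s hs hsp hzs =>
        ⟨s, Or.inr ⟨hs, hsp⟩, hzs⟩
      by_cases hzp : z = p
      · exact hq' (Or.inl (by simp [hzp, hp]))
      have hzS : z ∉ S := fun h' => hz (Or.inr ⟨h', hzp⟩)
      obtain ⟨s, hs, hzs⟩ := hS.exists_adj hzS
      by_cases hsp : s = p
      · subst hsp
        obtain ⟨-, w, hwz, hws⟩ := (R.adj z s).1 hzs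
        rw [hp, Sym2.mem_iff] at hws
        rcases hws with rfl | rfl
        · obtain ⟨y', hy', hxy'⟩ := R.exists_eq_of_mem hwz
          by_cases hy'b : y' = b
          · exact hq' (Or.inl (by simp [hy', hy'b]))
          by_cases hy'c : y' = c
          · exact hq' (Or.inr (by simp [hy', hy'c]))
          by_cases hcov : ∃ s' ∈ S, y' ∈ f s'
          · obtain ⟨s', hs', hys'⟩ := hcov
            refine hT' s' hs' ?_ (R.adj_of_mem (x := y') (fun e => hzS (e ▸ hs')) (by simp [hy']) hys')
            rintro rfl
            rw [hp, Sym2.mem_iff] at hys'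
            rcases hys' with rfl | rfl
            · exact hxy'.ne rfl
            · exact hy'b rfl
          -- An edge `xy'` with `y'` uncovered would block maximality. All neighbors of `y'` would
          -- lie in `xb`, but `y'` is not a leaf and `b` has no neighbors besides `x` and `c`.
          · push Not at hcov
            obtain ⟨v', hv', hN⟩ := hM S hS y' hcov
            have : v' = s := R.eq_of_mem hS.1 hv' hs (hN w hxy'.symm) (by simp [hp])
            subst this
            obtain ⟨z', hz'x, hz'⟩ := hl y' hxy'
            have := hN z' hz'
            rw [hp, Sym2.mem_iff] at this
            rcases this with rfl | rfl
            · exact absurd rfl hz'x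
            · rcases h.left y' hz'.symm with rfl | rfl
              · exact absurd rfl hxy'.ne
              · exact absurd rfl hy'c
        · exact hq' (Or.inl hwz)
      · exact hT' s hs hsp hzs
  obtain ⟨v', hv', hN⟩ := hM T hT x (by
    rintro s (rfl | hs) hxs
    · rw [hq, Sym2.mem_iff] at hxs
      rcases hxs with rfl | rfl
      · exact h.xb.ne rfl
      · exact h.xc.ne rfl
    · exact (hSp s hs.1 hs.2).1 hxs)
  rcases hv' with rfl | hv'
  · have := hN y hy
    rw [hq, Sym2.mem_iff] at this
    exact this.elim hyb hyc
  · exact (hSp v' hv'.1 hv'.2).2.1 (hN b h.xb)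

/-- A vertex of degree at least two without neighbors of degree one that lies in no triangle. -/
structure IsInner (H : SimpleGraph W) (x : W) : Prop where
  two : ∃ y y', H.Adj x y ∧ H.Adj x y' ∧ y ≠ y'
  noLeaf : NoLeafAt H x
  noTriangle : ∀ y z, H.Adj x y → H.Adj x z → ¬ H.Adj y z

/-- An uncovered `x` would have two neighbors in a common edge, forming a triangle. -/
theorem IsInner.exists_mem (R : IsRoot G H f) (hM : MissCondition G H f) {x : W}
    (hx : IsInner H x) {S : Set V} (hS : IsMaxStable G S) : ∃ s ∈ S, x ∈ f s := by
  by_contra! hno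
  obtain ⟨v, -, hv⟩ := hM S hS x hno
  obtain ⟨y, y', hy, hy', hne⟩ := hx.two
  exact hx.noTriangle y y' hy hy' (R.hadj (R.eq_of_two_mem hne (hv y hy) (hv y' hy')))

/-- The edge at an inner vertex is determined by the rest of the maximal matching. If `T` used
another edge `xu`, then `u` could not be covered by `S`, and its neighbors would lie in `p`, making
`u` a leaf or creating a triangle at `x`. -/
theorem IsInner.mem_of_sdiff_subset (R : IsRoot G H f) (hM : MissCondition G H f) {x : W}
    (hx : IsInner H x) {S T : Set V} (hS : IsMaxStable G S) (hT : IsMaxStable G T) {p : V}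
    (hp : p ∈ S) (hxp : x ∈ f p) (hST : S \ {p} ⊆ T) : p ∈ T := by
  obtain ⟨q, hq, hxq⟩ := hx.exists_mem R hM hT
  by_contra hpT
  obtain ⟨u, hu, hxu⟩ := R.exists_eq_of_mem hxq
  have hpq : p ≠ q := fun e => hpT (e ▸ hq)
  obtain ⟨y, hy, hxy⟩ := R.exists_eq_of_mem hxp
  have huy : u ≠ y := fun e => hpq (R.inj (by rw [hu, hy, e]))
  by_cases hcov : ∃ s ∈ S, u ∈ f s
  · obtain ⟨s, hs, hus⟩ := hcov
    have hsp : s ≠ p := by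
      rintro rfl
      rw [hy, Sym2.mem_iff] at hus
      exact hus.elim hxu.ne' huy
    have := R.eq_of_mem hT.1 hq (hST ⟨hs, hsp⟩) (by simp [hu]) hus
    subst this
    exact hsp (R.eq_of_mem hS.1 hs hp hxq hxp)
  · push Not at hcov
    obtain ⟨v, hv, hN⟩ := hM S hS u hcov
    have := R.eq_of_mem hS.1 hv hp (hN x hxu.symm) hxp
    subst this
    obtain ⟨z, hzx, hz⟩ := hx.noLeaf u hxu
    have := hN z hz
    rw [hy, Sym2.mem_iff] at this
    rcases this with rfl | rfl
    · exact hzx rfl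
    · exact hx.noTriangle u z hxu hxy hz

/-- A leaf `l` at `y` would allow exchanging `xy` for `yl`, against `mem_of_sdiff_subset`. A
triangle at `y` would be pendant, which `not_isPendantTriangle` excludes, or would put `x` into a
diamond component and hence into a triangle. -/
theorem IsInner.adj [Finite V] (R : IsRoot G H f) (hM : MissCondition G H f) (hB : NoBull H)
    {x y : W} (hx : IsInner H x) (hxy : H.Adj x y) : IsInner H y := by
  obtain ⟨z, hzx, hyz⟩ := hx.noLeaf y hxy
  have hl : NoLeafAt H y := by
    intro l hyl
    by_contra! hno
    have hlx : l ≠ x := by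
      rintro rfl
      exact hno z (fun e => hyz.ne e.symm) (by
        obtain ⟨w, w', hw, hw', hne⟩ := hx.two
        by_cases e : w = y
        · exact absurd hw' (hno w' fun e' => hne (e.trans e'.symm))
        · exact absurd hw (hno w e))
    obtain ⟨p, hp⟩ := R.exists_eq hxy
    obtain ⟨q, hq⟩ := R.exists_eq hyl
    obtain ⟨S, hpS, hS⟩ := exists_isMaxStable_superset (G := G) (S := {p}) (by simp)
    have hpS : p ∈ S := hpS rfl
    obtain ⟨T, hST, hT⟩ := exists_isMaxStable_superset (G := G) (S := insert q (S \ {p})) (by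
      have key : ∀ s ∈ S \ {p}, ¬ G.Adj q s := by
        intro s hs hqs
        obtain ⟨-, w, hwq, hws⟩ := (R.adj q s).1 hqs
        have hys : y ∉ f s := fun h' => hs.2 (R.eq_of_mem hS.1 hs.1 hpS h' (by simp [hp]))
        rw [hq, Sym2.mem_iff] at hwq
        rcases hwq with rfl | rfl
        · exact hys hws
        · obtain ⟨w', hw', hadj⟩ := R.exists_eq_of_mem hws
          by_cases e : w' = y
          · exact hys (by simp [hw', e])
          · exact hno w' e hadj
      exact Set.Pairwise.insert (hS.1.mono Set.sdiff_subset) fun s hs _ =>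
        ⟨key s hs, fun h' => key s hs h'.symm⟩)
    have hpT := hx.mem_of_sdiff_subset R hM hS hT hpS (by simp [hp])
      ((Set.subset_insert _ _).trans hST)
    have := R.eq_of_mem hT.1 hpT (hST (Set.mem_insert _ _)) (x := y) (by simp [hp]) (by simp [hq])
    subst this
    exact hlx (Sym2.congr_right.1 ((hp.trans Sym2.eq_swap).symm.trans hq)).symm
  refine ⟨⟨x, z, hxy.symm, hyz, hzx.symm⟩, hl, ?_⟩
  intro b c hyb hyc hbc
  have hxb : x ≠ b := by rintro rfl; exact hx.noTriangle y c hxy hbc hyc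
  have hxc : x ≠ c := by rintro rfl; exact hx.noTriangle y b hxy hbc.symm hyb
  have hd : ∀ {a b c d}, IsDiamondComponent H a b c d → x ≠ d := by
    rintro a b c d h rfl
    exact hx.noTriangle a b h.ad.symm h.bd.symm h.ab
  rcases hB.triangle_cases hyb hbc hyc with h | h | h | ⟨d, h⟩ | ⟨d, h⟩ | ⟨d, h⟩
  · exact hM.not_isPendantTriangle R h hl hxy.symm hxb hxc
  · exact (h.left x hxy.symm).elim hxb hxc
  · exact (h.left x hxy.symm).elim hxc hxb
  · rcases h.closed y (by simp) x hxy.symm with e | e | e | e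
    exacts [hxy.ne e, hxb e, hxc e, hd h e]
  · rcases h.closed y (by simp) x hxy.symm with e | e | e | e
    exacts [hxb e, hxc e, hxy.ne e, hd h e]
  · rcases h.closed y (by simp) x hxy.symm with e | e | e | e
    exacts [hxy.ne e, hxc e, hxb e, hd h e]

/-- In a maximal matching containing `yz` and `xy'`, these two edges are exchanged for `xy` and the
result is extended. The extension covers `z` by some `zu`. The old matching covers the inner vertex
`u` too, and the only edge available for this is `xy'`, so `u = y'`. -/
theorem IsInner.adj_of_path [Finite V] (R : IsRoot G H f) (hM : MissCondition G H f)
    (hB : NoBull H) {x y y' z : W} (hx : IsInner H x) (hxy : H.Adj x y) (hxy' : H.Adj x y')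
    (hyz : H.Adj y z) (hzx : z ≠ x) (hyy : y' ≠ y) : H.Adj z y' := by
  have hzy' : z ≠ y' := by rintro rfl; exact hx.noTriangle y z hxy hxy' hyz
  have hz : IsInner H z := (hx.adj R hM hB hxy).adj R hM hB hyz
  obtain ⟨p, hp⟩ := R.exists_eq hyz
  obtain ⟨q, hq⟩ := R.exists_eq hxy'
  obtain ⟨e, he⟩ := R.exists_eq hxy
  obtain ⟨S, hpq, hS⟩ := exists_isMaxStable_superset (G := G) (S := {p, q}) (by
    refine Set.pairwise_pair.2 fun _ => ?_
    have : ¬ G.Adj p q := by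
      intro h'
      obtain ⟨-, w, hw, hw'⟩ := (R.adj p q).1 h'
      rw [hp, Sym2.mem_iff] at hw
      rw [hq, Sym2.mem_iff] at hw'
      rcases hw with rfl | rfl <;> rcases hw' with h | h
      exacts [hxy.ne h.symm, hyy h.symm, hzx h, hzy' h]
    exact ⟨this, fun h' => this h'.symm⟩)
  have hpS : p ∈ S := hpq (by simp)
  have hqS : q ∈ S := hpq (by simp)
  obtain ⟨T, hST, hT⟩ := exists_isMaxStable_superset (G := G) (S := insert e (S \ {p, q})) (by
    have key : ∀ s ∈ S \ {p, q}, ¬ G.Adj e s := by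
      intro s hs hes
      obtain ⟨-, w, hwe, hws⟩ := (R.adj e s).1 hes
      rw [he, Sym2.mem_iff] at hwe
      rcases hwe with rfl | rfl
      · exact hs.2 (Or.inr (R.eq_of_mem hS.1 hs.1 hqS hws (by simp [hq])))
      · exact hs.2 (Or.inl (R.eq_of_mem hS.1 hs.1 hpS hws (by simp [hp])))
    exact Set.Pairwise.insert (hS.1.mono Set.sdiff_subset) fun s hs _ =>
      ⟨key s hs, fun h' => key s hs h'.symm⟩)
  have heT : e ∈ T := hST (Set.mem_insert _ _)
  obtain ⟨t, ht, hzt⟩ := hz.exists_mem R hM hT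
  have hte : t ≠ e := by
    rintro rfl
    rw [he, Sym2.mem_iff] at hzt
    exact hzt.elim hzx hyz.ne'
  obtain ⟨u, hu, hzu⟩ := R.exists_eq_of_mem hzt
  have hux : u ≠ x := by
    rintro rfl
    exact hte (R.eq_of_mem hT.1 ht heT (x := u) (by simp [hu]) (by simp [he]))
  have huy : u ≠ y := by
    rintro rfl
    exact hte (R.eq_of_mem hT.1 ht heT (x := u) (by simp [hu]) (by simp [he]))
  obtain ⟨s, hs, hus⟩ := (hz.adj R hM hB hzu).exists_mem R hM hS
  by_cases hsp : s = p
  · subst hsp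
    rw [hp, Sym2.mem_iff] at hus
    exact (hus.elim huy hzu.ne').elim
  by_cases hsq : s = q
  · subst hsq
    rw [hq, Sym2.mem_iff] at hus
    rcases hus with h | h
    · exact absurd h hux
    · exact h ▸ hzu
  have hsT : s ∈ T := hST (Set.mem_insert_of_mem _ ⟨hs, by simp [hsp, hsq]⟩)
  have := R.eq_of_mem hT.1 ht hsT (x := u) (by simp [hu]) hus
  subst this
  exact absurd (R.eq_of_mem hS.1 hs hpS hzt (by simp [hp])) hsp

/-- The sets `A` and `B` form a complete bipartite component. -/
structure IsBipartiteComponent (H : SimpleGraph W) (A B : Set W) : Prop where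
  left : ∀ a ∈ A, ∀ w, H.Adj a w ↔ w ∈ B
  right : ∀ b ∈ B, ∀ w, H.Adj b w ↔ w ∈ A
  disjoint : ∀ a ∈ A, a ∉ B

namespace IsBipartiteComponent

variable {A B : Set W}

theorem swap (h : IsBipartiteComponent H A B) : IsBipartiteComponent H B A :=
  ⟨h.right, h.left, fun b hb ha => h.disjoint b ha hb⟩

theorem mk_eq_iff (h : IsBipartiteComponent H A B) {a a' b b' : W} (ha : a ∈ A) (hb' : b' ∈ B) :
    s(a, b) = s(a', b') ↔ a = a' ∧ b = b' := by
  rw [Sym2.eq_iff]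
  constructor
  · rintro (h' | ⟨rfl, rfl⟩)
    · exact h'
    · exact absurd hb' (h.disjoint _ ha)
  · exact Or.inl

theorem ncard_le [Finite W] (h : IsBipartiteComponent H A B) (R : IsRoot G H f) {S : Set V}
    (hS : G.IsIndepSet S) (hA : ∀ a ∈ A, ∃ s ∈ S, a ∈ f s) : A.ncard ≤ B.ncard := by
  have hex : ∀ a, ∃ b, a ∈ A → b ∈ B ∧ ∃ s ∈ S, f s = s(a, b) := by
    intro a
    by_cases ha : a ∈ A
    · obtain ⟨s, hs, has⟩ := hA a ha
      obtain ⟨b, hb, hab⟩ := R.exists_eq_of_mem has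
      exact ⟨b, fun _ => ⟨(h.left a ha b).1 hab, s, hs, hb⟩⟩
    · exact ⟨a, fun h' => absurd h' ha⟩
  choose g hg using hex
  refine Set.ncard_le_ncard_of_injOn g (fun a ha => (hg a ha).1) ?_ (Set.toFinite _)
  intro a ha a' ha' haa
  obtain ⟨hb, s, hs, hs'⟩ := hg a ha
  obtain ⟨hb', t, ht, ht'⟩ := hg a' ha'
  have := R.eq_of_mem hS hs ht (x := g a) (by simp [hs']) (by simp [ht', haa])
  subst this
  exact ((h.mk_eq_iff ha hb').1 (hs'.symm.trans ht')).1

/-- An edge meeting both `a₀b₀` and `a₁b₀` contains `b₀`, since `a₀` and `a₁` lie on the same side.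
The line through `v` and `c` is thus a copy of `A`. -/
theorem onLine_iff (h : IsBipartiteComponent H A B) (R : IsRoot G H f) {a₀ a₁ b₀ : W} {v c : V}
    (h₀ : a₀ ∈ A) (h₁ : a₁ ∈ A) (hne : a₀ ≠ a₁) (hb : b₀ ∈ B) (hv : f v = s(a₀, b₀))
    (hc : f c = s(a₁, b₀)) (k : V) : OnLine G v c k ↔ ∃ a ∈ A, f k = s(a, b₀) := by
  constructor
  · rintro ⟨h1, h2⟩
    obtain ⟨y, hyv, hyk⟩ := R.near_iff.1 h1
    obtain ⟨z, hzc, hzk⟩ := R.near_iff.1 h2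
    rw [hv, Sym2.mem_iff] at hyv
    rw [hc, Sym2.mem_iff] at hzc
    have hb' : b₀ ∈ f k → ∃ a ∈ A, f k = s(a, b₀) := by
      intro hbk
      obtain ⟨a, ha, hadj⟩ := R.exists_eq_of_mem hbk
      exact ⟨a, (h.right b₀ hb a).1 hadj, ha.trans Sym2.eq_swap⟩
    rcases hyv with rfl | rfl
    · rcases hzc with rfl | rfl
      · have := (h.left y h₀ z).1 (R.hadj (R.eq_of_two_mem hne hyk hzk))
        exact absurd this (h.disjoint z h₁)
      · exact hb' hzk
    · exact hb' hyk
  · rintro ⟨a, -, hk⟩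
    exact ⟨R.near_of_mem (x := b₀) (by simp [hv]) (by simp [hk]),
      R.near_of_mem (x := b₀) (by simp [hc]) (by simp [hk])⟩

theorem projectsTo_iff (h : IsBipartiteComponent H A B) (R : IsRoot G H f) {a₀ a₁ b₀ : W}
    {v c : V} (h₀ : a₀ ∈ A) (h₁ : a₁ ∈ A) (hne : a₀ ≠ a₁) (hb : b₀ ∈ B) (hv : f v = s(a₀, b₀))
    (hc : f c = s(a₁, b₀)) (x k : V) :
    ProjectsTo G v c x k ↔ ∃ a ∈ A, ∃ b ∈ B, f x = s(a, b) ∧ f k = s(a, b₀) := by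
  have hline := h.onLine_iff R h₀ h₁ hne hb hv hc
  rw [ProjectsTo, hline, hline]
  constructor
  · rintro ⟨⟨a, ha, hk⟩, rfl | ⟨hadj, hx⟩⟩
    · exact ⟨a, ha, b₀, hb, hk, hk⟩
    · obtain ⟨-, y, hyx, hyk⟩ := (R.adj x k).1 hadj
      obtain ⟨w, hw, hyw⟩ := R.exists_eq_of_mem hyx
      rw [hk, Sym2.mem_iff] at hyk
      rcases hyk with rfl | rfl
      · exact ⟨y, ha, w, (h.left y ha w).1 hyw, hw, hk⟩
      · exact absurd ⟨w, (h.right y hb w).1 hyw, hw.trans Sym2.eq_swap⟩ hx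
  · rintro ⟨a, ha, b, hb', hx, hk⟩
    refine ⟨⟨a, ha, hk⟩, ?_⟩
    by_cases hbb : b = b₀
    · exact Or.inl (R.inj (by rw [hx, hk, hbb]))
    · refine Or.inr ⟨R.adj_of_mem (x := a) ?_ (by simp [hx]) (by simp [hk]), ?_⟩
      · rintro rfl
        exact hbb ((h.mk_eq_iff ha hb).1 (hx.symm.trans hk)).2
      · rintro ⟨a', -, hx'⟩
        exact hbb ((h.mk_eq_iff ha hb).1 (hx.symm.trans hx')).2

theorem ncard_onLine (h : IsBipartiteComponent H A B) (R : IsRoot G H f) {a₀ a₁ b₀ : W}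
    {v c : V} (h₀ : a₀ ∈ A) (h₁ : a₁ ∈ A) (hne : a₀ ≠ a₁) (hb : b₀ ∈ B) (hv : f v = s(a₀, b₀))
    (hc : f c = s(a₁, b₀)) : {k | OnLine G v c k}.ncard = A.ncard := by
  have hline := h.onLine_iff R h₀ h₁ hne hb hv hc
  rw [← Set.ncard_image_of_injective _ R.inj,
    ← Set.InjOn.ncard_image (s := A) (f := fun a => s(a, b₀)) fun a ha a' ha' haa =>
      ((h.mk_eq_iff ha hb).1 haa).1]
  congr 1
  ext e
  simp only [Set.mem_image, Set.mem_ofPred_eq, hline]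
  constructor
  · rintro ⟨k, ⟨a, ha, hk⟩, rfl⟩
    exact ⟨a, ha, hk.symm⟩
  · rintro ⟨a, ha, rfl⟩
    obtain ⟨k, hk⟩ := R.exists_eq ((h.right b₀ hb a).2 ha)
    exact ⟨k, ⟨a, ha, hk.trans Sym2.eq_swap⟩, hk.trans Sym2.eq_swap⟩

theorem rookAt (h : IsBipartiteComponent H A B) (R : IsRoot G H f) (hcard : A.ncard = B.ncard)
    {a₀ a₁ b₀ b₁ : W} (h₀ : a₀ ∈ A) (h₁ : a₁ ∈ A) (ha : a₀ ≠ a₁) (h₂ : b₀ ∈ B) (h₃ : b₁ ∈ B)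
    (hb : b₀ ≠ b₁) {v : V} (hv : f v = s(a₀, b₀)) : RookAt G v := by
  have hedge : ∀ a ∈ A, ∀ b ∈ B, ∃ e, f e = s(a, b) := fun a ha b hb =>
    R.exists_eq ((h.left a ha b).2 hb)
  obtain ⟨c, hc⟩ := hedge a₁ h₁ b₀ h₂
  obtain ⟨d, hd⟩ := hedge a₀ h₀ b₁ h₃
  have hv' : f v = s(b₀, a₀) := hv.trans Sym2.eq_swap
  have hd' : f d = s(b₁, a₀) := hd.trans Sym2.eq_swap
  have hcell : ∀ x k r, Cell G v c d x k r ↔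
      ∃ a ∈ A, ∃ b ∈ B, f x = s(a, b) ∧ f k = s(a, b₀) ∧ f r = s(a₀, b) := by
    intro x k r
    rw [Cell, h.projectsTo_iff R h₀ h₁ ha h₂ hv hc, h.swap.projectsTo_iff R h₂ h₃ hb h₀ hv' hd']
    constructor
    · rintro ⟨⟨a, haA, b, hbB, hx, hk⟩, b', hb'B, a', -, hx', hr⟩
      obtain ⟨rfl, rfl⟩ := (h.mk_eq_iff haA hb'B).1 (hx.symm.trans (hx'.trans Sym2.eq_swap))
      exact ⟨a, haA, b, hbB, hx, hk, hr.trans Sym2.eq_swap⟩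
    · rintro ⟨a, haA, b, hbB, hx, hk, hr⟩
      exact ⟨⟨a, haA, b, hbB, hx, hk⟩, b, hbB, a, haA, hx.trans Sym2.eq_swap, hr.trans Sym2.eq_swap⟩
  have hexists : ∀ a ∈ A, ∀ b ∈ B, ∀ x, f x = s(a, b) → ∃ k r, Cell G v c d x k r := by
    intro a haA b hbB x hx
    obtain ⟨k, hk⟩ := hedge a haA b₀ h₂
    obtain ⟨r, hr⟩ := hedge a₀ h₀ b hbB
    exact ⟨k, r, (hcell x k r).2 ⟨a, haA, b, hbB, hx, hk, hr⟩⟩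
  refine ⟨c, d, hexists a₀ h₀ b₀ h₂ v hv, ?_, ?_, ?_, ?_⟩
  · intro x k r hx x' k' r' hx'
    obtain ⟨a, haA, b, hbB, hx, hk, hr⟩ := (hcell x k r).1 hx
    obtain ⟨a', haA', b', hbB', hx', hk', hr'⟩ := (hcell x' k' r').1 hx'
    have ek : k = k' ↔ a = a' := by
      rw [← R.inj.eq_iff, hk, hk', h.mk_eq_iff haA h₂]; simp
    have er : r = r' ↔ b = b' := by
      rw [← R.inj.eq_iff, hr, hr', h.mk_eq_iff h₀ hbB']; simp
    rw [ek, er]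
    refine ⟨by rw [← R.inj.eq_iff, hx, hx', h.mk_eq_iff haA hbB'], ?_⟩
    rw [R.near_iff, hx, hx']
    constructor
    · rintro ⟨z, hz, hz'⟩
      rw [Sym2.mem_iff] at hz hz'
      rcases hz with rfl | rfl <;> rcases hz' with rfl | rfl
      · exact Or.inl rfl
      · exact absurd hbB' (h.disjoint _ haA)
      · exact absurd hbB (h.disjoint _ haA')
      · exact Or.inr rfl
    · rintro (rfl | rfl)
      · exact ⟨a, by simp, by simp⟩
      · exact ⟨b, by simp, by simp⟩
  · intro x k r hx y hxy
    obtain ⟨a, haA, b, hbB, hx, -, -⟩ := (hcell x k r).1 hx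
    obtain ⟨-, z, hzx, hzy⟩ := (R.adj x y).1 hxy
    obtain ⟨w, hw, hzw⟩ := R.exists_eq_of_mem hzy
    rw [hx, Sym2.mem_iff] at hzx
    rcases hzx with rfl | rfl
    · exact hexists z haA w ((h.left z haA w).1 hzw) y hw
    · exact hexists w ((h.right z hbB w).1 hzw) z hbB y (hw.trans Sym2.eq_swap)
  · intro k r hk hr
    obtain ⟨a, haA, hk⟩ := (h.onLine_iff R h₀ h₁ ha h₂ hv hc k).1 hk
    obtain ⟨b, hbB, hr⟩ := (h.swap.onLine_iff R h₂ h₃ hb h₀ hv' hd' r).1 hr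
    obtain ⟨x, hx⟩ := hedge a haA b hbB
    exact ⟨x, (hcell x k r).2 ⟨a, haA, b, hbB, hx, hk, hr.trans Sym2.eq_swap⟩⟩
  · rw [h.ncard_onLine R h₀ h₁ ha h₂ hv hc, h.swap.ncard_onLine R h₂ h₃ hb h₀ hv' hd', hcard]

end IsBipartiteComponent

/-- Closing all paths of length three makes the component complete bipartite. Its vertices are all
inner, so a maximal matching covers both sides, which therefore have equal size. -/
theorem IsInner.rookAt [Finite V] [Finite W] (R : IsRoot G H f) (hM : MissCondition G H f)
    (hB : NoBull H) {x : W} (hx : IsInner H x) {v : V} (hxv : x ∈ f v) : RookAt G v := by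
  obtain ⟨y₀, hv, hxy₀⟩ := R.exists_eq_of_mem hxv
  have hy₀ := hx.adj R hM hB hxy₀
  let A : Set W := {z | H.Adj y₀ z}
  let B : Set W := {y | H.Adj x y}
  have hBA : ∀ y ∈ B, ∀ z, H.Adj y z ↔ z ∈ A := by
    intro y (hy : H.Adj x y) z
    by_cases hyy : y = y₀
    · rw [hyy]; exact Iff.rfl
    by_cases hzx : z = x
    · rw [hzx]; exact ⟨fun _ => hxy₀.symm, fun _ => hy.symm⟩
    exact ⟨fun h => (hx.adj_of_path R hM hB hy hxy₀ h hzx (Ne.symm hyy)).symm,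
      fun h => (hx.adj_of_path R hM hB hxy₀ hy h hzx hyy).symm⟩
  have hcomp : IsBipartiteComponent H A B := by
    refine ⟨fun z hz w => ⟨fun hzw => ?_, fun hw => ((hBA w hw z).2 hz).symm⟩, hBA, ?_⟩
    · by_cases hzx : z = x
      · rwa [hzx] at hzw
      by_cases hwy : w = y₀
      · rw [hwy]; exact hxy₀
      exact (hy₀.adj_of_path R hM hB hz hxy₀.symm hzw hwy (Ne.symm hzx)).symm
    · exact fun z hz hz' => hx.noTriangle y₀ z hxy₀ hz' hz
  obtain ⟨S, -, hS⟩ := exists_isMaxStable_superset (G := G) (S := ∅) (by simp)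
  have hcard : A.ncard = B.ncard := le_antisymm
    (hcomp.ncard_le R hS.1 fun a ha => (hy₀.adj R hM hB ha).exists_mem R hM hS)
    (hcomp.swap.ncard_le R hS.1 fun b hb => (hx.adj R hM hB hb).exists_mem R hM hS)
  have two : ∀ {x y}, IsInner H x → H.Adj x y → ∃ y', y ≠ y' ∧ H.Adj x y' := by
    intro x y hx _
    obtain ⟨z, z', hz, hz', hne⟩ := hx.two
    by_cases h : y = z
    · exact ⟨z', fun e => hne (h.symm.trans e), hz'⟩
    · exact ⟨z, h, hz⟩
  obtain ⟨b₁, hb, hb₁⟩ := two hx hxy₀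
  obtain ⟨a₁, ha, ha₁⟩ := two hy₀ hxy₀.symm
  exact hcomp.rookAt R hcard (a₀ := x) hxy₀.symm ha₁ ha hxy₀ hb₁ hb hv

/-- A clique at `v` that escapes all simplicial vertices is a star or a triangle. Leaves and pendant
triangles would supply a simplicial vertex and diamonds an octahedral component. What remains is a
star at an inner vertex, which puts `v` in a rook component. -/
theorem IsRoot.admissible [Finite V] [Finite W] [Nonempty V] (R : IsRoot G H f)
    (hM : MissCondition G H f) (hB : NoBull H) : Admissible G := by
  refine ⟨⟨Classical.arbitrary V, rfl⟩, fun v => ?_⟩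
  by_contra! hno
  obtain ⟨hO, hRk, hcov⟩ := hno
  have hcov : ¬ Covered G v := fun h => hcov h (R.clawFreeAt v) (R.linearAt v)
  refine hcov fun y z hy hz hyz => ?_
  by_contra! hs
  have hC : G.IsClique {v, y, z} := by
    have n : ∀ {a b}, Near G a b → a ≠ b → G.Adj a b := fun h => h.adj
    rintro a (rfl | rfl | rfl) b (rfl | rfl | rfl) hab
    exacts [absurd rfl hab, n hy hab, n hz hab, n hy.symm hab, absurd rfl hab, n hyz hab,
      n hz.symm hab, n hyz.symm hab, absurd rfl hab]
  have hs' : ∀ s, Simplicial G s → ∃ u ∈ ({v, y, z} : Set V), ¬ Near G s u := by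
    intro s h1
    by_contra! h2
    exact hs s h1 (h2 v (by simp)) (h2 y (by simp)) (h2 z (by simp))
  have hsC : ∀ s ∈ ({v, y, z} : Set V), ¬ Simplicial G s := by
    intro s hsC h1
    obtain ⟨u, hu, hu'⟩ := hs' s h1
    exact hu' (near_of_isClique hC hsC hu)
  rcases R.clique_cases hC ⟨v, by simp⟩ with ⟨x, hx⟩ | ⟨a, b, c, hab, hbc, hac, ⟨p, hp, hp'⟩,
    ⟨q, hq, hq'⟩, r, hr, hr'⟩
  · have hxs : ∀ s, x ∈ f s → ¬ Simplicial G s := by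
      intro s hxs h1
      obtain ⟨u, hu, hu'⟩ := hs' s h1
      exact hu' (R.near_of_mem hxs (hx u hu))
    have hxv := hx v (by simp)
    obtain ⟨y₀, hy₀, hxy₀⟩ := R.exists_eq_of_mem hxv
    have hl : NoLeafAt H x := by
      intro l hxl
      by_contra! hno
      obtain ⟨s, hs⟩ := R.exists_eq hxl
      refine hxs s (by simp [hs]) (R.simplicial_of_leaf hs fun w hw => ?_)
      by_contra hwx
      exact hno w hwx hw
    have htri : ∀ b c, H.Adj x b → H.Adj x c → ¬ H.Adj b c := by
      intro b c hxb hxc hbc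
      rcases hB.triangle_cases hxb hbc hxc with h | h | h | ⟨d, h⟩ | ⟨d, h⟩ | ⟨d, h⟩
      · have hN : ∀ w, H.Adj x w → w = b ∨ w = c := by
          intro w hw
          by_contra! hne
          exact hM.not_isPendantTriangle R h hl hw hne.1 hne.2
        obtain ⟨s, hs⟩ := R.exists_eq hbc
        obtain ⟨u, hu, hu'⟩ := hs' s (R.simplicial_of_isPendantTriangle h hs)
        obtain ⟨w, hw, hxw⟩ := R.exists_eq_of_mem (hx u hu)
        refine hu' (R.near_of_mem (x := w) ?_ (by simp [hw]))
        rcases hN w hxw with rfl | rfl <;> simp [hs]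
      · obtain ⟨s, hs⟩ := R.exists_eq hxc
        exact hxs s (by simp [hs]) (R.simplicial_of_isPendantTriangle h hs)
      · obtain ⟨s, hs⟩ := R.exists_eq hxb
        exact hxs s (by simp [hs]) (R.simplicial_of_isPendantTriangle h hs)
      · exact hO (R.octahedralAt h (by simp) hxv)
      · exact hO (R.octahedralAt h (by simp) hxv)
      · exact hO (R.octahedralAt h (by simp) hxv)
    have htwo : ∃ w w', H.Adj x w ∧ H.Adj x w' ∧ w ≠ w' := by
      by_contra! hno
      refine hxs v hxv (R.simplicial_of_leaf (hy₀.trans Sym2.eq_swap) fun w hw => ?_)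
      exact hno w y₀ hw hxy₀
    exact hRk (IsInner.rookAt R hM hB ⟨htwo, hl, htri⟩ hxv)
  · have hvt : a ∈ f v ∨ b ∈ f v := by
      obtain ⟨w, hw, hw'⟩ := R.near_iff.1 (near_of_isClique hC hp (show v ∈ ({v, y, z} : Set V) by simp))
      rw [hp', Sym2.mem_iff] at hw
      rcases hw with rfl | rfl
      · exact Or.inl hw'
      · exact Or.inr hw'
    rcases hB.triangle_cases (R.hadj hp') (R.hadj hq') (R.hadj hr') with
      h | h | h | ⟨d, h⟩ | ⟨d, h⟩ | ⟨d, h⟩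
    · exact hsC q hq (R.simplicial_of_isPendantTriangle h hq')
    · exact hsC r hr (R.simplicial_of_isPendantTriangle h hr')
    · exact hsC p hp (R.simplicial_of_isPendantTriangle h hp')
    · exact hO (hvt.elim (R.octahedralAt h (by simp)) (R.octahedralAt h (by simp)))
    · exact hO (hvt.elim (R.octahedralAt h (by simp)) (R.octahedralAt h (by simp)))
    · exact hO (hvt.elim (R.octahedralAt h (by simp)) (R.octahedralAt h (by simp)))

end Structure

/-- In the empty graph the empty set is both a maximal clique and a maximal stable set, so the graph
is not CIS. This matches the demand for a vertex in `Admissible`. -/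
theorem IsCIS.nonempty {V : Type u} {G : SimpleGraph V} (h : IsCIS G) : Nonempty V := by
  by_contra hV
  rw [not_nonempty_iff] at hV
  obtain ⟨x, -⟩ := h ∅ ∅ ⟨by simp, fun _ _ _ x _ => isEmptyElim x⟩
    ⟨by simp, fun _ _ _ x _ => isEmptyElim x⟩
  exact isEmptyElim x

theorem isLineGraph_and_isCIS_iff {V : Type} [Finite V] (G : SimpleGraph V) :
    IsLineGraph G ∧ IsCIS G ↔ Admissible G := by
  refine ⟨fun ⟨⟨W, hW, H, ⟨e⟩⟩, hC⟩ => ?_, fun h => ⟨h.isLineGraph, h.isCIS⟩⟩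
  have := hC.nonempty
  have R := isRoot_of_iso e
  obtain ⟨hb, hM⟩ := ((tfae_of_iso G H ⟨e⟩).out 0 6).1 hC
  exact R.admissible (R.maxMatchingCondition_iff.1 hM) (bull_free_iff.1 hb)

end CISGraph

theorem mainTheorem1 :
    (∀ {V : Type*} {W : Type*} [Finite V] [Nonempty V] [Finite W]
      (G : SimpleGraph V) (H : SimpleGraph W), Nonempty (G ≃g H.lineGraph) →
      List.TFAE [
        CISGraph.IsCIS G,
        CISGraph.Cap CISGraph.IsGeneralPartition G,
        CISGraph.Cap CISGraph.IsSemiWeaklyCIS G,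
        CISGraph.Cap CISGraph.IsStronglyEquistable G,
        CISGraph.Cap CISGraph.IsEquistable G,
        CISGraph.Cap CISGraph.IsTriangle G,
        CISGraph.bull.Free H ∧ CISGraph.MaxMatchingCondition H,
        CISGraph.bull.Free H ∧ CISGraph.LocalMatchingCondition H]) ∧
    CISGraph.PolyTimeRecognizable
      (fun G => CISGraph.IsLineGraph G ∧ CISGraph.IsCIS G) := by
  refine ⟨fun G H e => CISGraph.tfae_of_iso G H e, ?_⟩
  refine CISGraph.polyTimeRecognizable_of_dec (CISGraph.dec_admissible.congr fun n G _ => ?_)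
  exact (CISGraph.isLineGraph_and_isCIS_iff G).symm
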